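/- **Conventions.** A quasi-bialgebra is a unital associative algebra $H$ over a field with algebra homomorphisms $\varepsilon:H\to\mathbb F$ and $\Delta:H\to H\otimes H$ and an invertible $\Phi\in H^{\otimes 3}$ such that $(\varepsilon\otimes1)\Delta=1=(1\otimes\varepsilon)\Delta$, $(1\otimes\Delta)\Delta(a)=\Phi^{-1}(\Delta\otimes1)\Delta(a)\,\Phi$ for all $a\in H$, $(\Delta\otimes1\otimes1)\Phi\,(1\otimes1\otimes\Delta)\Phi=(\Phi\otimes1)\,(1\otimes\Delta\otimes1)\Phi\,(1\otimes\Phi)$ and $(1\otimes\varepsilon\otimes1)\Phi=1$. Write $\Phi=\sum X\otimes Y\otimes Z$, $\Phi^{-1}=\sum\bar X\otimes\bar Y\otimes\bar Z$ and $\Delta(a)=\sum a_{(1)}\otimes a_{(2)}$. It is a quasi-Hopf algebra if moreover it has a bijective algebra anti-homomorphism $S:H\to H$ and $\alpha,\beta\in H$ with $\sum S(X)\alpha Y\beta S(Z)=1=\sum\bar X\beta S(\bar Y)\alpha\bar Z$, $\sum S(a_{(1)})\alpha a_{(2)}=\varepsilon(a)\alpha$ and $\sum a_{(1)}\beta S(a_{(2)})=\varepsilon(a)\beta$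 for all $a\in H$. A twist is an invertible $F\in H\otimes H$ with $(\varepsilon\otimes1)F=(1\otimes\varepsilon)F=1$. A $*$-quasi-Hopf algebra ($*$-QHA) is a quasi-Hopf algebra over $\mathbb C$ with an antilinear map $\dagger:H\to H$ satisfying $(a^\dagger)^\dagger=a$, $(ab)^\dagger=b^\dagger a^\dagger$ (extended to tensor powers by $(a\otimes b)^\dagger=a^\dagger\otimes b^\dagger$) and a twist $\Omega\in H\otimes H$, the $*$-canonical element, such that, for all $a\in H$, $\varepsilon(a^\dagger)=\overline{\varepsilon(a)}$, $\Delta(a)^\dagger=\Omega\,\Delta(a^\dagger)\,\Omega^{-1}$ and $$(\Phi^\dagger)^{-1}=(\Omega\otimes1)\,(\Delta\otimes1)\Omega\;\Phi\;(1\otimes\Delta)\Omega^{-1}\,(1\otimes\Omega^{-1}).$$ Let $T(a\otimes b)=b\otimes a$, $x^T=T(x)$ for $x\in H\otimes H$, and $\Delta^T=T\circ\Delta$. Put $\gamma=\sum S(B)\alpha C\otimes S(A)\alpha D$, where $\sum A\otimes B\otimes C\otimes D=(\Phi^{-1}\otimes1)\,(\Delta\otimes1\otimes1)\Phi$. The Drinfeld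 twist and the second Drinfeld twist are $$F_\delta=\sum (S\otimes S)\Delta^T(X)\;\gamma\;\Delta\bigl(Y\beta S(Z)\bigr),\qquad F_0=(S^{-1}\otimes S^{-1})F_\delta^T .$$ Let $\tilde S(a)=\bigl(S^{-1}(a^\dagger)\bigr)^\dagger$, and, with $\Omega=\sum\Omega_i\otimes\Omega^i$ and $\Omega^{-1}=\sum\bar\Omega_i\otimes\bar\Omega^i$, let $\alpha_\Omega=\sum S(\bar\Omega_i)\alpha\bar\Omega^i$ and $\beta_\Omega=\sum\Omega_i\beta S(\Omega^i)$. **Theorem.** Let $H$ be a $*$-QHA with $*$-canonical element $\Omega$. There is a unique invertible $w\in H$ such that $$w\,S^{-1}(\beta)^\dagger=\alpha_\Omega,\qquad \beta_\Omega\,w=S^{-1}(\alpha)^\dagger,\qquad S(a)=w\,\tilde S(a)\,w^{-1}\quad\text{for all }a\in H .$$ The elements $F_\delta$ and $F_0$ are invertible in $H\otimes H$ and, with $W=S^{-1}(w)\otimes S^{-1}(w)$, $$F_\delta^\dagger=\Omega\,\Delta\bigl(S^{-1}(w^{-1})\bigr)\,F_0^{-1}\,(S^{-1}\otimes S^{-1})\Omega^T\;W,$$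 $$F_0^\dagger=\Omega\,\Delta(w^{-1})\,F_\delta^{-1}\,(S\otimes S)\Omega^T\,(w\otimes w),$$ $$\Omega^{-1}F_\delta^\dagger\,W^{-1}\,(S^{-1}\otimes S^{-1})(\Omega^T)^{-1}\,F_0\,\Delta\bigl(S^{-1}(w)\bigr)=1\otimes1 .$$ -/

import Mathlib

open scoped TensorProduct

noncomputable section

namespace QHA

section Maps

variable {𝕜 H A M N : Type*} [Field 𝕜] [Ring H] [Algebra 𝕜 H] [Ring A] [Algebra 𝕜 A]
  [AddCommGroup M] [Module 𝕜 M] [AddCommGroup N] [Module 𝕜 N]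

/-- `m ∘ (f ⊗ g)`, that is, `x ⊗ y ↦ f x * g y`. -/
def mulMap (f : M →ₗ[𝕜] A) (g : N →ₗ[𝕜] A) : M ⊗[𝕜] N →ₗ[𝕜] A :=
  LinearMap.mul' 𝕜 A ∘ₗ TensorProduct.map f g

/-- `m ∘ (m ⊗ 1) ∘ (f ⊗ g ⊗ h)`, that is, `x ⊗ y ⊗ z ↦ f x * g y * h z`. -/
def mulMap₃ (f g h : H →ₗ[𝕜] A) : H ⊗[𝕜] H ⊗[𝕜] H →ₗ[𝕜] A :=
  mulMap (mulMap f g) h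

/-- The flip `T (a ⊗ b) = b ⊗ a` on `H ⊗ H`. -/
def flip : H ⊗[𝕜] H ≃ₗ[𝕜] H ⊗[𝕜] H := TensorProduct.comm 𝕜 H H

/-- `ε ⊗ 1 : H ⊗ H → H`. -/
def counitOne (ε : H →ₐ[𝕜] 𝕜) : H ⊗[𝕜] H →ₐ[𝕜] H :=
  (Algebra.TensorProduct.lid 𝕜 H).toAlgHom.comp
    (Algebra.TensorProduct.map ε (AlgHom.id 𝕜 H))

/-- `1 ⊗ ε : H ⊗ H → H`. -/
def oneCounit (ε : H →ₐ[𝕜] 𝕜) : H ⊗[𝕜] H →ₐ[𝕜] H :=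
  (Algebra.TensorProduct.rid 𝕜 𝕜 H).toAlgHom.comp
    (Algebra.TensorProduct.map (AlgHom.id 𝕜 H) ε)

/-- `1 ⊗ ε ⊗ 1 : H ⊗ H ⊗ H → H ⊗ H`. -/
def oneCounitOne (ε : H →ₐ[𝕜] 𝕜) : H ⊗[𝕜] H ⊗[𝕜] H →ₐ[𝕜] H ⊗[𝕜] H :=
  Algebra.TensorProduct.map (oneCounit ε) (AlgHom.id 𝕜 H)

/-- `a ⊗ b ↦ a ⊗ b ⊗ 1`. -/
def tensorOne₂ : H ⊗[𝕜] H →ₐ[𝕜] H ⊗[𝕜] H ⊗[𝕜] H := Algebra.TensorProduct.includeLeft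

/-- `a ⊗ b ↦ 1 ⊗ a ⊗ b`. -/
def oneTensor₂ : H ⊗[𝕜] H →ₐ[𝕜] H ⊗[𝕜] H ⊗[𝕜] H :=
  (Algebra.TensorProduct.assoc 𝕜 𝕜 𝕜 H H H).symm.toAlgHom.comp
    Algebra.TensorProduct.includeRight

/-- `a ⊗ b ⊗ c ↦ a ⊗ b ⊗ c ⊗ 1`. The fourth tensor power is `(H ⊗ H) ⊗ (H ⊗ H)` throughout. -/
def tensorOne₃ : H ⊗[𝕜] H ⊗[𝕜] H →ₐ[𝕜] (H ⊗[𝕜] H) ⊗[𝕜] (H ⊗[𝕜] H) :=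
  Algebra.TensorProduct.map (AlgHom.id 𝕜 (H ⊗[𝕜] H)) Algebra.TensorProduct.includeLeft

/-- `a ⊗ b ⊗ c ↦ 1 ⊗ a ⊗ b ⊗ c`. -/
def oneTensor₃ : H ⊗[𝕜] H ⊗[𝕜] H →ₐ[𝕜] (H ⊗[𝕜] H) ⊗[𝕜] (H ⊗[𝕜] H) :=
  (Algebra.TensorProduct.map Algebra.TensorProduct.includeRight (AlgHom.id 𝕜 (H ⊗[𝕜] H))).comp
    (Algebra.TensorProduct.assoc 𝕜 𝕜 𝕜 H H H).toAlgHom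

/-- `Δ ⊗ 1 : H ⊗ H → H ⊗ H ⊗ H`. -/
def comulOne (Δ : H →ₐ[𝕜] H ⊗[𝕜] H) : H ⊗[𝕜] H →ₐ[𝕜] H ⊗[𝕜] H ⊗[𝕜] H :=
  Algebra.TensorProduct.map Δ (AlgHom.id 𝕜 H)

/-- `1 ⊗ Δ : H ⊗ H → H ⊗ H ⊗ H`. -/
def oneComul (Δ : H →ₐ[𝕜] H ⊗[𝕜] H) : H ⊗[𝕜] H →ₐ[𝕜] H ⊗[𝕜] H ⊗[𝕜] H :=
  (Algebra.TensorProduct.assoc 𝕜 𝕜 𝕜 H H H).symm.toAlgHom.comp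
    (Algebra.TensorProduct.map (AlgHom.id 𝕜 H) Δ)

/-- `Δ ⊗ 1 ⊗ 1`. -/
def comulOneOne (Δ : H →ₐ[𝕜] H ⊗[𝕜] H) :
    H ⊗[𝕜] H ⊗[𝕜] H →ₐ[𝕜] (H ⊗[𝕜] H) ⊗[𝕜] (H ⊗[𝕜] H) :=
  (Algebra.TensorProduct.map Δ (AlgHom.id 𝕜 (H ⊗[𝕜] H))).comp
    (Algebra.TensorProduct.assoc 𝕜 𝕜 𝕜 H H H).toAlgHom

/-- `1 ⊗ Δ ⊗ 1`. -/
def oneComulOne (Δ : H →ₐ[𝕜] H ⊗[𝕜] H) :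
    H ⊗[𝕜] H ⊗[𝕜] H →ₐ[𝕜] (H ⊗[𝕜] H) ⊗[𝕜] (H ⊗[𝕜] H) :=
  (Algebra.TensorProduct.assoc 𝕜 𝕜 𝕜 (H ⊗[𝕜] H) H H).toAlgHom.comp
    (Algebra.TensorProduct.map (oneComul Δ) (AlgHom.id 𝕜 H))

/-- `1 ⊗ 1 ⊗ Δ`. -/
def oneOneComul (Δ : H →ₐ[𝕜] H ⊗[𝕜] H) :
    H ⊗[𝕜] H ⊗[𝕜] H →ₐ[𝕜] (H ⊗[𝕜] H) ⊗[𝕜] (H ⊗[𝕜] H) :=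
  Algebra.TensorProduct.map (AlgHom.id 𝕜 (H ⊗[𝕜] H)) Δ

end Maps

/-- A quasi-bialgebra structure on a unital associative algebra `H`: co-unit `ε`, co-product `Δ`
and an invertible co-associator `Φ`. -/
structure QuasiBialgebra (𝕜 H : Type*) [Field 𝕜] [Ring H] [Algebra 𝕜 H] where
  /-- the co-unit -/
  ε : H →ₐ[𝕜] 𝕜
  /-- the co-product -/
  Δ : H →ₐ[𝕜] H ⊗[𝕜] H
  /-- the co-associator -/
  Φ : (H ⊗[𝕜] H ⊗[𝕜] H)ˣ
  counit_comul : ∀ a, counitOne ε (Δ a) = a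
  comul_counit : ∀ a, oneCounit ε (Δ a) = a
  quasi_coassoc : ∀ a, oneComul Δ (Δ a) = ↑Φ⁻¹ * comulOne Δ (Δ a) * ↑Φ
  pentagon : comulOneOne Δ (Φ : H ⊗[𝕜] H ⊗[𝕜] H) * oneOneComul Δ (Φ : H ⊗[𝕜] H ⊗[𝕜] H) =
    tensorOne₃ (Φ : H ⊗[𝕜] H ⊗[𝕜] H) * oneComulOne Δ (Φ : H ⊗[𝕜] H ⊗[𝕜] H) *
      oneTensor₃ (Φ : H ⊗[𝕜] H ⊗[𝕜] H)
  counit_coassociator : oneCounitOne ε (Φ : H ⊗[𝕜] H ⊗[𝕜] H) = 1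

/-- A quasi-Hopf algebra structure on `H`, with bijective antipode `S` and canonical elements
`α`, `β`. -/
structure QuasiHopfAlgebra (𝕜 H : Type*) [Field 𝕜] [Ring H] [Algebra 𝕜 H] extends
    QuasiBialgebra 𝕜 H where
  /-- the antipode, a bijective unital algebra anti-homomorphism -/
  S : H ≃ₗ[𝕜] H
  S_one : S 1 = 1
  S_mul : ∀ a b, S (a * b) = S b * S a
  /-- the first canonical element -/
  α : H
  /-- the second canonical element -/
  β : H
  /-- `∑ S(X) α Y β S(Z) = 1`, where `Φ = ∑ X ⊗ Y ⊗ Z` -/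
  antipode_coassociator :
    mulMap₃ S.toLinearMap (LinearMap.mulLeftRight 𝕜 (α, β)) S.toLinearMap
      (Φ : H ⊗[𝕜] H ⊗[𝕜] H) = 1
  /-- `∑ X' β S(Y') α Z' = 1`, where `Φ⁻¹ = ∑ X' ⊗ Y' ⊗ Z'` -/
  antipode_coassociator_inv :
    mulMap₃ LinearMap.id (LinearMap.mulLeftRight 𝕜 (β, α) ∘ₗ S.toLinearMap) LinearMap.id
      (↑Φ⁻¹ : H ⊗[𝕜] H ⊗[𝕜] H) = 1
  /-- `∑ S(a₁) α a₂ = ε(a) α` -/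
  antipode_left : ∀ a, mulMap S.toLinearMap (LinearMap.mulLeft 𝕜 α) (Δ a) = ε a • α
  /-- `∑ a₁ β S(a₂) = ε(a) β` -/
  antipode_right : ∀ a,
    mulMap LinearMap.id (LinearMap.mulLeft 𝕜 β ∘ₗ S.toLinearMap) (Δ a) = ε a • β

/-- An invertible element `F` of `H ⊗ H` is a twist if `(ε ⊗ 1) F = (1 ⊗ ε) F = 1`. -/
def QuasiBialgebra.IsTwist {𝕜 H : Type*} [Field 𝕜] [Ring H] [Algebra 𝕜 H]
    (Q : QuasiBialgebra 𝕜 H) (F : (H ⊗[𝕜] H)ˣ) : Prop :=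
  counitOne Q.ε (F : H ⊗[𝕜] H) = 1 ∧ oneCounit Q.ε (F : H ⊗[𝕜] H) = 1

/-- The twisted co-associator
`Φ_F = (F ⊗ 1) (Δ ⊗ 1)F Φ (1 ⊗ Δ)F⁻¹ (1 ⊗ F⁻¹)`. -/
def QuasiBialgebra.twistΦ {𝕜 H : Type*} [Field 𝕜] [Ring H] [Algebra 𝕜 H]
    (Q : QuasiBialgebra 𝕜 H) (F : (H ⊗[𝕜] H)ˣ) : H ⊗[𝕜] H ⊗[𝕜] H :=
  tensorOne₂ (F : H ⊗[𝕜] H) * comulOne Q.Δ (F : H ⊗[𝕜] H) * ↑Q.Φ *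
    oneComul Q.Δ (↑F⁻¹ : H ⊗[𝕜] H) * oneTensor₂ (↑F⁻¹ : H ⊗[𝕜] H)

namespace QuasiHopfAlgebra

variable {𝕜 H : Type*} [Field 𝕜] [Ring H] [Algebra 𝕜 H] (Q : QuasiHopfAlgebra 𝕜 H)

/-- The twisted canonical element `α_F = m (1 ⊗ α)(S ⊗ 1)F⁻¹`. -/
def twistα (F : (H ⊗[𝕜] H)ˣ) : H :=
  mulMap Q.S.toLinearMap (LinearMap.mulLeft 𝕜 Q.α) (↑F⁻¹ : H ⊗[𝕜] H)

/-- The twisted canonical element `β_F = m (1 ⊗ β)(1 ⊗ S)F`. -/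
def twistβ (F : (H ⊗[𝕜] H)ˣ) : H :=
  mulMap LinearMap.id (LinearMap.mulLeft 𝕜 Q.β ∘ₗ Q.S.toLinearMap) (F : H ⊗[𝕜] H)

/-- `S ⊗ S`, with inverse `S⁻¹ ⊗ S⁻¹`. -/
def SS : H ⊗[𝕜] H ≃ₗ[𝕜] H ⊗[𝕜] H := TensorProduct.congr Q.S Q.S

/-- The linear map `A ⊗ B ⊗ C ⊗ D ↦ S(B) α C ⊗ S(A) α D`. -/
def γMap : (H ⊗[𝕜] H) ⊗[𝕜] (H ⊗[𝕜] H) →ₗ[𝕜] H ⊗[𝕜] H :=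
  TensorProduct.map (mulMap Q.S.toLinearMap (LinearMap.mulLeft 𝕜 Q.α))
      (mulMap Q.S.toLinearMap (LinearMap.mulLeft 𝕜 Q.α)) ∘ₗ
    (TensorProduct.tensorTensorTensorComm 𝕜 H H H H).toLinearMap ∘ₗ
    TensorProduct.map (flip (𝕜 := 𝕜) (H := H)).toLinearMap LinearMap.id

/-- `γ = ∑ S(B) α C ⊗ S(A) α D`, where
`∑ A ⊗ B ⊗ C ⊗ D = (Φ⁻¹ ⊗ 1) (Δ ⊗ 1 ⊗ 1)Φ`. -/
def γ : H ⊗[𝕜] H :=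
  Q.γMap (tensorOne₃ (↑Q.Φ⁻¹ : H ⊗[𝕜] H ⊗[𝕜] H) *
    comulOneOne Q.Δ (Q.Φ : H ⊗[𝕜] H ⊗[𝕜] H))

/-- The Drinfeld twist `F_δ = ∑ (S ⊗ S)(Δᵀ(X)) γ Δ(Y β S(Z))`, where `Φ = ∑ X ⊗ Y ⊗ Z` and
`Δᵀ = T ∘ Δ`. -/
def drinfeldTwist : H ⊗[𝕜] H :=
  mulMap (Q.SS.toLinearMap ∘ₗ (flip (𝕜 := 𝕜) (H := H)).toLinearMap ∘ₗ Q.Δ.toLinearMap)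
    (LinearMap.mulLeft 𝕜 Q.γ ∘ₗ Q.Δ.toLinearMap ∘ₗ
      mulMap LinearMap.id (LinearMap.mulLeft 𝕜 Q.β ∘ₗ Q.S.toLinearMap))
    (TensorProduct.assoc 𝕜 H H H (Q.Φ : H ⊗[𝕜] H ⊗[𝕜] H))

/-- The second Drinfeld twist `F₀ = (S⁻¹ ⊗ S⁻¹)(F_δᵀ)`. -/
def secondDrinfeldTwist : H ⊗[𝕜] H := Q.SS.symm (flip Q.drinfeldTwist)

end QuasiHopfAlgebra

/-- A `*`-quasi-Hopf algebra structure on a complex algebra `H` with conjugation `star`, together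
with its `*`-canonical element `Ω`. On tensor powers `star (a ⊗ b) = star a ⊗ star b`. -/
structure StarQuasiHopfAlgebra (H : Type*) [Ring H] [Algebra ℂ H] [StarRing H] [StarModule ℂ H]
    extends QuasiHopfAlgebra ℂ H where
  /-- the `*`-canonical element -/
  Ω : (H ⊗[ℂ] H)ˣ
  isTwist_Ω : toQuasiBialgebra.IsTwist Ω
  counit_star : ∀ a, ε (star a) = star (ε a)
  comul_star : ∀ a, star (Δ a) = ↑Ω * Δ (star a) * ↑Ω⁻¹
  coassociator_star : (↑(star Φ)⁻¹ : H ⊗[ℂ] H ⊗[ℂ] H) = toQuasiBialgebra.twistΦ Ω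

namespace StarQuasiHopfAlgebra

variable {H : Type*} [Ring H] [Algebra ℂ H] [StarRing H] [StarModule ℂ H]
  (Q : StarQuasiHopfAlgebra H)

/-- The conjugate antipode `S̃(a) = (S⁻¹(a†))†`. -/
def conjS (a : H) : H := star (Q.S.symm (star a))

/-- The invertible element `w` intertwines the conjugate antipode structure
`(S̃, S⁻¹(β)†, S⁻¹(α)†)` and the structure `(S, α_Ω, β_Ω)` twisted by `Ω`. -/
def IsIntertwiner (w : Hˣ) : Prop :=
  ↑w * star (Q.S.symm Q.β) = Q.twistα Q.Ω ∧
  Q.twistβ Q.Ω * ↑w = star (Q.S.symm Q.α) ∧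
  ∀ a, Q.S a = ↑w * Q.conjS a * ↑w⁻¹

end StarQuasiHopfAlgebra

end QHA

end

open scoped TensorProduct

set_option linter.unusedSimpArgs false

/-! The whole theorem rests on one uniqueness principle. For a quasi-bialgebra and a homomorphism f
: H → A, call an anti-homomorphism g : H → A with elements α, β of A an antipode along f if the
antipode axioms hold with f in place of the identity (`IsAntipode`). Given two of them, (g, α, β)
and (g', α', β'), the element U = ∑ g(X) α f(Y) β' g'(Z) satisfies U α' = α, β U = β' and U g'(a) =
g(a) U. It is invertible, its inverse being obtained by exchanging the two triples, and it is
determined by the relations with α' and g' (`evCoevMap_mul`, `mul_evCoevMap`,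
`evCoevMap_intertwines`, `eq_evCoevMap`).

Along Δ there are two antipodes: (Δ ∘ S, Δ(α), Δ(β)) and ((S ⊗ S)Δᵀ, γ, δ). Their intertwiner is
F_δ, hence F_δ is invertible and is characterized by F_δ Δ(α) = γ and F_δ Δ(S(a)) = (S ⊗ S)Δᵀ(a)
F_δ. The hard point is that the second triple is an antipode (`isAntipode_comulS`): several
pentagons on six tensor legs must be contracted (`contract_six`, `contract_six'`).

Along the identity, the principle is applied to the conjugate quasi-bialgebra, with co-product
Δ(a†)† and co-associator (Φ†)⁻¹. The axioms on Ω say that it is the twist of H by Ω, so it carries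
both the twisted antipode (S, α_Ω, β_Ω) and the conjugate one (S̃, S⁻¹(β)†, S⁻¹(α)†). Their
intertwiner is w.

The conjugation formulas follow from computing the Drinfeld twist of the conjugate algebra in two
ways. By its characterization it is (F₀†)⁻¹ (`star_secondDrinfeldUnit_mul_drinfeldUnit_conj`). By
its behaviour under twisting and under a change of antipode, it is expressed through F_δ, Ω and w
(`drinfeldUnit_twist`). Equating the two gives F₀†, applying (S⁻¹ ⊗ S⁻¹)T gives F_δ†, and the last
identity is a cancellation. -/

namespace QHA

/-! ### Evaluating tensors along commuting homomorphisms ("legs") -/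

section Legs

variable {𝕜 H A B M N : Type*} [Field 𝕜] [Ring H] [Algebra 𝕜 H] [Ring A] [Algebra 𝕜 A]
  [Ring B] [Algebra 𝕜 B] [AddCommGroup M] [Module 𝕜 M] [AddCommGroup N] [Module 𝕜 N]

@[simp]
theorem mulMap_tmul (f : M →ₗ[𝕜] A) (g : N →ₗ[𝕜] A) (x : M) (y : N) :
    mulMap f g (x ⊗ₜ y) = f x * g y := by
  simp [mulMap]

@[simp]
theorem mulMap₃_tmul (f g h : H →ₗ[𝕜] A) (x y z : H) :
    mulMap₃ f g h (x ⊗ₜ y ⊗ₜ z) = f x * g y * h z := by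
  simp [mulMap₃]

@[simp]
theorem flip_tmul (x y : H) : flip (x ⊗ₜ[𝕜] y) = y ⊗ₜ x := by
  simp [flip]

@[simp]
theorem counitOne_tmul (ε : H →ₐ[𝕜] 𝕜) (x y : H) : counitOne ε (x ⊗ₜ y) = ε x • y := by
  simp [counitOne]

@[simp]
theorem oneCounit_tmul (ε : H →ₐ[𝕜] 𝕜) (x y : H) : oneCounit ε (x ⊗ₜ y) = ε y • x := by
  simp [oneCounit]

@[simp]
theorem tensorOne₂_apply (x : H ⊗[𝕜] H) : tensorOne₂ x = x ⊗ₜ 1 := rfl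

@[simp]
theorem oneTensor₂_tmul (x y : H) : oneTensor₂ (x ⊗ₜ[𝕜] y) = 1 ⊗ₜ x ⊗ₜ y := by
  simp [oneTensor₂]

@[simp]
theorem tensorOne₃_tmul (x : H ⊗[𝕜] H) (y : H) : tensorOne₃ (x ⊗ₜ y) = x ⊗ₜ (y ⊗ₜ 1) := by
  simp [tensorOne₃]

@[simp]
theorem oneTensor₃_tmul (x y z : H) :
    oneTensor₃ (x ⊗ₜ[𝕜] y ⊗ₜ[𝕜] z) = (1 ⊗ₜ x) ⊗ₜ (y ⊗ₜ z) := by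
  simp [oneTensor₃]

@[simp]
theorem comulOne_tmul (Δ : H →ₐ[𝕜] H ⊗[𝕜] H) (x y : H) : comulOne Δ (x ⊗ₜ y) = Δ x ⊗ₜ y := by
  simp [comulOne]

theorem oneComul_tmul (Δ : H →ₐ[𝕜] H ⊗[𝕜] H) (x y : H) :
    oneComul Δ (x ⊗ₜ y) = (TensorProduct.assoc 𝕜 H H H).symm (x ⊗ₜ Δ y) := by
  simp only [oneComul, AlgHom.comp_apply, Algebra.TensorProduct.map_tmul, AlgHom.id_apply]
  rfl

@[simp]
theorem comulOneOne_tmul (Δ : H →ₐ[𝕜] H ⊗[𝕜] H) (x y z : H) :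
    comulOneOne Δ (x ⊗ₜ y ⊗ₜ z) = Δ x ⊗ₜ (y ⊗ₜ z) := by
  simp [comulOneOne]

theorem oneComulOne_tmul (Δ : H →ₐ[𝕜] H ⊗[𝕜] H) (x : H ⊗[𝕜] H) (z : H) :
    oneComulOne Δ (x ⊗ₜ z) = TensorProduct.assoc 𝕜 (H ⊗[𝕜] H) H H (oneComul Δ x ⊗ₜ z) := by
  simp only [oneComulOne, AlgHom.comp_apply, Algebra.TensorProduct.map_tmul, AlgHom.id_apply]
  rfl

@[simp]
theorem oneOneComul_tmul (Δ : H →ₐ[𝕜] H ⊗[𝕜] H) (x : H ⊗[𝕜] H) (z : H) :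
    oneOneComul Δ (x ⊗ₜ z) = x ⊗ₜ Δ z := by
  simp [oneOneComul]

/-- A linear map is multiplicative if it is a homomorphism of unital algebras. -/
structure IsHom (φ : H →ₗ[𝕜] B) : Prop where
  map_one : φ 1 = 1
  map_mul : ∀ a b, φ (a * b) = φ a * φ b

/-- `c` intertwines `φ` and `φ'`: `c φ(a) = φ'(a) c`. -/
def Sc (c : B) (φ φ' : H →ₗ[𝕜] B) : Prop := ∀ a, SemiconjBy c (φ a) (φ' a)

/-- The images of `φ` and `ψ` commute. -/
def Com (φ ψ : H →ₗ[𝕜] B) : Prop := ∀ a, Sc (φ a) ψ ψ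

theorem Com.symm {φ ψ : H →ₗ[𝕜] B} (h : Com φ ψ) : Com ψ φ :=
  fun a b => (show Commute (φ b) (ψ a) from h b a).symm

/-- The linear map `x ⊗ y ⊗ z ⊗ u ↦ φ x * ψ y * χ z * ω u`. -/
def mulMap₄ (φ ψ χ ω : H →ₗ[𝕜] B) : (H ⊗[𝕜] H) ⊗[𝕜] (H ⊗[𝕜] H) →ₗ[𝕜] B :=
  mulMap (mulMap φ ψ) (mulMap χ ω)

@[simp]
theorem mulMap₄_tmul (φ ψ χ ω : H →ₗ[𝕜] B) (x y z u : H) :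
    mulMap₄ φ ψ χ ω ((x ⊗ₜ y) ⊗ₜ (z ⊗ₜ u)) = φ x * ψ y * (χ z * ω u) := by
  simp [mulMap₄]

variable {φ φ' ψ ψ' χ χ' ω ω' : H →ₗ[𝕜] B} {c d : B}

theorem sc_mulMap (h₁ : Sc c φ φ') (h₂ : Sc c ψ ψ') (x : H ⊗[𝕜] H) :
    SemiconjBy c (mulMap φ ψ x) (mulMap φ' ψ' x) := by
  induction x with
  | zero => simp
  | tmul a b => simpa using (h₁ a).mul_right (h₂ b)
  | add a b ha hb => simpa using ha.add_right hb

theorem sc_mulMap₃ (h₁ : Sc c φ φ') (h₂ : Sc c ψ ψ') (h₃ : Sc c χ χ') (x : H ⊗[𝕜] H ⊗[𝕜] H) :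
    SemiconjBy c (mulMap₃ φ ψ χ x) (mulMap₃ φ' ψ' χ' x) := by
  induction x with
  | zero => simp
  | tmul a b => simpa [mulMap₃] using (sc_mulMap h₁ h₂ a).mul_right (h₃ b)
  | add a b ha hb => simpa using ha.add_right hb

/-- For commuting homomorphisms this is the universal property of the algebra H ⊗ H. Identities
between tensors are pushed through such maps, so that tensor positions become homomorphisms into a
common algebra. -/
theorem mulMap_mul (h₁ : IsHom φ) (h₂ : IsHom ψ) (h : Com φ ψ) (x y : H ⊗[𝕜] H) :
    mulMap φ ψ (x * y) = mulMap φ ψ x * mulMap φ ψ y := by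
  induction x with
  | zero => simp
  | add a b ha hb => simp [add_mul, ha, hb]
  | tmul a b =>
    induction y with
    | zero => simp
    | add a b ha hb => simp [mul_add, ha, hb]
    | tmul a' b' =>
      have := (h a' b).eq
      simp only [Algebra.TensorProduct.tmul_mul_tmul, mulMap_tmul, h₁.map_mul, h₂.map_mul]
      simp only [mul_assoc]
      rw [← mul_assoc (φ a'), this, mul_assoc]

theorem mulMap_one (h₁ : IsHom φ) (h₂ : IsHom ψ) : mulMap φ ψ 1 = 1 := by
  simp [Algebra.TensorProduct.one_def, h₁.map_one, h₂.map_one]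

theorem mulMap₃_mul (h₁ : IsHom φ) (h₂ : IsHom ψ) (h₃ : IsHom χ) (h₁₂ : Com φ ψ)
    (h₁₃ : Com φ χ) (h₂₃ : Com ψ χ) (x y : H ⊗[𝕜] H ⊗[𝕜] H) :
    mulMap₃ φ ψ χ (x * y) = mulMap₃ φ ψ χ x * mulMap₃ φ ψ χ y := by
  induction x with
  | zero => simp
  | add a b ha hb => simp [add_mul, ha, hb]
  | tmul a b =>
    induction y with
    | zero => simp
    | add a b ha hb => simp [mul_add, ha, hb]
    | tmul a' b' =>
      have := (sc_mulMap (h₁₃.symm b) (h₂₃.symm b) a').eq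
      simp only [mulMap₃, Algebra.TensorProduct.tmul_mul_tmul, mulMap_tmul, h₃.map_mul,
        mulMap_mul h₁ h₂ h₁₂]
      simp only [mul_assoc]
      rw [← mul_assoc (χ b), this, mul_assoc]

theorem mulMap₃_one (h₁ : IsHom φ) (h₂ : IsHom ψ) (h₃ : IsHom χ) : mulMap₃ φ ψ χ 1 = 1 := by
  simp [Algebra.TensorProduct.one_def, h₁.map_one, h₂.map_one, h₃.map_one]

theorem mulMap₄_mul (h₁ : IsHom φ) (h₂ : IsHom ψ) (h₃ : IsHom χ) (h₄ : IsHom ω)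
    (h₁₂ : Com φ ψ) (h₁₃ : Com φ χ) (h₁₄ : Com φ ω) (h₂₃ : Com ψ χ) (h₂₄ : Com ψ ω)
    (h₃₄ : Com χ ω) (x y : (H ⊗[𝕜] H) ⊗[𝕜] (H ⊗[𝕜] H)) :
    mulMap₄ φ ψ χ ω (x * y) = mulMap₄ φ ψ χ ω x * mulMap₄ φ ψ χ ω y := by
  induction x with
  | zero => simp
  | add a b ha hb => simp [add_mul, ha, hb]
  | tmul a b =>
    induction y with
    | zero => simp
    | add a b ha hb => simp [mul_add, ha, hb]
    | tmul a' b' =>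
      have h : SemiconjBy (mulMap φ ψ a') (mulMap χ ω b) (mulMap χ ω b) :=
        sc_mulMap (fun z => (sc_mulMap (h₁₃.symm z) (h₂₃.symm z) a').symm)
          (fun z => (sc_mulMap (h₁₄.symm z) (h₂₄.symm z) a').symm) b
      simp only [mulMap₄, Algebra.TensorProduct.tmul_mul_tmul, mulMap_tmul,
        mulMap_mul h₁ h₂ h₁₂, mulMap_mul h₃ h₄ h₃₄]
      simp only [mul_assoc]
      rw [← mul_assoc (mulMap φ ψ a'), h.eq, mul_assoc]

end Legs

/-! ### Quasi-bialgebra axioms in terms of legs and convolutions -/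

namespace QuasiBialgebra

variable {𝕜 H A B : Type*} [Field 𝕜] [Ring H] [Algebra 𝕜 H] [Ring A] [Algebra 𝕜 A]
  [Ring B] [Algebra 𝕜 B] (P : QuasiBialgebra 𝕜 H) {φ φ' ψ ψ' χ χ' ω : H →ₗ[𝕜] B} {c : B}

/-- The convolution `a ↦ φ(a₁) ψ(a₂)`. -/
def conv (φ ψ : H →ₗ[𝕜] B) : H →ₗ[𝕜] B := mulMap φ ψ ∘ₗ P.Δ.toLinearMap

theorem conv_apply (φ ψ : H →ₗ[𝕜] B) (a : H) : P.conv φ ψ a = mulMap φ ψ (P.Δ a) := rfl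

/-- The map `a ↦ ε(a) 1`. -/
def triv : H →ₗ[𝕜] B := (Algebra.linearMap 𝕜 B) ∘ₗ P.ε.toLinearMap

theorem triv_apply (a : H) : P.triv a = algebraMap 𝕜 B (P.ε a) := rfl

/-- `∑ φ(X) ψ(Y) χ(Z)`. -/
def asc (φ ψ χ : H →ₗ[𝕜] B) : B := mulMap₃ φ ψ χ (P.Φ : H ⊗[𝕜] H ⊗[𝕜] H)

/-- `∑ φ(X') ψ(Y') χ(Z')`, where `Φ⁻¹ = ∑ X' ⊗ Y' ⊗ Z'`. -/
def ascInv (φ ψ χ : H →ₗ[𝕜] B) : B := mulMap₃ φ ψ χ (↑P.Φ⁻¹ : H ⊗[𝕜] H ⊗[𝕜] H)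

theorem isHom_triv : IsHom (P.triv : H →ₗ[𝕜] B) where
  map_one := by simp [triv_apply]
  map_mul := by simp [triv_apply]

theorem sc_triv : Sc c P.triv P.triv := fun a => (Algebra.commutes (P.ε a) c).symm

theorem com_triv_left : Com P.triv φ := fun a b => Algebra.commutes (P.ε a) (φ b)

theorem com_triv_right : Com φ P.triv := fun _ => P.sc_triv

theorem isHom_conv (h₁ : IsHom φ) (h₂ : IsHom ψ) (h : Com φ ψ) : IsHom (P.conv φ ψ) where
  map_one := by simp [conv_apply, mulMap_one h₁ h₂]
  map_mul := by simp [conv_apply, mulMap_mul h₁ h₂ h]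

theorem sc_conv (h₁ : Sc c φ φ') (h₂ : Sc c ψ ψ') : Sc c (P.conv φ ψ) (P.conv φ' ψ') :=
  fun a => sc_mulMap h₁ h₂ (P.Δ a)

theorem com_conv_right (h₁ : Com φ ψ) (h₂ : Com φ χ) : Com φ (P.conv ψ χ) :=
  fun a => P.sc_conv (h₁ a) (h₂ a)

theorem com_conv_left (h₁ : Com φ χ) (h₂ : Com ψ χ) : Com (P.conv φ ψ) χ :=
  (P.com_conv_right h₁.symm h₂.symm).symm

theorem sc_asc (h₁ : Sc c φ φ') (h₂ : Sc c ψ ψ') (h₃ : Sc c χ χ') :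
    SemiconjBy c (P.asc φ ψ χ) (P.asc φ' ψ' χ') := sc_mulMap₃ h₁ h₂ h₃ _

theorem sc_ascInv (h₁ : Sc c φ φ') (h₂ : Sc c ψ ψ') (h₃ : Sc c χ χ') :
    SemiconjBy c (P.ascInv φ ψ χ) (P.ascInv φ' ψ' χ') := sc_mulMap₃ h₁ h₂ h₃ _

theorem asc_sc (h₁ : Com φ ω) (h₂ : Com ψ ω) (h₃ : Com χ ω) : Sc (P.asc φ ψ χ) ω ω :=
  fun a => (P.sc_asc (h₁.symm a) (h₂.symm a) (h₃.symm a)).symm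

theorem ascInv_sc (h₁ : Com φ ω) (h₂ : Com ψ ω) (h₃ : Com χ ω) : Sc (P.ascInv φ ψ χ) ω ω :=
  fun a => (P.sc_ascInv (h₁.symm a) (h₂.symm a) (h₃.symm a)).symm

theorem asc_mul_ascInv (h₁ : IsHom φ) (h₂ : IsHom ψ) (h₃ : IsHom χ) (h₁₂ : Com φ ψ)
    (h₁₃ : Com φ χ) (h₂₃ : Com ψ χ) : P.asc φ ψ χ * P.ascInv φ ψ χ = 1 := by
  rw [asc, ascInv, ← mulMap₃_mul h₁ h₂ h₃ h₁₂ h₁₃ h₂₃, Units.mul_inv, mulMap₃_one h₁ h₂ h₃]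

theorem ascInv_mul_asc (h₁ : IsHom φ) (h₂ : IsHom ψ) (h₃ : IsHom χ) (h₁₂ : Com φ ψ)
    (h₁₃ : Com φ χ) (h₂₃ : Com ψ χ) : P.ascInv φ ψ χ * P.asc φ ψ χ = 1 := by
  rw [asc, ascInv, ← mulMap₃_mul h₁ h₂ h₃ h₁₂ h₁₃ h₂₃, Units.inv_mul, mulMap₃_one h₁ h₂ h₃]

/-- This and the next lemmas form a dictionary: a co-product in a tensor position becomes a
convolution of two legs, and a unit in a position disappears. -/
theorem mulMap₃_comulOne (x : H ⊗[𝕜] H) :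
    mulMap₃ φ ψ χ (comulOne P.Δ x) = mulMap (P.conv φ ψ) χ x := by
  induction x with
  | zero => simp
  | add a b ha hb => simp [ha, hb]
  | tmul a b => simp [mulMap₃, conv_apply]

theorem mulMap₃_assoc_symm (a : H) (y : H ⊗[𝕜] H) :
    mulMap₃ φ ψ χ ((TensorProduct.assoc 𝕜 H H H).symm (a ⊗ₜ y)) = φ a * mulMap ψ χ y := by
  induction y with
  | zero => simp
  | add a b ha hb => simp [TensorProduct.tmul_add, mul_add, ha, hb]
  | tmul a b => simp [mul_assoc]

theorem mulMap₃_oneComul (x : H ⊗[𝕜] H) :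
    mulMap₃ φ ψ χ (oneComul P.Δ x) = mulMap φ (P.conv ψ χ) x := by
  induction x with
  | zero => simp
  | add a b ha hb => simp [ha, hb]
  | tmul a b => simp [oneComul_tmul, conv_apply, mulMap₃_assoc_symm]

theorem mulMap₄_comulOneOne (x : H ⊗[𝕜] H ⊗[𝕜] H) :
    mulMap₄ φ ψ χ ω (comulOneOne P.Δ x) = mulMap₃ (P.conv φ ψ) χ ω x := by
  induction x with
  | zero => simp
  | add a b ha hb => simp [ha, hb]
  | tmul a b =>
    induction a with
    | zero => simp
    | add a b ha hb => simp [TensorProduct.add_tmul, ha, hb]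
    | tmul a a' => simp [mulMap₄, conv_apply, mul_assoc]

theorem mulMap₄_oneOneComul (x : H ⊗[𝕜] H ⊗[𝕜] H) :
    mulMap₄ φ ψ χ ω (oneOneComul P.Δ x) = mulMap₃ φ ψ (P.conv χ ω) x := by
  induction x with
  | zero => simp
  | add a b ha hb => simp [ha, hb]
  | tmul a b => simp [mulMap₄, mulMap₃, conv_apply]

theorem mulMap₄_oneComulOne (x : H ⊗[𝕜] H ⊗[𝕜] H) :
    mulMap₄ φ ψ χ ω (oneComulOne P.Δ x) = mulMap₃ φ (P.conv ψ χ) ω x := by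
  induction x with
  | zero => simp
  | add a b ha hb => simp [ha, hb]
  | tmul a b =>
    rw [oneComulOne_tmul, mulMap₃, mulMap_tmul, ← mulMap₃_oneComul]
    generalize oneComul P.Δ a = y
    induction y with
    | zero => simp
    | add a b ha hb => simp [TensorProduct.add_tmul, add_mul, ha, hb]
    | tmul a a' => simp [mulMap₄, mulMap₃, mul_assoc]

theorem mulMap₄_tensorOne₃ (h : IsHom ω) (x : H ⊗[𝕜] H ⊗[𝕜] H) :
    mulMap₄ φ ψ χ ω (tensorOne₃ x) = mulMap₃ φ ψ χ x := by
  induction x with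
  | zero => simp
  | add a b ha hb => simp [ha, hb]
  | tmul a b => simp [mulMap₄, mulMap₃, h.map_one]

theorem mulMap₄_oneTensor₃ (h : IsHom φ) (x : H ⊗[𝕜] H ⊗[𝕜] H) :
    mulMap₄ φ ψ χ ω (oneTensor₃ x) = mulMap₃ ψ χ ω x := by
  induction x with
  | zero => simp
  | add a b ha hb => simp [ha, hb]
  | tmul a b =>
    induction a with
    | zero => simp
    | add a b ha hb => simp [TensorProduct.add_tmul, ha, hb]
    | tmul a a' => simp [h.map_one, mul_assoc]

/-- The pentagon axiom pushed through `mulMap₄`. Since legs may themselves be convolutions, it also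
yields every pentagon with co-products applied to its entries. -/
theorem asc_pentagon (h₁ : IsHom φ) (h₂ : IsHom ψ) (h₃ : IsHom χ) (h₄ : IsHom ω)
    (h₁₂ : Com φ ψ) (h₁₃ : Com φ χ) (h₁₄ : Com φ ω) (h₂₃ : Com ψ χ) (h₂₄ : Com ψ ω)
    (h₃₄ : Com χ ω) :
    P.asc (P.conv φ ψ) χ ω * P.asc φ ψ (P.conv χ ω) =
      P.asc φ ψ χ * P.asc φ (P.conv ψ χ) ω * P.asc ψ χ ω := by
  have := congrArg (mulMap₄ φ ψ χ ω) P.pentagon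
  simp only [mulMap₄_mul h₁ h₂ h₃ h₄ h₁₂ h₁₃ h₁₄ h₂₃ h₂₄ h₃₄, mulMap₄_comulOneOne,
    mulMap₄_oneOneComul, mulMap₄_oneComulOne, mulMap₄_tensorOne₃ h₄,
    mulMap₄_oneTensor₃ h₁] at this
  exact this

/-- Quasi-coassociativity, multiplied by Φ on the left: Φ moves the brackets of an iterated
convolution. -/
theorem sc_asc_conv (h₁ : IsHom φ) (h₂ : IsHom ψ) (h₃ : IsHom χ) (h₁₂ : Com φ ψ)
    (h₁₃ : Com φ χ) (h₂₃ : Com ψ χ) :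
    Sc (P.asc φ ψ χ) (P.conv φ (P.conv ψ χ)) (P.conv (P.conv φ ψ) χ) := by
  intro a
  have := congrArg (mulMap₃ φ ψ χ) (congrArg (P.Φ.val * ·) (P.quasi_coassoc a))
  simp only [← mul_assoc, Units.mul_inv, one_mul] at this
  simp only [mulMap₃_mul h₁ h₂ h₃ h₁₂ h₁₃ h₂₃, mulMap₃_comulOne, mulMap₃_oneComul] at this
  exact this

theorem sc_ascInv_conv (h₁ : IsHom φ) (h₂ : IsHom ψ) (h₃ : IsHom χ) (h₁₂ : Com φ ψ)
    (h₁₃ : Com φ χ) (h₂₃ : Com ψ χ) :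
    Sc (P.ascInv φ ψ χ) (P.conv (P.conv φ ψ) χ) (P.conv φ (P.conv ψ χ)) := by
  intro a
  have := congrArg (mulMap₃ φ ψ χ) (congrArg (· * (↑P.Φ⁻¹ : H ⊗[𝕜] H ⊗[𝕜] H)) (P.quasi_coassoc a))
  simp only [mul_assoc, Units.mul_inv, mul_one] at this
  simp only [mulMap₃_mul h₁ h₂ h₃ h₁₂ h₁₃ h₂₃, mulMap₃_comulOne, mulMap₃_oneComul] at this
  exact this.symm

theorem mulMap_triv_left (x : H ⊗[𝕜] H) : mulMap P.triv φ x = φ (counitOne P.ε x) := by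
  induction x with
  | zero => simp
  | add a b ha hb => simp [ha, hb]
  | tmul a b => rw [mulMap_tmul, counitOne_tmul, map_smul, triv_apply, Algebra.smul_def]

theorem mulMap_triv_right (x : H ⊗[𝕜] H) : mulMap φ P.triv x = φ (oneCounit P.ε x) := by
  induction x with
  | zero => simp
  | add a b ha hb => simp [ha, hb]
  | tmul a b =>
    rw [mulMap_tmul, oneCounit_tmul, map_smul, triv_apply, Algebra.smul_def, Algebra.commutes]

@[simp]
theorem conv_triv_left : P.conv P.triv φ = φ := by
  ext a
  rw [conv_apply, mulMap_triv_left, P.counit_comul]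

@[simp]
theorem conv_triv_right : P.conv φ P.triv = φ := by
  ext a
  rw [conv_apply, mulMap_triv_right, P.comul_counit]

theorem mulMap₃_triv_mid (x : H ⊗[𝕜] H ⊗[𝕜] H) :
    mulMap₃ φ P.triv χ x = mulMap φ χ (oneCounitOne P.ε x) := by
  induction x with
  | zero => simp
  | add a b ha hb => simp [ha, hb]
  | tmul a b => simp [mulMap₃, mulMap_triv_right, oneCounitOne]

theorem asc_triv_mid (h₁ : IsHom φ) (h₃ : IsHom χ) : P.asc φ P.triv χ = 1 := by
  rw [asc, mulMap₃_triv_mid, P.counit_coassociator, mulMap_one h₁ h₃]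

/-- Only the middle counit axiom for Φ is assumed. The pentagon with two trivial legs on the left
gives e = e · e for e = (ε ⊗ 1 ⊗ 1)Φ, and e is invertible, so e = 1. -/
theorem asc_triv_left (h₂ : IsHom ψ) (h₃ : IsHom χ) (h : Com ψ χ) : P.asc P.triv ψ χ = 1 := by
  have h' := P.asc_pentagon P.isHom_triv P.isHom_triv h₂ h₃ P.com_triv_left P.com_triv_left
    P.com_triv_left P.com_triv_left P.com_triv_left h
  have hu := P.asc_mul_ascInv P.isHom_triv h₂ h₃ P.com_triv_left P.com_triv_left h
  simp only [conv_triv_left] at h'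
  rw [P.asc_triv_mid P.isHom_triv h₂, P.asc_triv_mid P.isHom_triv (P.isHom_conv h₂ h₃ h), one_mul,
    mul_one] at h'
  calc P.asc P.triv ψ χ = P.asc P.triv ψ χ * P.asc P.triv ψ χ * P.ascInv P.triv ψ χ := by
        rw [mul_assoc, hu, mul_one]
    _ = 1 := by rw [← h', hu]

theorem asc_triv_right (h₁ : IsHom φ) (h₂ : IsHom ψ) (h : Com φ ψ) : P.asc φ ψ P.triv = 1 := by
  have h' := P.asc_pentagon h₁ h₂ P.isHom_triv P.isHom_triv h P.com_triv_right P.com_triv_right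
    P.com_triv_right P.com_triv_right P.com_triv_right
  have hu := P.asc_mul_ascInv h₁ h₂ P.isHom_triv h P.com_triv_right P.com_triv_right
  simp only [conv_triv_right] at h'
  rw [P.asc_triv_mid h₂ P.isHom_triv, P.asc_triv_mid (P.isHom_conv h₁ h₂ h) P.isHom_triv, one_mul,
    mul_one] at h'
  calc P.asc φ ψ P.triv = P.asc φ ψ P.triv * P.asc φ ψ P.triv * P.ascInv φ ψ P.triv := by
        rw [mul_assoc, hu, mul_one]
    _ = 1 := by rw [← h', hu]

theorem ascInv_triv_mid (h₁ : IsHom φ) (h₃ : IsHom χ) (h : Com φ χ) :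
    P.ascInv φ P.triv χ = 1 := by
  simpa [P.asc_triv_mid h₁ h₃] using
    P.asc_mul_ascInv h₁ P.isHom_triv h₃ P.com_triv_right h P.com_triv_left

theorem ascInv_triv_left (h₂ : IsHom ψ) (h₃ : IsHom χ) (h : Com ψ χ) :
    P.ascInv P.triv ψ χ = 1 := by
  simpa [P.asc_triv_left h₂ h₃ h] using
    P.asc_mul_ascInv P.isHom_triv h₂ h₃ P.com_triv_left P.com_triv_left h

theorem ascInv_triv_right (h₁ : IsHom φ) (h₂ : IsHom ψ) (h : Com φ ψ) :
    P.ascInv φ ψ P.triv = 1 := by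
  simpa [P.asc_triv_right h₁ h₂ h] using
    P.asc_mul_ascInv h₁ h₂ P.isHom_triv h P.com_triv_right P.com_triv_right

end QuasiBialgebra

end QHA

namespace QHA

/-! ### Replacing outermost factors under a linear contraction -/

section Congruence

variable {𝕜 H A B : Type*} [Field 𝕜] [Ring H] [Algebra 𝕜 H] [Ring A] [Algebra 𝕜 A]
  [Ring B] [Algebra 𝕜 B]

/-- Under `C`, the elements `b` and `b'` agree as left factors. -/
def LEqE (C : B →ₗ[𝕜] A) (b b' : B) : Prop := ∀ y, C (b * y) = C (b' * y)

/-- Under `C`, the elements `b` and `b'` agree as right factors. -/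
def REqE (C : B →ₗ[𝕜] A) (b b' : B) : Prop := ∀ y, C (y * b) = C (y * b')

/-- Under `C`, the values of `φ` and `φ'` agree as left factors. -/
def LEq (C : B →ₗ[𝕜] A) (φ φ' : H →ₗ[𝕜] B) : Prop := ∀ a, LEqE C (φ a) (φ' a)

/-- Under `C`, the values of `φ` and `φ'` agree as right factors. -/
def REq (C : B →ₗ[𝕜] A) (φ φ' : H →ₗ[𝕜] B) : Prop := ∀ a, REqE C (φ a) (φ' a)

variable {C : B →ₗ[𝕜] A} {b b' u : B} {φ φ' ψ ψ' χ χ' : H →ₗ[𝕜] B}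

theorem LEq.refl : LEq C φ φ := fun _ _ => rfl

theorem REq.refl : REq C φ φ := fun _ _ => rfl

theorem LEq.trans (h₁ : LEq C φ ψ) (h₂ : LEq C ψ χ) : LEq C φ χ :=
  fun a y => (h₁ a y).trans (h₂ a y)

theorem REq.trans (h₁ : REq C φ ψ) (h₂ : REq C ψ χ) : REq C φ χ :=
  fun a y => (h₁ a y).trans (h₂ a y)

/-- A replacement valid at the far left remains valid behind a factor `u` which commutes with both
legs: move the leg to the front, replace it there, and move it back. -/
theorem LEq.comp_mulLeft (h : LEq C φ φ') (h₁ : Sc u φ φ) (h₂ : Sc u φ' φ') :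
    LEq (C ∘ₗ LinearMap.mulLeft 𝕜 u) φ φ' := by
  intro a y
  simp only [LinearMap.comp_apply, LinearMap.mulLeft_apply, ← mul_assoc]
  rw [(h₁ a).eq, (h₂ a).eq, mul_assoc, mul_assoc, h a]

theorem REq.comp_mulRight (h : REq C φ φ') (h₁ : Sc u φ φ) (h₂ : Sc u φ' φ') :
    REq (C ∘ₗ LinearMap.mulRight 𝕜 u) φ φ' := by
  intro a y
  simp only [LinearMap.comp_apply, LinearMap.mulRight_apply, mul_assoc]
  rw [← (h₁ a).eq, ← (h₂ a).eq, ← mul_assoc, ← mul_assoc, h a]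

/-- Once `φ` has been replaced by `φ'`, it is moved past the second factor, which then stands
outermost and can be replaced too. For this reason only commutation with the new leg `φ'` is needed.
-/
theorem LEq.mulMap (h₁ : LEq C φ φ') (h₂ : LEq C ψ ψ') (c : Com φ' ψ) (c' : Com φ' ψ')
    (x : H ⊗[𝕜] H) : LEqE C (mulMap φ ψ x) (mulMap φ' ψ' x) := by
  intro y
  induction x with
  | zero => simp
  | add a b ha hb => simp [add_mul, ha, hb]
  | tmul a b =>
    rw [mulMap_tmul, mulMap_tmul, mul_assoc, h₁ a, ← mul_assoc, (c a b).eq, (c' a b).eq, mul_assoc,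
      mul_assoc, h₂ b]

theorem REq.mulMap (h₁ : REq C φ φ') (h₂ : REq C ψ ψ') (c : Com φ ψ') (c' : Com φ' ψ')
    (x : H ⊗[𝕜] H) : REqE C (mulMap φ ψ x) (mulMap φ' ψ' x) := by
  intro y
  induction x with
  | zero => simp
  | add a b ha hb => simp [mul_add, ha, hb]
  | tmul a b =>
    rw [mulMap_tmul, mulMap_tmul, ← mul_assoc, h₂ b, mul_assoc, (c a b).eq, (c' a b).eq,
      ← mul_assoc, ← mul_assoc, h₁ a]

theorem LEq.mulMap₃ (h₁ : LEq C φ φ') (h₂ : LEq C ψ ψ') (h₃ : LEq C χ χ') (c₁ : Com φ' ψ)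
    (c₂ : Com φ' ψ') (c₃ : Com φ' χ) (c₄ : Com φ' χ') (c₅ : Com ψ' χ) (c₆ : Com ψ' χ')
    (x : H ⊗[𝕜] H ⊗[𝕜] H) : LEqE C (mulMap₃ φ ψ χ x) (mulMap₃ φ' ψ' χ' x) := by
  intro y
  induction x with
  | zero => simp
  | add a b ha hb => simp [add_mul, ha, hb]
  | tmul a b =>
    have h : ∀ {ω : H →ₗ[𝕜] B}, Com φ' ω → Com ψ' ω →
        QHA.mulMap φ' ψ' a * ω b = ω b * QHA.mulMap φ' ψ' a := fun h h' =>
      (sc_mulMap (h.symm b) (h'.symm b) a).eq.symm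
    simp only [QHA.mulMap₃, mulMap_tmul]
    rw [mul_assoc, h₁.mulMap h₂ c₁ c₂ a, ← mul_assoc, h c₃ c₅, h c₄ c₆, mul_assoc, mul_assoc, h₃ b]

theorem REq.mulMap₃ (h₁ : REq C φ φ') (h₂ : REq C ψ ψ') (h₃ : REq C χ χ') (c₁ : Com φ ψ')
    (c₂ : Com φ' ψ') (c₃ : Com φ χ') (c₄ : Com φ' χ') (c₅ : Com ψ χ') (c₆ : Com ψ' χ')
    (x : H ⊗[𝕜] H ⊗[𝕜] H) : REqE C (mulMap₃ φ ψ χ x) (mulMap₃ φ' ψ' χ' x) := by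
  intro y
  induction x with
  | zero => simp
  | add a b ha hb => simp [mul_add, ha, hb]
  | tmul a b =>
    have h : ∀ {φ ψ : H →ₗ[𝕜] B}, Com φ χ' → Com ψ χ' →
        QHA.mulMap φ ψ a * χ' b = χ' b * QHA.mulMap φ ψ a := fun h h' =>
      (sc_mulMap (h.symm b) (h'.symm b) a).eq.symm
    simp only [QHA.mulMap₃, mulMap_tmul]
    rw [← mul_assoc, h₃ b, mul_assoc, h c₃ c₅, h c₄ c₆, ← mul_assoc, ← mul_assoc,
      h₁.mulMap h₂ c₁ c₂ a]

end Congruence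

namespace QuasiBialgebra

variable {𝕜 H A B : Type*} [Field 𝕜] [Ring H] [Algebra 𝕜 H] [Ring A] [Algebra 𝕜 A]
  [Ring B] [Algebra 𝕜 B] (P : QuasiBialgebra 𝕜 H) {φ φ' ψ ψ' χ χ' ω : H →ₗ[𝕜] B} {c : B}
  {C : B →ₗ[𝕜] A}

attribute [simp] isHom_triv sc_triv com_triv_left com_triv_right isHom_conv com_conv_left
  com_conv_right asc_triv_left asc_triv_mid asc_triv_right ascInv_triv_left ascInv_triv_mid
  ascInv_triv_right LEq.refl REq.refl

theorem lEq_conv (h₁ : LEq C φ φ') (h₂ : LEq C ψ ψ') (c : Com φ' ψ) (c' : Com φ' ψ') :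
    LEq C (P.conv φ ψ) (P.conv φ' ψ') := fun a => h₁.mulMap h₂ c c' (P.Δ a)

theorem rEq_conv (h₁ : REq C φ φ') (h₂ : REq C ψ ψ') (c : Com φ ψ') (c' : Com φ' ψ') :
    REq C (P.conv φ ψ) (P.conv φ' ψ') := fun a => h₁.mulMap h₂ c c' (P.Δ a)

/-! ### The pentagon solved for various pairs of factors -/

section Pentagon

variable (h₁ : IsHom φ) (h₂ : IsHom ψ) (h₃ : IsHom χ) (h₄ : IsHom ω)
  (h₁₂ : Com φ ψ) (h₁₃ : Com φ χ) (h₁₄ : Com φ ω) (h₂₃ : Com ψ χ) (h₂₄ : Com ψ ω)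
  (h₃₄ : Com χ ω)
include h₁ h₂ h₃ h₄ h₁₂ h₁₃ h₁₄ h₂₃ h₂₄ h₃₄

theorem asc_mul_ascInv_pentagon :
    P.asc φ ψ (P.conv χ ω) * P.ascInv ψ χ ω =
      P.ascInv (P.conv φ ψ) χ ω * P.asc φ ψ χ * P.asc φ (P.conv ψ χ) ω := by
  have e := P.asc_pentagon h₁ h₂ h₃ h₄ h₁₂ h₁₃ h₁₄ h₂₃ h₂₄ h₃₄
  have u := P.asc_mul_ascInv h₂ h₃ h₄ h₂₃ h₂₄ h₃₄
  have v : P.ascInv (P.conv φ ψ) χ ω * P.asc (P.conv φ ψ) χ ω = 1 :=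
    P.ascInv_mul_asc (P.isHom_conv h₁ h₂ h₁₂) h₃ h₄ (by simp [*]) (by simp [*]) h₃₄
  calc _ = P.ascInv (P.conv φ ψ) χ ω * (P.asc (P.conv φ ψ) χ ω * P.asc φ ψ (P.conv χ ω)) *
        P.ascInv ψ χ ω := by rw [← mul_assoc, v, one_mul]
    _ = _ := by rw [e]; simp only [mul_assoc, u, mul_one]

theorem ascInv_mul_asc_pentagon :
    P.ascInv φ ψ χ * P.asc (P.conv φ ψ) χ ω =
      P.asc φ (P.conv ψ χ) ω * P.asc ψ χ ω * P.ascInv φ ψ (P.conv χ ω) := by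
  have e := P.asc_pentagon h₁ h₂ h₃ h₄ h₁₂ h₁₃ h₁₄ h₂₃ h₂₄ h₃₄
  have u := P.ascInv_mul_asc h₁ h₂ h₃ h₁₂ h₁₃ h₂₃
  have v : P.asc φ ψ (P.conv χ ω) * P.ascInv φ ψ (P.conv χ ω) = 1 :=
    P.asc_mul_ascInv h₁ h₂ (P.isHom_conv h₃ h₄ h₃₄) h₁₂ (by simp [*]) (by simp [*])
  calc _ = P.ascInv φ ψ χ * (P.asc (P.conv φ ψ) χ ω * P.asc φ ψ (P.conv χ ω)) *
        P.ascInv φ ψ (P.conv χ ω) := by simp only [mul_assoc, v, mul_one]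
    _ = _ := by rw [e]; simp only [← mul_assoc, u, one_mul]

theorem ascInv_pentagon :
    P.ascInv φ ψ (P.conv χ ω) * P.ascInv (P.conv φ ψ) χ ω =
      P.ascInv ψ χ ω * P.ascInv φ (P.conv ψ χ) ω * P.ascInv φ ψ χ := by
  have e := P.asc_pentagon h₁ h₂ h₃ h₄ h₁₂ h₁₃ h₁₄ h₂₃ h₂₄ h₃₄
  have u₁ := P.ascInv_mul_asc h₁ h₂ h₃ h₁₂ h₁₃ h₂₃
  have u₂ := P.ascInv_mul_asc h₂ h₃ h₄ h₂₃ h₂₄ h₃₄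
  have u₃ : P.ascInv φ (P.conv ψ χ) ω * P.asc φ (P.conv ψ χ) ω = 1 :=
    P.ascInv_mul_asc h₁ (P.isHom_conv h₂ h₃ h₂₃) h₄ (by simp [*]) h₁₄ (by simp [*])
  have v₁ : P.asc φ ψ (P.conv χ ω) * P.ascInv φ ψ (P.conv χ ω) = 1 :=
    P.asc_mul_ascInv h₁ h₂ (P.isHom_conv h₃ h₄ h₃₄) h₁₂ (by simp [*]) (by simp [*])
  have v₂ : P.asc (P.conv φ ψ) χ ω * P.ascInv (P.conv φ ψ) χ ω = 1 :=
    P.asc_mul_ascInv (P.isHom_conv h₁ h₂ h₁₂) h₃ h₄ (by simp [*]) (by simp [*]) h₃₄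
  refine (left_inv_eq_right_inv (a := P.asc (P.conv φ ψ) χ ω * P.asc φ ψ (P.conv χ ω)) ?_ ?_).symm
  · rw [e]
    simp only [mul_assoc]
    rw [← mul_assoc (P.ascInv φ ψ χ), u₁, one_mul, ← mul_assoc (P.ascInv φ (P.conv ψ χ) ω), u₃,
      one_mul, u₂]
  · rw [mul_assoc, ← mul_assoc (P.asc φ ψ (P.conv χ ω)), v₁, one_mul, v₂]

theorem asc_mul_ascInv_pentagon' :
    P.asc ψ χ ω * P.ascInv φ ψ (P.conv χ ω) =
      P.ascInv φ (P.conv ψ χ) ω * P.ascInv φ ψ χ * P.asc (P.conv φ ψ) χ ω := by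
  have e := P.ascInv_pentagon h₁ h₂ h₃ h₄ h₁₂ h₁₃ h₁₄ h₂₃ h₂₄ h₃₄
  have u := P.asc_mul_ascInv h₂ h₃ h₄ h₂₃ h₂₄ h₃₄
  have v : P.ascInv (P.conv φ ψ) χ ω * P.asc (P.conv φ ψ) χ ω = 1 :=
    P.ascInv_mul_asc (P.isHom_conv h₁ h₂ h₁₂) h₃ h₄ (by simp [*]) (by simp [*]) h₃₄
  calc _ = P.asc ψ χ ω * (P.ascInv φ ψ (P.conv χ ω) * P.ascInv (P.conv φ ψ) χ ω) *
        P.asc (P.conv φ ψ) χ ω := by simp only [mul_assoc, v, mul_one]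
    _ = _ := by rw [e]; simp only [← mul_assoc, u, one_mul]

theorem ascInv_mul_asc_pentagon' :
    P.ascInv (P.conv φ ψ) χ ω * P.asc φ ψ χ =
      P.asc φ ψ (P.conv χ ω) * P.ascInv ψ χ ω * P.ascInv φ (P.conv ψ χ) ω := by
  have e := P.ascInv_pentagon h₁ h₂ h₃ h₄ h₁₂ h₁₃ h₁₄ h₂₃ h₂₄ h₃₄
  have u := P.ascInv_mul_asc h₁ h₂ h₃ h₁₂ h₁₃ h₂₃
  have v : P.asc φ ψ (P.conv χ ω) * P.ascInv φ ψ (P.conv χ ω) = 1 :=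
    P.asc_mul_ascInv h₁ h₂ (P.isHom_conv h₃ h₄ h₃₄) h₁₂ (by simp [*]) (by simp [*])
  calc _ = P.asc φ ψ (P.conv χ ω) * (P.ascInv φ ψ (P.conv χ ω) * P.ascInv (P.conv φ ψ) χ ω) *
        P.asc φ ψ χ := by rw [← mul_assoc, v, one_mul]
    _ = _ := by rw [e]; simp only [mul_assoc, u, mul_one]

end Pentagon

/-! ### Contracting pentagons on four and on six legs -/

section FourLegs

variable {ι : Fin 4 → H →ₗ[𝕜] B} (hι : ∀ i, IsHom (ι i)) (hc : ∀ i j, i ≠ j → Com (ι i) (ι j))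
include hι hc

/-- In the pentagon Φ(0,1,23) Φ⁻¹(1,2,3) = Φ⁻¹(01,2,3) Φ(0,1,2) Φ(0,12,3), the three factors
containing a convolution can each be brought under an outermost contraction. Their contracted leg
becomes trivial and the factor becomes 1. This is the shape needed to compare two antipodes: legs 01
and 23 meet at an α, legs 12 at a β. -/
theorem contract_asc_eq_ascInv (hl₁ : LEq C (P.conv (ι 0) (ι 1)) P.triv)
    (hl₂ : LEq C (P.conv (ι 2) (ι 3)) P.triv) (hr : REq C (P.conv (ι 1) (ι 2)) P.triv) :
    C (P.asc (ι 0) (ι 1) (ι 2)) = C (P.ascInv (ι 1) (ι 2) (ι 3)) := by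
  have e := congrArg C (P.asc_mul_ascInv_pentagon (hι 0) (hι 1) (hι 2) (hι 3) (hc _ _ (by decide))
    (hc _ _ (by decide)) (hc _ _ (by decide)) (hc _ _ (by decide)) (hc _ _ (by decide))
    (hc _ _ (by decide)))
  have e₁ : LEqE C (P.asc (ι 0) (ι 1) (P.conv (ι 2) (ι 3))) (P.asc (ι 0) (ι 1) P.triv) :=
    LEq.refl.mulMap₃ LEq.refl hl₂ (by simp [hι, hc]) (by simp [hι, hc]) (by simp [hι, hc])
      (by simp [hι, hc]) (by simp [hι, hc]) (by simp [hι, hc]) _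
  have e₂ : LEqE C (P.ascInv (P.conv (ι 0) (ι 1)) (ι 2) (ι 3)) (P.ascInv P.triv (ι 2) (ι 3)) :=
    hl₁.mulMap₃ LEq.refl LEq.refl (by simp [hι, hc]) (by simp [hι, hc]) (by simp [hι, hc])
      (by simp [hι, hc]) (by simp [hι, hc]) (by simp [hι, hc]) _
  have e₃ : REqE C (P.asc (ι 0) (P.conv (ι 1) (ι 2)) (ι 3)) (P.asc (ι 0) P.triv (ι 3)) :=
    REq.refl.mulMap₃ hr REq.refl (by simp [hι, hc]) (by simp [hι, hc]) (by simp [hι, hc])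
      (by simp [hι, hc]) (by simp [hι, hc]) (by simp [hι, hc]) _
  rw [e₁, e₃, mul_assoc, e₂] at e
  simpa [hι, hc] using e.symm

theorem contract_asc_eq_ascInv' (hr₁ : REq C (P.conv (ι 0) (ι 1)) P.triv)
    (hr₂ : REq C (P.conv (ι 2) (ι 3)) P.triv) (hl : LEq C (P.conv (ι 1) (ι 2)) P.triv) :
    C (P.asc (ι 1) (ι 2) (ι 3)) = C (P.ascInv (ι 0) (ι 1) (ι 2)) := by
  have e := congrArg C (P.asc_mul_ascInv_pentagon' (hι 0) (hι 1) (hι 2) (hι 3)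
    (hc _ _ (by decide)) (hc _ _ (by decide)) (hc _ _ (by decide)) (hc _ _ (by decide))
    (hc _ _ (by decide)) (hc _ _ (by decide)))
  have e₁ : REqE C (P.ascInv (ι 0) (ι 1) (P.conv (ι 2) (ι 3))) (P.ascInv (ι 0) (ι 1) P.triv) :=
    REq.refl.mulMap₃ REq.refl hr₂ (by simp [hι, hc]) (by simp [hι, hc]) (by simp [hι, hc])
      (by simp [hι, hc]) (by simp [hι, hc]) (by simp [hι, hc]) _
  have e₂ : REqE C (P.asc (P.conv (ι 0) (ι 1)) (ι 2) (ι 3)) (P.asc P.triv (ι 2) (ι 3)) :=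
    hr₁.mulMap₃ REq.refl REq.refl (by simp [hι, hc]) (by simp [hι, hc]) (by simp [hι, hc])
      (by simp [hι, hc]) (by simp [hι, hc]) (by simp [hι, hc]) _
  have e₃ : LEqE C (P.ascInv (ι 0) (P.conv (ι 1) (ι 2)) (ι 3)) (P.ascInv (ι 0) P.triv (ι 3)) :=
    LEq.refl.mulMap₃ hl LEq.refl (by simp [hι, hc]) (by simp [hι, hc]) (by simp [hι, hc])
      (by simp [hι, hc]) (by simp [hι, hc]) (by simp [hι, hc]) _
  rw [e₁, mul_assoc, e₃, ← mul_assoc, e₂] at e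
  simpa [hι, hc] using e

end FourLegs

/-- Semigroup bookkeeping for `contract_six`: `e₁` and `e₅` are pentagons, and the other hypotheses
move one factor past another, possibly changing its brackets. -/
theorem mul_rearrange {G : Type*} [Semigroup G] {p q r s t i j m m' i' i'' k k' l : G}
    (e₁ : r * s = i * j * m) (e₂ : m * t = t * m') (e₃ : q * i = i' * q) (e₄ : p * i' = i'' * p)
    (e₅ : k * l = q * j * t) (e₆ : p * k = k' * p) :
    p * q * r * (s * t) = i'' * (k' * p * l * m') :=
  calc p * q * r * (s * t) = p * q * (r * s) * t := by simp only [mul_assoc]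
    _ = p * (q * i) * j * (m * t) := by rw [e₁]; simp only [mul_assoc]
    _ = p * i' * (q * j * t) * m' := by rw [e₂, e₃]; simp only [mul_assoc]
    _ = i'' * (p * k) * l * m' := by rw [e₄, ← e₅]; simp only [mul_assoc]
    _ = _ := by rw [e₆]; simp only [mul_assoc]

theorem mul_rearrange' {G : Type*} [Semigroup G] {p q r s t i j m m' i' i'' k k' l : G}
    (e₁ : s * r = m * j * i) (e₂ : t * m = m' * t) (e₃ : i * q = q * i') (e₄ : i' * p = p * i'')
    (e₅ : l * k = t * j * q) (e₆ : k * p = p * k') :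
    t * s * r * (q * p) = m' * (l * p * k') * i'' :=
  calc t * s * r * (q * p) = t * (s * r) * q * p := by simp only [mul_assoc]
    _ = (t * m) * j * (i * q) * p := by rw [e₁]; simp only [mul_assoc]
    _ = m' * (t * j * q) * (i' * p) := by rw [e₂, e₃]; simp only [mul_assoc]
    _ = m' * l * (k * p) * i'' := by rw [e₄, ← e₅]; simp only [mul_assoc]
    _ = _ := by rw [e₆]; simp only [mul_assoc]

section SixLegs

variable {ι : Fin 6 → H →ₗ[𝕜] B} (hι : ∀ i, IsHom (ι i)) (hc : ∀ i j, i ≠ j → Com (ι i) (ι j))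
include hι hc

/-- The left side is the element of γ on legs 0, 1, 2, 3, then Φ with Δ applied to all three
entries, then the element of δ on legs 2, 3, 4, 5. Pentagons move the convolutions 12, 03 to the
left end and 25, 34 to the right end, where `C` trivializes them. What survives is one Φ per tensor
factor of the target. -/
theorem contract_six (hl₁ : LEq C (P.conv (ι 1) (ι 2)) P.triv)
    (hl₂ : LEq C (P.conv (ι 0) (ι 3)) P.triv) (hr₁ : REq C (P.conv (ι 2) (ι 5)) P.triv)
    (hr₂ : REq C (P.conv (ι 3) (ι 4)) P.triv) :
    C (P.ascInv (ι 0) (ι 1) (ι 2) * P.asc (P.conv (ι 0) (ι 1)) (ι 2) (ι 3) *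
      P.asc (P.conv (ι 0) (ι 1)) (P.conv (ι 2) (ι 3)) (P.conv (ι 4) (ι 5)) *
      (P.ascInv (P.conv (ι 2) (ι 3)) (ι 4) (ι 5) * P.asc (ι 2) (ι 3) (ι 4))) =
    C (P.asc (ι 0) (ι 3) (ι 4) * P.asc (ι 1) (ι 2) (ι 5)) := by
  have h₀ : Com (P.conv (ι 0) (ι 1)) (P.conv (ι 2) (ι 3)) :=
    P.com_conv_left (by simp [hι, hc]) (by simp [hι, hc])
  have e₁ := P.asc_mul_ascInv_pentagon (φ := P.conv (ι 0) (ι 1)) (ψ := P.conv (ι 2) (ι 3))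
    (χ := ι 4) (ω := ι 5) (by simp [hι, hc]) (by simp [hι, hc]) (by simp [hι, hc])
    (by simp [hι, hc]) h₀ (by simp [hι, hc]) (by simp [hι, hc])
    (by simp [hι, hc]) (by simp [hι, hc]) (by simp [hι, hc])
  have e₂ : P.asc (P.conv (ι 0) (ι 1)) (P.conv (P.conv (ι 2) (ι 3)) (ι 4)) (ι 5) *
      P.asc (ι 2) (ι 3) (ι 4) = P.asc (ι 2) (ι 3) (ι 4) *
        P.asc (P.conv (ι 0) (ι 1)) (P.conv (ι 2) (P.conv (ι 3) (ι 4))) (ι 5) :=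
    (P.sc_asc (P.asc_sc (by simp [hι, hc]) (by simp [hι, hc]) (by simp [hι, hc]))
      (P.sc_asc_conv (hι _) (hι _) (hι _) (by simp [hι, hc]) (by simp [hι, hc])
        (by simp [hι, hc]))
      (P.asc_sc (by simp [hι, hc]) (by simp [hι, hc]) (by simp [hι, hc]))).eq.symm
  have e₃ : P.asc (P.conv (ι 0) (ι 1)) (ι 2) (ι 3) *
      P.ascInv (P.conv (P.conv (ι 0) (ι 1)) (P.conv (ι 2) (ι 3))) (ι 4) (ι 5) =
      P.ascInv (P.conv (P.conv (P.conv (ι 0) (ι 1)) (ι 2)) (ι 3)) (ι 4) (ι 5) *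
        P.asc (P.conv (ι 0) (ι 1)) (ι 2) (ι 3) :=
    P.sc_ascInv (P.sc_asc_conv (by simp [hι, hc]) (by simp [hι, hc]) (by simp [hι, hc])
        (by simp [hι, hc]) (by simp [hι, hc]) (by simp [hι, hc]))
      (P.asc_sc (by simp [hι, hc]) (by simp [hι, hc]) (by simp [hι, hc]))
      (P.asc_sc (by simp [hι, hc]) (by simp [hι, hc]) (by simp [hι, hc]))
  have hs : Sc (P.ascInv (ι 0) (ι 1) (ι 2)) (P.conv (P.conv (ι 0) (ι 1)) (ι 2))
      (P.conv (ι 0) (P.conv (ι 1) (ι 2))) :=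
    P.sc_ascInv_conv (by simp [hι, hc]) (by simp [hι, hc]) (by simp [hι, hc])
      (by simp [hι, hc]) (by simp [hι, hc]) (by simp [hι, hc])
  have hs' : ∀ i, 2 < i → Sc (P.ascInv (ι 0) (ι 1) (ι 2)) (ι i) (ι i) := fun i hi =>
    P.ascInv_sc (hc _ _ (by lia)) (hc _ _ (by lia)) (hc _ _ (by lia))
  have e₄ : P.ascInv (ι 0) (ι 1) (ι 2) *
      P.ascInv (P.conv (P.conv (P.conv (ι 0) (ι 1)) (ι 2)) (ι 3)) (ι 4) (ι 5) =
      P.ascInv (P.conv (P.conv (ι 0) (P.conv (ι 1) (ι 2))) (ι 3)) (ι 4) (ι 5) *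
        P.ascInv (ι 0) (ι 1) (ι 2) :=
    P.sc_ascInv (P.sc_conv hs (hs' 3 (by decide))) (hs' 4 (by decide)) (hs' 5 (by decide))
  have e₅ := P.asc_pentagon (φ := P.conv (ι 0) (ι 1)) (ψ := ι 2)
    (χ := ι 3) (ω := ι 4) (by simp [hι, hc]) (by simp [hι, hc]) (by simp [hι, hc])
    (by simp [hι, hc]) (by simp [hι, hc]) (by simp [hι, hc]) (by simp [hι, hc])
    (by simp [hι, hc]) (by simp [hι, hc]) (by simp [hι, hc])
  have e₆ : P.ascInv (ι 0) (ι 1) (ι 2) *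
      P.asc (P.conv (P.conv (ι 0) (ι 1)) (ι 2)) (ι 3) (ι 4) =
      P.asc (P.conv (ι 0) (P.conv (ι 1) (ι 2))) (ι 3) (ι 4) * P.ascInv (ι 0) (ι 1) (ι 2) :=
    P.sc_asc hs (hs' 3 (by decide)) (hs' 4 (by decide))
  rw [mul_rearrange e₁ e₂ e₃ e₄ e₅ e₆]
  -- The inner pair 12 must be contracted before 0 meets 3; dually, 34 is contracted inside 2(34).
  have k₁ : LEq C (P.conv (ι 0) (P.conv (ι 1) (ι 2))) (ι 0) := by
    simpa using P.lEq_conv (LEq.refl (φ := ι 0)) hl₁ (by simp [hι, hc]) (by simp [hι, hc])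
  have k₂ : LEq C (P.conv (P.conv (ι 0) (P.conv (ι 1) (ι 2))) (ι 3)) P.triv :=
    (P.lEq_conv k₁ LEq.refl (by simp [hι, hc]) (by simp [hι, hc])).trans hl₂
  have k₃ : REq C (P.conv (ι 2) (P.conv (ι 3) (ι 4))) (ι 2) := by
    simpa using P.rEq_conv (REq.refl (φ := ι 2)) hr₂ (by simp [hι, hc]) (by simp [hι, hc])
  have k₄ : REqE C (P.asc (P.conv (ι 0) (ι 1)) (P.conv (ι 2) (P.conv (ι 3) (ι 4))) (ι 5))
      (P.asc (P.conv (ι 0) (ι 1)) (ι 2) (ι 5)) :=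
    REq.refl.mulMap₃ k₃ REq.refl (by simp [hι, hc]) (by simp [hι, hc]) (by simp [hι, hc])
      (by simp [hι, hc]) (P.com_conv_left (by simp [hι, hc]) (by simp [hι, hc]))
      (by simp [hι, hc]) _
  have k₅ : LEqE C
      (P.ascInv (P.conv (P.conv (ι 0) (P.conv (ι 1) (ι 2))) (ι 3)) (ι 4) (ι 5))
      (P.ascInv P.triv (ι 4) (ι 5)) :=
    k₂.mulMap₃ LEq.refl LEq.refl (by simp [hι, hc]) (by simp [hι, hc]) (by simp [hι, hc])
      (by simp [hι, hc]) (by simp [hι, hc]) (by simp [hι, hc]) _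
  have k₆ : LEqE C (P.asc (P.conv (ι 0) (P.conv (ι 1) (ι 2))) (ι 3) (ι 4))
      (P.asc (ι 0) (ι 3) (ι 4)) :=
    k₁.mulMap₃ LEq.refl LEq.refl (by simp [hι, hc]) (by simp [hι, hc]) (by simp [hι, hc])
      (by simp [hι, hc]) (by simp [hι, hc]) (by simp [hι, hc]) _
  -- The pair 34 is not at the right end here, but it commutes with the last factor, whose legs 0,
  -- 1, 2, 5 are disjoint from it.
  have k₇ : REqE (C ∘ₗ LinearMap.mulRight 𝕜 (P.asc (P.conv (ι 0) (ι 1)) (ι 2) (ι 5)))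
      (P.asc (P.conv (ι 0) (ι 1)) (ι 2) (P.conv (ι 3) (ι 4)))
      (P.asc (P.conv (ι 0) (ι 1)) (ι 2) P.triv) :=
    REq.refl.mulMap₃ REq.refl
      (hr₂.comp_mulRight (P.asc_sc (P.com_conv_left (by simp [hι, hc]) (by simp [hι, hc]))
        (by simp [hι, hc]) (by simp [hι, hc]))
        P.sc_triv) (by simp [hι, hc]) (by simp [hι, hc]) (by simp [hι, hc])
      (by simp [hι, hc]) (by simp [hι, hc]) (by simp [hι, hc]) _
  have k₈ : REqE C (P.ascInv (ι 0) (ι 1) (P.conv (ι 2) (ι 5))) (P.ascInv (ι 0) (ι 1) P.triv) :=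
    REq.refl.mulMap₃ REq.refl hr₁ (by simp [hι, hc]) (by simp [hι, hc]) (by simp [hι, hc])
      (by simp [hι, hc]) (by simp [hι, hc]) (by simp [hι, hc]) _
  have k₉ : LEqE (C ∘ₗ LinearMap.mulLeft 𝕜 (P.asc (ι 0) (ι 3) (ι 4)))
      (P.asc (ι 0) (P.conv (ι 1) (ι 2)) (ι 5)) (P.asc (ι 0) P.triv (ι 5)) :=
    LEq.refl.mulMap₃
      (hl₁.comp_mulLeft (P.asc_sc (by simp [hι, hc]) (by simp [hι, hc]) (by simp [hι, hc]))
        P.sc_triv) LEq.refl (by simp [hι, hc]) (by simp [hι, hc]) (by simp [hι, hc])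
      (by simp [hι, hc]) (by simp [hι, hc]) (by simp [hι, hc]) _
  -- A last pentagon, on the legs 0, 1, 2, 5, absorbs the remaining Φ⁻¹(0,1,2). Its two superfluous
  -- factors contain 25 and 12, and are trivialized from the right and from the left.
  have f := P.ascInv_mul_asc_pentagon (hι 0) (hι 1) (hι 2) (hι 5)
    (hc _ _ (by decide)) (hc _ _ (by decide)) (hc _ _ (by decide)) (hc _ _ (by decide))
    (hc _ _ (by decide)) (hc _ _ (by decide))
  rw [k₅, P.ascInv_triv_left (hι _) (hι _) (hc _ _ (by decide)), one_mul, k₄]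
  have k := k₇ (P.asc (P.conv (ι 0) (P.conv (ι 1) (ι 2))) (ι 3) (ι 4) *
    P.ascInv (ι 0) (ι 1) (ι 2))
  simp only [LinearMap.comp_apply, LinearMap.mulRight_apply] at k
  rw [k, P.asc_triv_right (by simp [hι, hc]) (hι _) (by simp [hι, hc]), mul_one, mul_assoc, k₆, f,
    ← mul_assoc, k₈, P.ascInv_triv_right (hι _) (hι _) (hc _ _ (by decide)), mul_one]
  have k := k₉ (P.asc (ι 1) (ι 2) (ι 5))
  simp only [LinearMap.comp_apply, LinearMap.mulLeft_apply] at k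
  rw [k, P.asc_triv_mid (hι _) (hι _), one_mul]

/-- The mirror image for the axiom with Φ⁻¹: the δ-element now occupies legs 0 to 3 and the
γ-element legs 2 to 5, with left and right contractions exchanged. -/
theorem contract_six' (hr₁ : REq C (P.conv (ι 1) (ι 2)) P.triv)
    (hr₂ : REq C (P.conv (ι 0) (ι 3)) P.triv) (hl₁ : LEq C (P.conv (ι 2) (ι 5)) P.triv)
    (hl₂ : LEq C (P.conv (ι 3) (ι 4)) P.triv) :
    C (P.ascInv (ι 2) (ι 3) (ι 4) * P.asc (P.conv (ι 2) (ι 3)) (ι 4) (ι 5) *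
      P.ascInv (P.conv (ι 0) (ι 1)) (P.conv (ι 2) (ι 3)) (P.conv (ι 4) (ι 5)) *
      (P.ascInv (P.conv (ι 0) (ι 1)) (ι 2) (ι 3) * P.asc (ι 0) (ι 1) (ι 2))) =
    C (P.ascInv (ι 1) (ι 2) (ι 5) * P.ascInv (ι 0) (ι 3) (ι 4)) := by
  have h₀ : Com (P.conv (ι 0) (ι 1)) (P.conv (ι 2) (ι 3)) :=
    P.com_conv_left (by simp [hι, hc]) (by simp [hι, hc])
  have e₁ := P.asc_mul_ascInv_pentagon' (φ := P.conv (ι 0) (ι 1)) (ψ := P.conv (ι 2) (ι 3))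
    (χ := ι 4) (ω := ι 5) (by simp [hι, hc]) (by simp [hι, hc]) (by simp [hι, hc])
    (by simp [hι, hc]) h₀ (by simp [hι, hc]) (by simp [hι, hc])
    (by simp [hι, hc]) (by simp [hι, hc]) (by simp [hι, hc])
  have e₂ : P.ascInv (ι 2) (ι 3) (ι 4) *
      P.ascInv (P.conv (ι 0) (ι 1)) (P.conv (P.conv (ι 2) (ι 3)) (ι 4)) (ι 5) =
        P.ascInv (P.conv (ι 0) (ι 1)) (P.conv (ι 2) (P.conv (ι 3) (ι 4))) (ι 5) *
        P.ascInv (ι 2) (ι 3) (ι 4) :=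
    (P.sc_ascInv (P.ascInv_sc (by simp [hι, hc]) (by simp [hι, hc]) (by simp [hι, hc]))
      (P.sc_ascInv_conv (hι _) (hι _) (hι _) (by simp [hι, hc]) (by simp [hι, hc])
        (by simp [hι, hc]))
      (P.ascInv_sc (by simp [hι, hc]) (by simp [hι, hc]) (by simp [hι, hc]))).eq
  have e₃ : P.asc (P.conv (P.conv (ι 0) (ι 1)) (P.conv (ι 2) (ι 3))) (ι 4) (ι 5) *
      P.ascInv (P.conv (ι 0) (ι 1)) (ι 2) (ι 3) =
      P.ascInv (P.conv (ι 0) (ι 1)) (ι 2) (ι 3) *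
      P.asc (P.conv (P.conv (P.conv (ι 0) (ι 1)) (ι 2)) (ι 3)) (ι 4) (ι 5) :=
    (P.sc_asc (P.sc_ascInv_conv (by simp [hι, hc]) (by simp [hι, hc]) (by simp [hι, hc])
        (by simp [hι, hc]) (by simp [hι, hc]) (by simp [hι, hc]))
      (P.ascInv_sc (by simp [hι, hc]) (by simp [hι, hc]) (by simp [hι, hc]))
      (P.ascInv_sc (by simp [hι, hc]) (by simp [hι, hc]) (by simp [hι, hc]))).eq.symm
  have hs : Sc (P.asc (ι 0) (ι 1) (ι 2)) (P.conv (ι 0) (P.conv (ι 1) (ι 2)))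
      (P.conv (P.conv (ι 0) (ι 1)) (ι 2)) :=
    P.sc_asc_conv (by simp [hι, hc]) (by simp [hι, hc]) (by simp [hι, hc])
      (by simp [hι, hc]) (by simp [hι, hc]) (by simp [hι, hc])
  have hs' : ∀ i, 2 < i → Sc (P.asc (ι 0) (ι 1) (ι 2)) (ι i) (ι i) := fun i hi =>
    P.asc_sc (hc _ _ (by lia)) (hc _ _ (by lia)) (hc _ _ (by lia))
  have e₄ : P.asc (P.conv (P.conv (P.conv (ι 0) (ι 1)) (ι 2)) (ι 3)) (ι 4) (ι 5) *
      P.asc (ι 0) (ι 1) (ι 2) = P.asc (ι 0) (ι 1) (ι 2) *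
      P.asc (P.conv (P.conv (ι 0) (P.conv (ι 1) (ι 2))) (ι 3)) (ι 4) (ι 5) :=
    (P.sc_asc (P.sc_conv hs (hs' 3 (by decide))) (hs' 4 (by decide)) (hs' 5 (by decide))).eq.symm
  have e₅ := P.ascInv_pentagon (φ := P.conv (ι 0) (ι 1)) (ψ := ι 2)
    (χ := ι 3) (ω := ι 4) (by simp [hι, hc]) (by simp [hι, hc]) (by simp [hι, hc])
    (by simp [hι, hc]) (by simp [hι, hc]) (by simp [hι, hc]) (by simp [hι, hc])
    (by simp [hι, hc]) (by simp [hι, hc]) (by simp [hι, hc])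
  have e₆ : P.ascInv (P.conv (P.conv (ι 0) (ι 1)) (ι 2)) (ι 3) (ι 4) *
      P.asc (ι 0) (ι 1) (ι 2) = P.asc (ι 0) (ι 1) (ι 2) *
      P.ascInv (P.conv (ι 0) (P.conv (ι 1) (ι 2))) (ι 3) (ι 4) :=
    (P.sc_ascInv hs (hs' 3 (by decide)) (hs' 4 (by decide))).eq.symm
  rw [mul_rearrange' e₁ e₂ e₃ e₄ e₅ e₆]
  have k₁ : REq C (P.conv (ι 0) (P.conv (ι 1) (ι 2))) (ι 0) := by
    simpa using P.rEq_conv (REq.refl (φ := ι 0)) hr₁ (by simp [hι, hc]) (by simp [hι, hc])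
  have k₂ : REq C (P.conv (P.conv (ι 0) (P.conv (ι 1) (ι 2))) (ι 3)) P.triv :=
    (P.rEq_conv k₁ REq.refl (P.com_conv_left (by simp [hι, hc]) (by simp [hι, hc]))
      (by simp [hι, hc])).trans hr₂
  have k₃ : LEq C (P.conv (ι 2) (P.conv (ι 3) (ι 4))) (ι 2) := by
    simpa using P.lEq_conv (LEq.refl (φ := ι 2)) hl₂ (by simp [hι, hc]) (by simp [hι, hc])
  have k₄ : LEqE C (P.ascInv (P.conv (ι 0) (ι 1)) (P.conv (ι 2) (P.conv (ι 3) (ι 4))) (ι 5))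
      (P.ascInv (P.conv (ι 0) (ι 1)) (ι 2) (ι 5)) :=
    LEq.refl.mulMap₃ k₃ LEq.refl
      (P.com_conv_left (P.com_conv_right (by simp [hι, hc]) (by simp [hι, hc]))
        (P.com_conv_right (by simp [hι, hc]) (by simp [hι, hc])))
      (by simp [hι, hc]) (by simp [hι, hc])
      (by simp [hι, hc]) (by simp [hι, hc]) (by simp [hι, hc]) _
  have k₅ : REqE C
      (P.asc (P.conv (P.conv (ι 0) (P.conv (ι 1) (ι 2))) (ι 3)) (ι 4) (ι 5))
      (P.asc P.triv (ι 4) (ι 5)) :=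
    k₂.mulMap₃ REq.refl REq.refl
      (P.com_conv_left (P.com_conv_left (by simp [hι, hc]) (by simp [hι, hc])) (by simp [hι, hc]))
      (by simp [hι, hc])
      (P.com_conv_left (P.com_conv_left (by simp [hι, hc]) (by simp [hι, hc])) (by simp [hι, hc]))
      (by simp [hι, hc]) (by simp [hι, hc]) (by simp [hι, hc]) _
  have k₆ : REqE C (P.ascInv (P.conv (ι 0) (P.conv (ι 1) (ι 2))) (ι 3) (ι 4))
      (P.ascInv (ι 0) (ι 3) (ι 4)) :=
    k₁.mulMap₃ REq.refl REq.refl (P.com_conv_left (by simp [hι, hc]) (by simp [hι, hc]))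
      (by simp [hι, hc]) (P.com_conv_left (by simp [hι, hc]) (by simp [hι, hc]))
      (by simp [hι, hc]) (by simp [hι, hc]) (by simp [hι, hc]) _
  have k₇ : LEqE (C ∘ₗ LinearMap.mulLeft 𝕜 (P.ascInv (P.conv (ι 0) (ι 1)) (ι 2) (ι 5)))
      (P.ascInv (P.conv (ι 0) (ι 1)) (ι 2) (P.conv (ι 3) (ι 4)))
      (P.ascInv (P.conv (ι 0) (ι 1)) (ι 2) P.triv) :=
    LEq.refl.mulMap₃ LEq.refl
      (hl₂.comp_mulLeft (P.ascInv_sc (P.com_conv_left (by simp [hι, hc]) (by simp [hι, hc]))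
        (by simp [hι, hc]) (by simp [hι, hc]))
        P.sc_triv) (by simp [hι, hc]) (by simp [hι, hc])
      (P.com_conv_left (by simp [hι, hc]) (by simp [hι, hc]))
      (by simp [hι, hc]) (by simp [hι, hc]) (by simp [hι, hc]) _
  have k₈ : LEqE C (P.asc (ι 0) (ι 1) (P.conv (ι 2) (ι 5))) (P.asc (ι 0) (ι 1) P.triv) :=
    LEq.refl.mulMap₃ LEq.refl hl₁ (by simp [hι, hc]) (by simp [hι, hc]) (by simp [hι, hc])
      (by simp [hι, hc]) (by simp [hι, hc]) (by simp [hι, hc]) _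
  have k₉ : REqE (C ∘ₗ LinearMap.mulRight 𝕜 (P.ascInv (ι 0) (ι 3) (ι 4)))
      (P.ascInv (ι 0) (P.conv (ι 1) (ι 2)) (ι 5)) (P.ascInv (ι 0) P.triv (ι 5)) :=
    REq.refl.mulMap₃
      (hr₁.comp_mulRight (P.ascInv_sc (by simp [hι, hc]) (by simp [hι, hc]) (by simp [hι, hc]))
        P.sc_triv) REq.refl (by simp [hι, hc]) (by simp [hι, hc]) (by simp [hι, hc])
      (by simp [hι, hc]) (by simp [hι, hc]) (by simp [hι, hc]) _
  have f := P.ascInv_mul_asc_pentagon' (hι 0) (hι 1) (hι 2) (hι 5)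
    (hc _ _ (by decide)) (hc _ _ (by decide)) (hc _ _ (by decide)) (hc _ _ (by decide))
    (hc _ _ (by decide)) (hc _ _ (by decide))
  rw [k₅, P.asc_triv_left (hι _) (hι _) (hc _ _ (by decide)), mul_one, k₄, mul_assoc
    (P.ascInv _ _ _)]
  have k := k₇ (P.asc (ι 0) (ι 1) (ι 2) *
    P.ascInv (P.conv (ι 0) (P.conv (ι 1) (ι 2))) (ι 3) (ι 4))
  simp only [LinearMap.comp_apply, LinearMap.mulLeft_apply] at k
  rw [k, P.ascInv_triv_right (by simp [hι, hc]) (hι _) (by simp [hι, hc]), one_mul, ← mul_assoc, k₆,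
    f, mul_assoc, mul_assoc, k₈, P.asc_triv_right (hι _) (hι _) (hc _ _ (by decide)), one_mul,
    ← mul_assoc]
  have k := k₉ (P.ascInv (ι 1) (ι 2) (ι 5))
  simp only [LinearMap.comp_apply, LinearMap.mulRight_apply] at k
  rw [k, P.ascInv_triv_mid (hι _) (hι _) (hc _ _ (by decide)), mul_one]

end SixLegs

end QuasiBialgebra

end QHA

namespace QHA

/-! ### Legs in tensor powers, and antipodes along a homomorphism -/

section Legs

variable {𝕜 H A B : Type*} [Field 𝕜] [Ring H] [Algebra 𝕜 H] [Ring A] [Algebra 𝕜 A]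
  [Ring B] [Algebra 𝕜 B]

theorem isHom_algHom (f : H →ₐ[𝕜] B) : IsHom f.toLinearMap where
  map_one := map_one f
  map_mul := map_mul f

variable (𝕜 H) in
/-- The four inclusions of `H` in its fourth tensor power. -/
def leg₄ : Fin 4 → H →ₐ[𝕜] (H ⊗[𝕜] H) ⊗[𝕜] (H ⊗[𝕜] H) :=
  ![Algebra.TensorProduct.includeLeft.comp Algebra.TensorProduct.includeLeft,
    Algebra.TensorProduct.includeLeft.comp Algebra.TensorProduct.includeRight,
    Algebra.TensorProduct.includeRight.comp Algebra.TensorProduct.includeLeft,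
    Algebra.TensorProduct.includeRight.comp Algebra.TensorProduct.includeRight]

@[simp] theorem leg₄_zero (x : H) : leg₄ 𝕜 H 0 x = (x ⊗ₜ 1) ⊗ₜ 1 := rfl
@[simp] theorem leg₄_one (x : H) : leg₄ 𝕜 H 1 x = (1 ⊗ₜ x) ⊗ₜ 1 := rfl
@[simp] theorem leg₄_two (x : H) : leg₄ 𝕜 H 2 x = 1 ⊗ₜ (x ⊗ₜ 1) := rfl
@[simp] theorem leg₄_three (x : H) : leg₄ 𝕜 H 3 x = 1 ⊗ₜ (1 ⊗ₜ x) := rfl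

theorem com_leg₄ (i j : Fin 4) (h : i ≠ j) :
    Com (leg₄ 𝕜 H i).toLinearMap (leg₄ 𝕜 H j).toLinearMap := by
  intro a b
  fin_cases i <;> fin_cases j <;> first | exact absurd rfl h | simp [SemiconjBy]

variable (𝕜 H) in
/-- The three inclusions of `H` in its third tensor power. -/
def leg₃ : Fin 3 → H →ₐ[𝕜] H ⊗[𝕜] H ⊗[𝕜] H :=
  ![Algebra.TensorProduct.includeLeft.comp Algebra.TensorProduct.includeLeft,
    Algebra.TensorProduct.includeLeft.comp Algebra.TensorProduct.includeRight,
    Algebra.TensorProduct.includeRight]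

@[simp] theorem leg₃_zero (x : H) : leg₃ 𝕜 H 0 x = x ⊗ₜ 1 ⊗ₜ 1 := rfl
@[simp] theorem leg₃_one (x : H) : leg₃ 𝕜 H 1 x = 1 ⊗ₜ x ⊗ₜ 1 := rfl
@[simp] theorem leg₃_two (x : H) : leg₃ 𝕜 H 2 x = 1 ⊗ₜ x := rfl

theorem com_leg₃ (i j : Fin 3) (h : i ≠ j) :
    Com (leg₃ 𝕜 H i).toLinearMap (leg₃ 𝕜 H j).toLinearMap := by
  intro a b
  fin_cases i <;> fin_cases j <;> first | exact absurd rfl h | simp [SemiconjBy]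

theorem mulMap₃_leg₃ (x : H ⊗[𝕜] H ⊗[𝕜] H) :
    mulMap₃ (leg₃ 𝕜 H 0).toLinearMap (leg₃ 𝕜 H 1).toLinearMap (leg₃ 𝕜 H 2).toLinearMap x = x := by
  induction x with
  | zero => simp
  | add a b ha hb => simp [ha, hb]
  | tmul a b =>
    induction a with
    | zero => simp
    | add a b ha hb => simp [TensorProduct.add_tmul, ha, hb]
    | tmul a c => simp

theorem mulMap₄_leg₄ (x : (H ⊗[𝕜] H) ⊗[𝕜] (H ⊗[𝕜] H)) :
    mulMap₄ (leg₄ 𝕜 H 0).toLinearMap (leg₄ 𝕜 H 1).toLinearMap (leg₄ 𝕜 H 2).toLinearMap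
      (leg₄ 𝕜 H 3).toLinearMap x = x := by
  refine LinearMap.congr_fun (g := LinearMap.id) (TensorProduct.ext_fourfold' ?_) x
  simp

variable (g g' : H →ₗ[𝕜] A) (f : H →ₐ[𝕜] A)

/-- `x ⊗ y ↦ g(x) α f(y)`. -/
def evMap (g : H →ₗ[𝕜] A) (α : A) (f : H →ₐ[𝕜] A) : H ⊗[𝕜] H →ₗ[𝕜] A :=
  mulMap g (LinearMap.mulLeft 𝕜 α ∘ₗ f.toLinearMap)

/-- `x ⊗ y ↦ f(x) β g(y)`. -/
def coevMap (f : H →ₐ[𝕜] A) (β : A) (g : H →ₗ[𝕜] A) : H ⊗[𝕜] H →ₗ[𝕜] A :=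
  mulMap f.toLinearMap (LinearMap.mulLeft 𝕜 β ∘ₗ g)

/-- `x ⊗ y ⊗ z ↦ g(x) α f(y) β g'(z)`. -/
def evCoevMap (g : H →ₗ[𝕜] A) (α : A) (f : H →ₐ[𝕜] A) (β : A) (g' : H →ₗ[𝕜] A) :
    H ⊗[𝕜] H ⊗[𝕜] H →ₗ[𝕜] A :=
  mulMap₃ g (LinearMap.mulLeftRight 𝕜 (α, β) ∘ₗ f.toLinearMap) g'

/-- `x ⊗ y ⊗ z ↦ f(x) β g(y) α f(z)`. -/
def coevEvMap (f : H →ₐ[𝕜] A) (β : A) (g : H →ₗ[𝕜] A) (α : A) :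
    H ⊗[𝕜] H ⊗[𝕜] H →ₗ[𝕜] A :=
  mulMap₃ f.toLinearMap (LinearMap.mulLeftRight 𝕜 (β, α) ∘ₗ g) f.toLinearMap

variable {g g' f} {α β : A}

@[simp]
theorem evMap_tmul (x y : H) : evMap g α f (x ⊗ₜ y) = g x * α * f y := by
  simp [evMap, mul_assoc]

@[simp]
theorem coevMap_tmul (x y : H) : coevMap f β g (x ⊗ₜ y) = f x * β * g y := by
  simp [coevMap, mul_assoc]

@[simp]
theorem evCoevMap_tmul (x y z : H) :
    evCoevMap g α f β g' (x ⊗ₜ y ⊗ₜ z) = g x * α * f y * β * g' z := by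
  simp [evCoevMap, mul_assoc]

@[simp]
theorem coevEvMap_tmul (x y z : H) :
    coevEvMap f β g α (x ⊗ₜ y ⊗ₜ z) = f x * β * g y * α * f z := by
  simp [coevEvMap, mul_assoc]

theorem evCoevMap_tmul' {g' : H →ₗ[𝕜] A} {β : A} (t : H ⊗[𝕜] H) (z : H) :
    evCoevMap g α f β g' (t ⊗ₜ z) = evMap g α f t * β * g' z := by
  induction t with
  | zero => simp
  | add a b ha hb => simp [TensorProduct.add_tmul, add_mul, ha, hb]
  | tmul a b => simp

theorem coevEvMap_tmul' (t : H ⊗[𝕜] H) (z : H) :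
    coevEvMap f β g α (t ⊗ₜ z) = coevMap f β g t * α * f z := by
  induction t with
  | zero => simp
  | add a b ha hb => simp [TensorProduct.add_tmul, add_mul, ha, hb]
  | tmul a b => simp

end Legs

/-- `g` is an algebra anti-homomorphism which, with `α` and `β`, is an antipode along `f`. -/
structure QuasiBialgebra.IsAntipode {𝕜 H A : Type*} [Field 𝕜] [Ring H] [Algebra 𝕜 H] [Ring A]
    [Algebra 𝕜 A] (P : QuasiBialgebra 𝕜 H) (f : H →ₐ[𝕜] A) (g : H →ₗ[𝕜] A) (α β : A) :
    Prop where
  map_one : g 1 = 1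
  map_mul : ∀ a b, g (a * b) = g b * g a
  left : ∀ a, evMap g α f (P.Δ a) = P.ε a • α
  right : ∀ a, coevMap f β g (P.Δ a) = P.ε a • β
  coassociator : evCoevMap g α f β g (P.Φ : H ⊗[𝕜] H ⊗[𝕜] H) = 1
  coassociator_inv : coevEvMap f β g α (↑P.Φ⁻¹ : H ⊗[𝕜] H ⊗[𝕜] H) = 1

namespace QuasiBialgebra.IsAntipode

variable {𝕜 H A A' : Type*} [Field 𝕜] [Ring H] [Algebra 𝕜 H] [Ring A] [Algebra 𝕜 A]
  [Ring A'] [Algebra 𝕜 A']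
  {P : QuasiBialgebra 𝕜 H} {f : H →ₐ[𝕜] A} {g g' : H →ₗ[𝕜] A} {α α' β β' : A}

theorem lEq_triv {B : Type*} [Ring B] [Algebra 𝕜 B] {C : B →ₗ[𝕜] A} {φ : H →ₗ[𝕜] B}
    (h : ∀ a y, C (φ a * y) = P.ε a • C y) : LEq C φ P.triv := fun a y => by
  rw [h, triv_apply, ← Algebra.smul_def, map_smul]

theorem rEq_triv {B : Type*} [Ring B] [Algebra 𝕜 B] {C : B →ₗ[𝕜] A} {φ : H →ₗ[𝕜] B}
    (h : ∀ a y, C (y * φ a) = P.ε a • C y) : REq C φ P.triv := fun a y => by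
  rw [h, triv_apply, ← Algebra.commutes, ← Algebra.smul_def, map_smul]

/-- An algebra homomorphism transports an antipode along `f`. -/
theorem map (h : P.IsAntipode f g α β) (k : A →ₐ[𝕜] A') :
    P.IsAntipode (k.comp f) (k.toLinearMap ∘ₗ g) (k α) (k β) := by
  have h₁ : evMap (k.toLinearMap ∘ₗ g) (k α) (k.comp f) = k.toLinearMap ∘ₗ evMap g α f :=
    TensorProduct.ext' fun x y => by simp
  have h₂ : coevMap (k.comp f) (k β) (k.toLinearMap ∘ₗ g) = k.toLinearMap ∘ₗ coevMap f β g :=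
    TensorProduct.ext' fun x y => by simp
  have h₃ : evCoevMap (k.toLinearMap ∘ₗ g) (k α) (k.comp f) (k β) (k.toLinearMap ∘ₗ g) =
      k.toLinearMap ∘ₗ evCoevMap g α f β g := TensorProduct.ext_threefold fun x y z => by simp
  have h₄ : coevEvMap (k.comp f) (k β) (k.toLinearMap ∘ₗ g) (k α) =
      k.toLinearMap ∘ₗ coevEvMap f β g α := TensorProduct.ext_threefold fun x y z => by simp
  constructor
  · simp [h.map_one]
  · simp [h.map_mul]
  · simp [h₁, h.left]
  · simp [h₂, h.right]
  · simp [h₃, h.coassociator]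
  · simp [h₄, h.coassociator_inv]

theorem evMap_mul (h : P.IsAntipode f g α β) (t : H ⊗[𝕜] H) (x y : H) :
    evMap g α f (t * (x ⊗ₜ y)) = g x * evMap g α f t * f y := by
  induction t with
  | zero => simp
  | add a b ha hb => simp [mul_add, add_mul, ha, hb]
  | tmul a b => simp [h.map_mul, mul_assoc]

theorem mul_coevMap (h : P.IsAntipode f g α β) (t : H ⊗[𝕜] H) (x y : H) :
    coevMap f β g ((x ⊗ₜ y) * t) = f x * coevMap f β g t * g y := by
  induction t with
  | zero => simp
  | add a b ha hb => simp [mul_add, add_mul, ha, hb]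
  | tmul a b => simp [h.map_mul, mul_assoc]

/-- A right factor x ⊗ y only adds g(x) and f(y) on the outside, so the axiom for Δ(a) alone
suffices. In this form the axiom is a left contraction in the sense of `LEq`. -/
theorem evMap_comul_mul (h : P.IsAntipode f g α β) (a : H) (t : H ⊗[𝕜] H) :
    evMap g α f (P.Δ a * t) = P.ε a • evMap g α f t := by
  induction t with
  | zero => simp
  | add a b ha hb => simp [mul_add, ha, hb]
  | tmul x y => simp [h.evMap_mul, h.left]

theorem coevMap_mul_comul (h : P.IsAntipode f g α β) (a : H) (t : H ⊗[𝕜] H) :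
    coevMap f β g (t * P.Δ a) = P.ε a • coevMap f β g t := by
  induction t with
  | zero => simp
  | add a b ha hb => simp [add_mul, ha, hb]
  | tmul x y => simp [h.mul_coevMap, h.right]

theorem evCoevMap_mul_right (t : H ⊗[𝕜] H) (x y z : H) :
    evCoevMap g α' f β g' ((x ⊗ₜ y ⊗ₜ z) * oneTensor₂ t) =
      g x * α' * coevMap f β g' ((y ⊗ₜ z) * t) := by
  induction t with
  | zero => simp
  | add a b ha hb => simp [mul_add, ha, hb]
  | tmul a b => simp [mul_assoc]

theorem coevEvMap_mul_left (t : H ⊗[𝕜] H) (x y z : H) :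
    coevEvMap f β g α (oneTensor₂ t * (x ⊗ₜ y ⊗ₜ z)) =
      f x * β * evMap g α f (t * (y ⊗ₜ z)) := by
  induction t with
  | zero => simp
  | add a b ha hb => simp [mul_add, add_mul, ha, hb]
  | tmul a b => simp [mul_assoc]

theorem evCoevMap_comul_left (h : P.IsAntipode f g α β) (a : H) (t : H ⊗[𝕜] H ⊗[𝕜] H) :
    evCoevMap g α f β' g' ((P.Δ a ⊗ₜ 1) * t) = P.ε a • evCoevMap g α f β' g' t := by
  refine LinearMap.congr_fun (f := evCoevMap g α f β' g' ∘ₗ LinearMap.mulLeft 𝕜 (P.Δ a ⊗ₜ 1))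
    (g := P.ε a • evCoevMap g α f β' g') (TensorProduct.ext_threefold fun x y z => ?_) t
  simp [evCoevMap_tmul', h.evMap_comul_mul]

theorem evCoevMap_comul_right (h : P.IsAntipode f g' α β) (a : H) (t : H ⊗[𝕜] H ⊗[𝕜] H) :
    evCoevMap g α' f β g' (t * oneTensor₂ (P.Δ a)) = P.ε a • evCoevMap g α' f β g' t := by
  refine LinearMap.congr_fun
    (f := evCoevMap g α' f β g' ∘ₗ LinearMap.mulRight 𝕜 (oneTensor₂ (P.Δ a)))
    (g := P.ε a • evCoevMap g α' f β g') (TensorProduct.ext_threefold fun x y z => ?_) t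
  simp [-Algebra.TensorProduct.tmul_mul_tmul, evCoevMap_mul_right, h.coevMap_mul_comul,
    mul_assoc]

theorem coevEvMap_comul_right (h : P.IsAntipode f g α β) (a : H) (t : H ⊗[𝕜] H ⊗[𝕜] H) :
    coevEvMap f β g α' (t * (P.Δ a ⊗ₜ 1)) = P.ε a • coevEvMap f β g α' t := by
  refine LinearMap.congr_fun (f := coevEvMap f β g α' ∘ₗ LinearMap.mulRight 𝕜 (P.Δ a ⊗ₜ 1))
    (g := P.ε a • coevEvMap f β g α') (TensorProduct.ext_threefold fun x y z => ?_) t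
  simp [coevEvMap_tmul', h.coevMap_mul_comul]

theorem coevEvMap_comul_left (h : P.IsAntipode f g α β) (a : H) (t : H ⊗[𝕜] H ⊗[𝕜] H) :
    coevEvMap f β' g α (oneTensor₂ (P.Δ a) * t) = P.ε a • coevEvMap f β' g α t := by
  refine LinearMap.congr_fun
    (f := coevEvMap f β' g α ∘ₗ LinearMap.mulLeft 𝕜 (oneTensor₂ (P.Δ a)))
    (g := P.ε a • coevEvMap f β' g α) (TensorProduct.ext_threefold fun x y z => ?_) t
  simp [-Algebra.TensorProduct.tmul_mul_tmul, coevEvMap_mul_left, h.evMap_comul_mul, mul_assoc]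

end QuasiBialgebra.IsAntipode

end QHA

namespace QHA

section Legs

variable {𝕜 H A : Type*} [Field 𝕜] [Ring H] [Algebra 𝕜 H] [Ring A] [Algebra 𝕜 A]

theorem mulMap_leg₃_zero_one (t : H ⊗[𝕜] H) :
    mulMap (leg₃ 𝕜 H 0).toLinearMap (leg₃ 𝕜 H 1).toLinearMap t = t ⊗ₜ 1 := by
  induction t with
  | zero => simp
  | add a b ha hb => simp [TensorProduct.add_tmul, ha, hb]
  | tmul a b => simp

theorem mulMap_leg₃_one_two (t : H ⊗[𝕜] H) :
    mulMap (leg₃ 𝕜 H 1).toLinearMap (leg₃ 𝕜 H 2).toLinearMap t = oneTensor₂ t := by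
  induction t with
  | zero => simp
  | add a b ha hb => simp [ha, hb]
  | tmul a b => simp

theorem mulMap_leg₄_zero_one (t : H ⊗[𝕜] H) :
    mulMap (leg₄ 𝕜 H 0).toLinearMap (leg₄ 𝕜 H 1).toLinearMap t = t ⊗ₜ 1 := by
  induction t with
  | zero => simp
  | add a b ha hb => simp [TensorProduct.add_tmul, ha, hb]
  | tmul a b => simp

theorem mulMap_leg₄_two_three (t : H ⊗[𝕜] H) :
    mulMap (leg₄ 𝕜 H 2).toLinearMap (leg₄ 𝕜 H 3).toLinearMap t = 1 ⊗ₜ t := by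
  induction t with
  | zero => simp
  | add a b ha hb => simp [TensorProduct.tmul_add, ha, hb]
  | tmul a b => simp

theorem linearMap_eq_of_tmul₄ {C C' : (H ⊗[𝕜] H) ⊗[𝕜] (H ⊗[𝕜] H) →ₗ[𝕜] A}
    (h : ∀ x y z u, C ((x ⊗ₜ y) ⊗ₜ (z ⊗ₜ u)) = C' ((x ⊗ₜ y) ⊗ₜ (z ⊗ₜ u))) (t) : C t = C' t :=
  LinearMap.congr_fun (TensorProduct.ext_fourfold' h) t

end Legs

/-! ### Comparison of two antipodes along the same homomorphism -/

namespace QuasiBialgebra.IsAntipode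

variable {𝕜 H A : Type*} [Field 𝕜] [Ring H] [Algebra 𝕜 H] [Ring A] [Algebra 𝕜 A]
  {P : QuasiBialgebra 𝕜 H} {f : H →ₐ[𝕜] A} {g g' : H →ₗ[𝕜] A} {α α' β β' : A}

/-- Contract Φ (1 ⊗ Δ)Δ(a) = (Δ ⊗ 1)Δ(a) Φ. On one side the last two legs collapse by the β'-axiom,
on the other the first two collapse by the α-axiom. The surviving copy of `a` sits in the first or
last leg, where the anti-homomorphisms turn it into an outer factor `g a` or `g' a`. -/
theorem evCoevMap_intertwines (h : P.IsAntipode f g α β) (h' : P.IsAntipode f g' α' β') (a : H) :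
    evCoevMap g α f β' g' (P.Φ : H ⊗[𝕜] H ⊗[𝕜] H) * g' a =
      g a * evCoevMap g α f β' g' (P.Φ : H ⊗[𝕜] H ⊗[𝕜] H) := by
  set C := evCoevMap g α f β' g' with hC
  have hl : LEq C (P.conv (leg₃ 𝕜 H 0).toLinearMap (leg₃ 𝕜 H 1).toLinearMap) P.triv :=
    lEq_triv fun a y => by
      rw [conv_apply, mulMap_leg₃_zero_one, h.evCoevMap_comul_left]
  have hr : REq C (P.conv (leg₃ 𝕜 H 1).toLinearMap (leg₃ 𝕜 H 2).toLinearMap) P.triv :=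
    rEq_triv fun a y => by
      rw [conv_apply, mulMap_leg₃_one_two, h'.evCoevMap_comul_right]
  have hc := com_leg₃ (𝕜 := 𝕜) (H := H)
  have e := P.sc_asc_conv (isHom_algHom (leg₃ 𝕜 H 0)) (isHom_algHom (leg₃ 𝕜 H 1))
    (isHom_algHom (leg₃ 𝕜 H 2)) (hc _ _ (by decide)) (hc _ _ (by decide)) (hc _ _ (by decide)) a
  have e₁ := P.lEq_conv hl (LEq.refl (φ := (leg₃ 𝕜 H 2).toLinearMap)) (by simp) (by simp) a
  have e₂ := P.rEq_conv (REq.refl (φ := (leg₃ 𝕜 H 0).toLinearMap)) hr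
    (by simp) (by simp) a
  have e := congrArg C e.eq
  rw [e₁, e₂, conv_triv_left, conv_triv_right, asc, mulMap₃_leg₃] at e
  have e₃ : ∀ t, C (t * leg₃ 𝕜 H 0 a) = g a * C t := LinearMap.congr_fun
    (f := C ∘ₗ LinearMap.mulRight 𝕜 (leg₃ 𝕜 H 0 a)) (g := LinearMap.mulLeft 𝕜 (g a) ∘ₗ C)
    (TensorProduct.ext_threefold fun x y z => by simp [hC, h.map_mul, mul_assoc])
  have e₄ : ∀ t, C (leg₃ 𝕜 H 2 a * t) = C t * g' a := LinearMap.congr_fun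
    (f := C ∘ₗ LinearMap.mulLeft 𝕜 (leg₃ 𝕜 H 2 a)) (g := LinearMap.mulRight 𝕜 (g' a) ∘ₗ C)
    (TensorProduct.ext_threefold fun x y z => by simp [hC, h'.map_mul, mul_assoc])
  rw [← e₃, ← e₄]
  exact e.symm

/-- The four-leg contraction g(x) α f(y) β' g'(z) α' f(u) identifies Φ on the first three legs with
Φ⁻¹ on the last three. The former gives the left side, the latter α times an antipode axiom for
`g'`. -/
theorem evCoevMap_mul (h : P.IsAntipode f g α β) (h' : P.IsAntipode f g' α' β') :
    evCoevMap g α f β' g' (P.Φ : H ⊗[𝕜] H ⊗[𝕜] H) * α' = α := by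
  set C : (H ⊗[𝕜] H) ⊗[𝕜] (H ⊗[𝕜] H) →ₗ[𝕜] A :=
    mulMap (evMap g α f) (LinearMap.mulLeft 𝕜 β' ∘ₗ evMap g' α' f) with hC
  have hr : ∀ (t : H ⊗[𝕜] H) (x y z u : H), C (((x ⊗ₜ y) ⊗ₜ (z ⊗ₜ u)) *
      mulMap (leg₄ 𝕜 H 1).toLinearMap (leg₄ 𝕜 H 2).toLinearMap t) =
      g x * α * coevMap f β' g' ((y ⊗ₜ z) * t) * (α' * f u) := by
    intro t x y z u
    induction t with
    | zero => simp
    | add a b ha hb =>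
      simp only [map_add, mul_add, add_mul] at ha hb ⊢
      rw [ha, hb]
    | tmul a b => simp [hC, mul_assoc]
  have key := P.contract_asc_eq_ascInv (ι := fun i => (leg₄ 𝕜 H i).toLinearMap) (C := C)
    (fun i => isHom_algHom _) com_leg₄
    (lEq_triv fun a => linearMap_eq_of_tmul₄ (C := C ∘ₗ LinearMap.mulLeft 𝕜 _) (C' := P.ε a • C)
      fun x y z u => by
        simp [conv_apply, mulMap_leg₄_zero_one, hC, h.evMap_comul_mul])
    (lEq_triv fun a => linearMap_eq_of_tmul₄ (C := C ∘ₗ LinearMap.mulLeft 𝕜 _) (C' := P.ε a • C)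
      fun x y z u => by
        simp [conv_apply, mulMap_leg₄_two_three, hC, h'.evMap_comul_mul])
    (rEq_triv fun a => linearMap_eq_of_tmul₄ (C := C ∘ₗ LinearMap.mulRight 𝕜 _) (C' := P.ε a • C)
      fun x y z u => by
        simp only [LinearMap.comp_apply, LinearMap.mulRight_apply, conv_apply, hr,
          h'.coevMap_mul_comul]
        simp [hC, mul_assoc])
  have e₁ : ∀ t, C (mulMap₃ (leg₄ 𝕜 H 0).toLinearMap (leg₄ 𝕜 H 1).toLinearMap
      (leg₄ 𝕜 H 2).toLinearMap t) = evCoevMap g α f β' g' t * α' := LinearMap.congr_fun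
    (f := C ∘ₗ mulMap₃ _ _ _) (g := LinearMap.mulRight 𝕜 α' ∘ₗ evCoevMap g α f β' g')
    (TensorProduct.ext_threefold fun x y z => by simp [hC, mul_assoc])
  have e₂ : ∀ t, C (mulMap₃ (leg₄ 𝕜 H 1).toLinearMap (leg₄ 𝕜 H 2).toLinearMap
      (leg₄ 𝕜 H 3).toLinearMap t) = α * coevEvMap f β' g' α' t := LinearMap.congr_fun
    (f := C ∘ₗ mulMap₃ _ _ _) (g := LinearMap.mulLeft 𝕜 α ∘ₗ coevEvMap f β' g' α')
    (TensorProduct.ext_threefold fun x y z => by simp [hC, mul_assoc, h.map_one])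
  rw [asc, ascInv, e₁, e₂, h'.coassociator_inv, mul_one] at key
  exact key

/-- The same with the contraction f(x) β g(y) α f(z) β' g'(u); here Φ⁻¹ on the first three legs is
evaluated by the antipode axiom for `g`. -/
theorem mul_evCoevMap (h : P.IsAntipode f g α β) (h' : P.IsAntipode f g' α' β') :
    β * evCoevMap g α f β' g' (P.Φ : H ⊗[𝕜] H ⊗[𝕜] H) = β' := by
  set C : (H ⊗[𝕜] H) ⊗[𝕜] (H ⊗[𝕜] H) →ₗ[𝕜] A :=
    mulMap (coevMap f β g) (LinearMap.mulLeft 𝕜 α ∘ₗ coevMap f β' g') with hC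
  have hl : ∀ (t : H ⊗[𝕜] H) (x y z u : H), C (
      mulMap (leg₄ 𝕜 H 1).toLinearMap (leg₄ 𝕜 H 2).toLinearMap t * ((x ⊗ₜ y) ⊗ₜ (z ⊗ₜ u))) =
      f x * β * evMap g α f (t * (y ⊗ₜ z)) * (β' * g' u) := by
    intro t x y z u
    induction t with
    | zero => simp
    | add a b ha hb =>
      simp only [map_add, mul_add, add_mul] at ha hb ⊢
      rw [ha, hb]
    | tmul a b => simp [hC, mul_assoc]
  have key := P.contract_asc_eq_ascInv' (ι := fun i => (leg₄ 𝕜 H i).toLinearMap) (C := C)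
    (fun i => isHom_algHom _) com_leg₄
    (rEq_triv fun a => linearMap_eq_of_tmul₄ (C := C ∘ₗ LinearMap.mulRight 𝕜 _) (C' := P.ε a • C)
      fun x y z u => by
        simp [conv_apply, mulMap_leg₄_zero_one, hC, h.coevMap_mul_comul])
    (rEq_triv fun a => linearMap_eq_of_tmul₄ (C := C ∘ₗ LinearMap.mulRight 𝕜 _) (C' := P.ε a • C)
      fun x y z u => by
        simp [conv_apply, mulMap_leg₄_two_three, hC, h'.coevMap_mul_comul])
    (lEq_triv fun a => linearMap_eq_of_tmul₄ (C := C ∘ₗ LinearMap.mulLeft 𝕜 _) (C' := P.ε a • C)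
      fun x y z u => by
        simp only [LinearMap.comp_apply, LinearMap.mulLeft_apply, conv_apply, hl,
          h.evMap_comul_mul]
        simp [hC, mul_assoc])
  have e₁ : ∀ t, C (mulMap₃ (leg₄ 𝕜 H 0).toLinearMap (leg₄ 𝕜 H 1).toLinearMap
      (leg₄ 𝕜 H 2).toLinearMap t) = coevEvMap f β g α t * β' := LinearMap.congr_fun
    (f := C ∘ₗ mulMap₃ _ _ _) (g := LinearMap.mulRight 𝕜 β' ∘ₗ coevEvMap f β g α)
    (TensorProduct.ext_threefold fun x y z => by simp [hC, mul_assoc, h'.map_one])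
  have e₂ : ∀ t, C (mulMap₃ (leg₄ 𝕜 H 1).toLinearMap (leg₄ 𝕜 H 2).toLinearMap
      (leg₄ 𝕜 H 3).toLinearMap t) = β * evCoevMap g α f β' g' t := LinearMap.congr_fun
    (f := C ∘ₗ mulMap₃ _ _ _) (g := LinearMap.mulLeft 𝕜 β ∘ₗ evCoevMap g α f β' g')
    (TensorProduct.ext_threefold fun x y z => by simp [hC, mul_assoc, h.map_one])
  rw [asc, ascInv, e₁, e₂, h.coassociator_inv, one_mul] at key
  exact key

/-- An element intertwining two antipodes along `f` is unique. -/
theorem eq_evCoevMap (h' : P.IsAntipode f g' α' β') {X : A} (h₁ : X * α' = α)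
    (h₂ : ∀ a, X * g' a = g a * X) :
    X = evCoevMap g α f β' g' (P.Φ : H ⊗[𝕜] H ⊗[𝕜] H) := by
  -- Since g(x) α = g(x) X α' = X g'(x) α', the element `X` comes out in front and leaves an
  -- antipode axiom for `g'`.
  have e : ∀ t, evCoevMap g α f β' g' t = X * evCoevMap g' α' f β' g' t := LinearMap.congr_fun
    (g := LinearMap.mulLeft 𝕜 X ∘ₗ evCoevMap g' α' f β' g')
    (TensorProduct.ext_threefold fun x y z => by simp [← mul_assoc, h₂, ← h₁])
  rw [e, h'.coassociator, mul_one]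

/-- With V the second factor, β' g'(z) V = β' V g(z) = β g(z), so the product collapses to the
Φ-axiom of the first antipode. -/
theorem evCoevMap_mul_evCoevMap (h : P.IsAntipode f g α β) (h' : P.IsAntipode f g' α' β') :
    evCoevMap g α f β' g' (P.Φ : H ⊗[𝕜] H ⊗[𝕜] H) *
      evCoevMap g' α' f β g (P.Φ : H ⊗[𝕜] H ⊗[𝕜] H) = 1 := by
  have e : ∀ t, evCoevMap g α f β' g' t * evCoevMap g' α' f β g (P.Φ : H ⊗[𝕜] H ⊗[𝕜] H) =
      evCoevMap g α f β g t := LinearMap.congr_fun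
    (f := LinearMap.mulRight 𝕜 _ ∘ₗ evCoevMap g α f β' g')
    (TensorProduct.ext_threefold fun x y z => by
      simp only [LinearMap.comp_apply, LinearMap.mulRight_apply, evCoevMap_tmul]
      rw [mul_assoc, ← h'.evCoevMap_intertwines h, ← mul_assoc, mul_assoc (_ * _) β',
        h'.mul_evCoevMap h])
  rw [e, h.coassociator]

/-- The invertible element intertwining two antipodes along `f`. -/
def unit (h : P.IsAntipode f g α β) (h' : P.IsAntipode f g' α' β') : Aˣ where
  val := evCoevMap g α f β' g' (P.Φ : H ⊗[𝕜] H ⊗[𝕜] H)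
  inv := evCoevMap g' α' f β g (P.Φ : H ⊗[𝕜] H ⊗[𝕜] H)
  val_inv := h.evCoevMap_mul_evCoevMap h'
  inv_val := h'.evCoevMap_mul_evCoevMap h

end QuasiBialgebra.IsAntipode

end QHA

namespace QHA

/-! ### The six-leg setting and the elements γ and δ -/

section Legs

variable {𝕜 H A B B' : Type*} [Field 𝕜] [Ring H] [Algebra 𝕜 H] [Ring A] [Algebra 𝕜 A]
  [Ring B] [Algebra 𝕜 B] [Ring B'] [Algebra 𝕜 B']

theorem tmul₄_induction {p : (H ⊗[𝕜] H) ⊗[𝕜] (H ⊗[𝕜] H) → Prop} (zero : p 0)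
    (add : ∀ x y, p x → p y → p (x + y)) (tmul : ∀ x y z u, p ((x ⊗ₜ y) ⊗ₜ (z ⊗ₜ u)))
    (t : (H ⊗[𝕜] H) ⊗[𝕜] (H ⊗[𝕜] H)) : p t := by
  induction t with
  | zero => exact zero
  | add a b ha hb => exact add a b ha hb
  | tmul a b =>
    induction a with
    | zero => simpa using zero
    | add a a' ha hb => simpa [TensorProduct.add_tmul] using add _ _ ha hb
    | tmul x y =>
      induction b with
      | zero => simpa using zero
      | add a a' ha hb => simpa [TensorProduct.tmul_add] using add _ _ ha hb
      | tmul z u => exact tmul x y z u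

theorem mulMap_comp (k : B →ₐ[𝕜] B') (φ ψ : H →ₐ[𝕜] B) (t : H ⊗[𝕜] H) :
    mulMap (k.comp φ).toLinearMap (k.comp ψ).toLinearMap t =
      k (mulMap φ.toLinearMap ψ.toLinearMap t) := by
  induction t with
  | zero => simp
  | add a b ha hb => simp only [map_add, ha, hb]
  | tmul a b => simp

theorem mulMap₃_comp (k : B →ₐ[𝕜] B') (φ ψ χ : H →ₐ[𝕜] B) (t : H ⊗[𝕜] H ⊗[𝕜] H) :
    mulMap₃ (k.comp φ).toLinearMap (k.comp ψ).toLinearMap (k.comp χ).toLinearMap t =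
      k (mulMap₃ φ.toLinearMap ψ.toLinearMap χ.toLinearMap t) :=
  LinearMap.congr_fun (g := k.toLinearMap ∘ₗ mulMap₃ _ _ _)
    (TensorProduct.ext_threefold fun x y z => by simp) t

variable (𝕜 H) in
/-- Six inclusions of `H` in the tensor square of `H ⊗ H ⊗ H`; the first factor carries the legs
`1`, `2`, `5` and the second one the legs `0`, `3`, `4`. -/
def leg₆ : Fin 6 → H →ₐ[𝕜] (H ⊗[𝕜] H ⊗[𝕜] H) ⊗[𝕜] (H ⊗[𝕜] H ⊗[𝕜] H) :=
  ![Algebra.TensorProduct.includeRight.comp (leg₃ 𝕜 H 0),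
    Algebra.TensorProduct.includeLeft.comp (leg₃ 𝕜 H 0),
    Algebra.TensorProduct.includeLeft.comp (leg₃ 𝕜 H 1),
    Algebra.TensorProduct.includeRight.comp (leg₃ 𝕜 H 1),
    Algebra.TensorProduct.includeRight.comp (leg₃ 𝕜 H 2),
    Algebra.TensorProduct.includeLeft.comp (leg₃ 𝕜 H 2)]

@[simp] theorem leg₆_zero (x : H) : leg₆ 𝕜 H 0 x = 1 ⊗ₜ (x ⊗ₜ 1 ⊗ₜ 1) := rfl
@[simp] theorem leg₆_one (x : H) : leg₆ 𝕜 H 1 x = (x ⊗ₜ 1 ⊗ₜ 1) ⊗ₜ 1 := rfl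
@[simp] theorem leg₆_two (x : H) : leg₆ 𝕜 H 2 x = (1 ⊗ₜ x ⊗ₜ 1) ⊗ₜ 1 := rfl
@[simp] theorem leg₆_three (x : H) : leg₆ 𝕜 H 3 x = 1 ⊗ₜ (1 ⊗ₜ x ⊗ₜ 1) := rfl
@[simp] theorem leg₆_four (x : H) : leg₆ 𝕜 H 4 x = 1 ⊗ₜ (1 ⊗ₜ x) := rfl
@[simp] theorem leg₆_five (x : H) : leg₆ 𝕜 H 5 x = (1 ⊗ₜ x) ⊗ₜ 1 := rfl

theorem com_leg₆ (i j : Fin 6) (h : i ≠ j) :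
    Com (𝕜 := 𝕜) (H := H) (B := (H ⊗[𝕜] H ⊗[𝕜] H) ⊗[𝕜] (H ⊗[𝕜] H ⊗[𝕜] H))
      (leg₆ 𝕜 H i).toLinearMap (leg₆ 𝕜 H j).toLinearMap := by
  intro a b
  fin_cases i <;> fin_cases j <;> first | exact absurd rfl h | simp [SemiconjBy]

theorem mulMap_leg₆_one_two (t : H ⊗[𝕜] H) :
    mulMap (leg₆ 𝕜 H 1).toLinearMap (leg₆ 𝕜 H 2).toLinearMap t =
      (t ⊗ₜ[𝕜] (1 : H)) ⊗ₜ[𝕜] (1 : H ⊗[𝕜] H ⊗[𝕜] H) :=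
  (mulMap_comp _ (leg₃ 𝕜 H 0) (leg₃ 𝕜 H 1) t).trans (by rw [mulMap_leg₃_zero_one]; rfl)

theorem mulMap_leg₆_two_five (t : H ⊗[𝕜] H) :
    mulMap (leg₆ 𝕜 H 2).toLinearMap (leg₆ 𝕜 H 5).toLinearMap t =
      oneTensor₂ t ⊗ₜ[𝕜] (1 : H ⊗[𝕜] H ⊗[𝕜] H) :=
  (mulMap_comp _ (leg₃ 𝕜 H 1) (leg₃ 𝕜 H 2) t).trans (by rw [mulMap_leg₃_one_two]; rfl)

theorem mulMap_leg₆_zero_three (t : H ⊗[𝕜] H) :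
    mulMap (leg₆ 𝕜 H 0).toLinearMap (leg₆ 𝕜 H 3).toLinearMap t =
      (1 : H ⊗[𝕜] H ⊗[𝕜] H) ⊗ₜ[𝕜] (t ⊗ₜ[𝕜] (1 : H)) :=
  (mulMap_comp _ (leg₃ 𝕜 H 0) (leg₃ 𝕜 H 1) t).trans (by rw [mulMap_leg₃_zero_one]; rfl)

theorem mulMap_leg₆_three_four (t : H ⊗[𝕜] H) :
    mulMap (leg₆ 𝕜 H 3).toLinearMap (leg₆ 𝕜 H 4).toLinearMap t =
      (1 : H ⊗[𝕜] H ⊗[𝕜] H) ⊗ₜ[𝕜] oneTensor₂ t :=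
  (mulMap_comp _ (leg₃ 𝕜 H 1) (leg₃ 𝕜 H 2) t).trans (by rw [mulMap_leg₃_one_two]; rfl)

theorem mulMap₃_leg₆_fst (t : H ⊗[𝕜] H ⊗[𝕜] H) :
    mulMap₃ (leg₆ 𝕜 H 1).toLinearMap (leg₆ 𝕜 H 2).toLinearMap (leg₆ 𝕜 H 5).toLinearMap t =
      t ⊗ₜ[𝕜] (1 : H ⊗[𝕜] H ⊗[𝕜] H) :=
  (mulMap₃_comp _ (leg₃ 𝕜 H 0) (leg₃ 𝕜 H 1) (leg₃ 𝕜 H 2) t).trans (by rw [mulMap₃_leg₃]; rfl)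

theorem mulMap₃_leg₆_snd (t : H ⊗[𝕜] H ⊗[𝕜] H) :
    mulMap₃ (leg₆ 𝕜 H 0).toLinearMap (leg₆ 𝕜 H 3).toLinearMap (leg₆ 𝕜 H 4).toLinearMap t =
      (1 : H ⊗[𝕜] H ⊗[𝕜] H) ⊗ₜ[𝕜] t :=
  (mulMap₃_comp _ (leg₃ 𝕜 H 0) (leg₃ 𝕜 H 1) (leg₃ 𝕜 H 2) t).trans (by rw [mulMap₃_leg₃]; rfl)

end Legs

namespace QuasiHopfAlgebra

open QuasiBialgebra

variable {𝕜 H : Type*} [Field 𝕜] [Ring H] [Algebra 𝕜 H] (Q : QuasiHopfAlgebra 𝕜 H)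

theorem isAntipode : Q.IsAntipode (AlgHom.id 𝕜 H) Q.S.toLinearMap Q.α Q.β where
  map_one := Q.S_one
  map_mul := Q.S_mul
  left := Q.antipode_left
  right := Q.antipode_right
  coassociator := Q.antipode_coassociator
  coassociator_inv := Q.antipode_coassociator_inv

@[simp]
theorem SS_tmul (x y : H) : Q.SS (x ⊗ₜ y) = Q.S x ⊗ₜ Q.S y := by
  simp [SS]

@[simp]
theorem γMap_tmul (x y z u : H) : Q.γMap ((x ⊗ₜ y) ⊗ₜ (z ⊗ₜ u)) =
    (Q.S y * Q.α * z) ⊗ₜ (Q.S x * Q.α * u) := by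
  simp [γMap, mul_assoc]

/-- The linear map `A ⊗ B ⊗ C ⊗ D ↦ A β S(D) ⊗ B β S(C)`. -/
noncomputable def δMap : (H ⊗[𝕜] H) ⊗[𝕜] (H ⊗[𝕜] H) →ₗ[𝕜] H ⊗[𝕜] H :=
  TensorProduct.map (coevMap (AlgHom.id 𝕜 H) Q.β Q.S.toLinearMap)
      (coevMap (AlgHom.id 𝕜 H) Q.β Q.S.toLinearMap) ∘ₗ
    (TensorProduct.tensorTensorTensorComm 𝕜 H H H H).toLinearMap ∘ₗ
    TensorProduct.map LinearMap.id (flip (𝕜 := 𝕜) (H := H)).toLinearMap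

@[simp]
theorem δMap_tmul (x y z u : H) : Q.δMap ((x ⊗ₜ y) ⊗ₜ (z ⊗ₜ u)) =
    (x * Q.β * Q.S u) ⊗ₜ (y * Q.β * Q.S z) := by
  simp [δMap]

/-- `δ = ∑ A β S(D) ⊗ B β S(C)`, where `∑ A ⊗ B ⊗ C ⊗ D = (Δ ⊗ 1 ⊗ 1)Φ⁻¹ (Φ ⊗ 1)`. -/
noncomputable def δ : H ⊗[𝕜] H :=
  Q.δMap (comulOneOne Q.Δ (↑Q.Φ⁻¹ : H ⊗[𝕜] H ⊗[𝕜] H) *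
    tensorOne₃ (Q.Φ : H ⊗[𝕜] H ⊗[𝕜] H))

/-- The anti-homomorphism `a ↦ (S ⊗ S) Δᵀ(a)`. -/
noncomputable def comulS : H →ₗ[𝕜] H ⊗[𝕜] H :=
  Q.SS.toLinearMap ∘ₗ (flip (𝕜 := 𝕜) (H := H)).toLinearMap ∘ₗ Q.Δ.toLinearMap

theorem comulS_apply (a : H) : Q.comulS a = Q.SS (flip (Q.Δ a)) := rfl

theorem SS_mul (x y : H ⊗[𝕜] H) : Q.SS (x * y) = Q.SS y * Q.SS x := by
  induction x with
  | zero => simp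
  | add a b ha hb => simp [add_mul, mul_add, ha, hb]
  | tmul a b =>
    induction y with
    | zero => simp
    | add a b ha hb => simp [add_mul, mul_add, ha, hb]
    | tmul c d => simp [Q.S_mul]

theorem SS_one : Q.SS 1 = 1 := by
  simp [Algebra.TensorProduct.one_def, Q.S_one]

/-- This lets γ absorb (S ⊗ S)Δᵀ(a) on its left and Δ(b) on its right as one factor Δ(a) ⊗ Δ(b)
inside `γMap`. -/
theorem γMap_mul (p q : H ⊗[𝕜] H) (t : (H ⊗[𝕜] H) ⊗[𝕜] (H ⊗[𝕜] H)) :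
    Q.γMap (t * (p ⊗ₜ q)) = Q.SS (flip p) * Q.γMap t * q := by
  induction p with
  | zero => simp
  | add a b ha hb => simp [TensorProduct.add_tmul, add_mul, mul_add, ha, hb]
  | tmul a b =>
    induction q with
    | zero => simp
    | add a b ha hb => simp [TensorProduct.tmul_add, mul_add, ha, hb]
    | tmul c d =>
      induction t using tmul₄_induction with
      | zero => simp
      | add x y hx hy =>
        simp only [map_add, add_mul, mul_add] at hx hy ⊢
        rw [hx, hy]
      | tmul x y z u => simp [Q.S_mul, mul_assoc]

theorem mul_δMap (p q : H ⊗[𝕜] H) (t : (H ⊗[𝕜] H) ⊗[𝕜] (H ⊗[𝕜] H)) :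
    Q.δMap ((p ⊗ₜ q) * t) = p * Q.δMap t * Q.SS (flip q) := by
  induction p with
  | zero => simp
  | add a b ha hb => simp [TensorProduct.add_tmul, add_mul, ha, hb]
  | tmul a b =>
    induction q with
    | zero => simp
    | add a b ha hb => simp [TensorProduct.tmul_add, mul_add, add_mul, ha, hb]
    | tmul c d =>
      induction t using tmul₄_induction with
      | zero => simp
      | add x y hx hy =>
        simp only [map_add, add_mul, mul_add] at hx hy ⊢
        rw [hx, hy]
      | tmul x y z u => simp [Q.S_mul, mul_assoc]

/-- Legs 1 and 2 meet as S(y) α z in the first tensor factor, so this is the α-axiom there. Legs 0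
and 3 meet likewise in the second factor. -/
theorem lEq_γMap_inner : LEq Q.γMap
    (Q.conv (leg₄ 𝕜 H 1).toLinearMap (leg₄ 𝕜 H 2).toLinearMap) Q.triv := by
  have h : ∀ (t : H ⊗[𝕜] H) (x y z u : H), Q.γMap (
      mulMap (leg₄ 𝕜 H 1).toLinearMap (leg₄ 𝕜 H 2).toLinearMap t * ((x ⊗ₜ y) ⊗ₜ (z ⊗ₜ u))) =
      evMap Q.S.toLinearMap Q.α (AlgHom.id 𝕜 H) (t * (y ⊗ₜ z)) ⊗ₜ (Q.S x * Q.α * u) := by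
    intro t x y z u
    induction t with
    | zero => simp
    | add a b ha hb =>
      simp only [map_add, add_mul, TensorProduct.add_tmul] at ha hb ⊢
      rw [ha, hb]
    | tmul a b => simp
  refine IsAntipode.lEq_triv fun a => linearMap_eq_of_tmul₄
    (C := Q.γMap ∘ₗ LinearMap.mulLeft 𝕜 _) (C' := Q.ε a • Q.γMap) fun x y z u => ?_
  simp only [LinearMap.comp_apply, LinearMap.mulLeft_apply, conv_apply, h,
    Q.isAntipode.evMap_comul_mul]
  simp [TensorProduct.smul_tmul']

theorem lEq_γMap_outer : LEq Q.γMap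
    (Q.conv (leg₄ 𝕜 H 0).toLinearMap (leg₄ 𝕜 H 3).toLinearMap) Q.triv := by
  have h : ∀ (t : H ⊗[𝕜] H) (x y z u : H), Q.γMap (
      mulMap (leg₄ 𝕜 H 0).toLinearMap (leg₄ 𝕜 H 3).toLinearMap t * ((x ⊗ₜ y) ⊗ₜ (z ⊗ₜ u))) =
      (Q.S y * Q.α * z) ⊗ₜ evMap Q.S.toLinearMap Q.α (AlgHom.id 𝕜 H) (t * (x ⊗ₜ u)) := by
    intro t x y z u
    induction t with
    | zero => simp
    | add a b ha hb =>
      simp only [map_add, add_mul, TensorProduct.tmul_add] at ha hb ⊢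
      rw [ha, hb]
    | tmul a b => simp
  refine IsAntipode.lEq_triv fun a => linearMap_eq_of_tmul₄
    (C := Q.γMap ∘ₗ LinearMap.mulLeft 𝕜 _) (C' := Q.ε a • Q.γMap) fun x y z u => ?_
  simp only [LinearMap.comp_apply, LinearMap.mulLeft_apply, conv_apply, h,
    Q.isAntipode.evMap_comul_mul]
  simp [TensorProduct.tmul_smul]

theorem rEq_δMap_inner : REq Q.δMap
    (Q.conv (leg₄ 𝕜 H 1).toLinearMap (leg₄ 𝕜 H 2).toLinearMap) Q.triv := by
  have h : ∀ (t : H ⊗[𝕜] H) (x y z u : H), Q.δMap (((x ⊗ₜ y) ⊗ₜ (z ⊗ₜ u)) *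
      mulMap (leg₄ 𝕜 H 1).toLinearMap (leg₄ 𝕜 H 2).toLinearMap t) =
      (x * Q.β * Q.S u) ⊗ₜ coevMap (AlgHom.id 𝕜 H) Q.β Q.S.toLinearMap ((y ⊗ₜ z) * t) := by
    intro t x y z u
    induction t with
    | zero => simp
    | add a b ha hb =>
      simp only [map_add, mul_add, TensorProduct.tmul_add] at ha hb ⊢
      rw [ha, hb]
    | tmul a b => simp
  refine IsAntipode.rEq_triv fun a => linearMap_eq_of_tmul₄
    (C := Q.δMap ∘ₗ LinearMap.mulRight 𝕜 _) (C' := Q.ε a • Q.δMap) fun x y z u => ?_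
  simp only [LinearMap.comp_apply, LinearMap.mulRight_apply, conv_apply, h,
    Q.isAntipode.coevMap_mul_comul]
  simp [TensorProduct.tmul_smul]

theorem rEq_δMap_outer : REq Q.δMap
    (Q.conv (leg₄ 𝕜 H 0).toLinearMap (leg₄ 𝕜 H 3).toLinearMap) Q.triv := by
  have h : ∀ (t : H ⊗[𝕜] H) (x y z u : H), Q.δMap (((x ⊗ₜ y) ⊗ₜ (z ⊗ₜ u)) *
      mulMap (leg₄ 𝕜 H 0).toLinearMap (leg₄ 𝕜 H 3).toLinearMap t) =
      coevMap (AlgHom.id 𝕜 H) Q.β Q.S.toLinearMap ((x ⊗ₜ u) * t) ⊗ₜ (y * Q.β * Q.S z) := by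
    intro t x y z u
    induction t with
    | zero => simp
    | add a b ha hb =>
      simp only [map_add, mul_add, TensorProduct.add_tmul] at ha hb ⊢
      rw [ha, hb]
    | tmul a b => simp
  refine IsAntipode.rEq_triv fun a => linearMap_eq_of_tmul₄
    (C := Q.δMap ∘ₗ LinearMap.mulRight 𝕜 _) (C' := Q.ε a • Q.δMap) fun x y z u => ?_
  simp only [LinearMap.comp_apply, LinearMap.mulRight_apply, conv_apply, h,
    Q.isAntipode.coevMap_mul_comul]
  simp [TensorProduct.smul_tmul']

end QuasiHopfAlgebra

end QHA

namespace QHA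

/-! ### (S ⊗ S)Δᵀ with γ and δ as an antipode along Δ -/

namespace QuasiHopfAlgebra

open QuasiBialgebra

variable {𝕜 H : Type*} [Field 𝕜] [Ring H] [Algebra 𝕜 H] (Q : QuasiHopfAlgebra 𝕜 H)

section FourLegs

variable {B : Type*} [Ring B] [Algebra 𝕜 B] {ι : Fin 4 → H →ₗ[𝕜] B} (hι : ∀ i, IsHom (ι i))
  (hc : ∀ i j, i ≠ j → Com (ι i) (ι j))
include hι hc

theorem mulMap₄_legs_mul (s t : (H ⊗[𝕜] H) ⊗[𝕜] (H ⊗[𝕜] H)) :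
    mulMap₄ (ι 0) (ι 1) (ι 2) (ι 3) (s * t) =
      mulMap₄ (ι 0) (ι 1) (ι 2) (ι 3) s * mulMap₄ (ι 0) (ι 1) (ι 2) (ι 3) t :=
  mulMap₄_mul (hι _) (hι _) (hι _) (hι _) (hc _ _ (by decide)) (hc _ _ (by decide))
    (hc _ _ (by decide)) (hc _ _ (by decide)) (hc _ _ (by decide)) (hc _ _ (by decide)) s t

theorem mulMap₄_γ_element :
    mulMap₄ (ι 0) (ι 1) (ι 2) (ι 3) (tensorOne₃ (↑Q.Φ⁻¹ : H ⊗[𝕜] H ⊗[𝕜] H) *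
      comulOneOne Q.Δ (Q.Φ : H ⊗[𝕜] H ⊗[𝕜] H)) =
    Q.ascInv (ι 0) (ι 1) (ι 2) * Q.asc (Q.conv (ι 0) (ι 1)) (ι 2) (ι 3) := by
  rw [mulMap₄_legs_mul hι hc, mulMap₄_tensorOne₃ (hι 3), mulMap₄_comulOneOne]
  rfl

theorem mulMap₄_δ_element :
    mulMap₄ (ι 0) (ι 1) (ι 2) (ι 3) (comulOneOne Q.Δ (↑Q.Φ⁻¹ : H ⊗[𝕜] H ⊗[𝕜] H) *
      tensorOne₃ (Q.Φ : H ⊗[𝕜] H ⊗[𝕜] H)) =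
    Q.ascInv (Q.conv (ι 0) (ι 1)) (ι 2) (ι 3) * Q.asc (ι 0) (ι 1) (ι 2) := by
  rw [mulMap₄_legs_mul hι hc, mulMap₄_tensorOne₃ (hι 3), mulMap₄_comulOneOne]
  rfl

/-- The two factors change the brackets from (01)(23) to ((01)2)3 and then to (0(12))3, the nesting
in which `γMap` can contract 12 first and 03 afterwards. -/
theorem sc_γ_element :
    Sc (Q.ascInv (ι 0) (ι 1) (ι 2) * Q.asc (Q.conv (ι 0) (ι 1)) (ι 2) (ι 3))
      (Q.conv (Q.conv (ι 0) (ι 1)) (Q.conv (ι 2) (ι 3)))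
      (Q.conv (Q.conv (ι 0) (Q.conv (ι 1) (ι 2))) (ι 3)) := fun a =>
  SemiconjBy.mul_left
    (Q.sc_conv (Q.sc_ascInv_conv (by simp [hι, hc]) (by simp [hι, hc]) (by simp [hι, hc])
      (by simp [hι, hc]) (by simp [hι, hc]) (by simp [hι, hc]))
      (Q.ascInv_sc (by simp [hι, hc]) (by simp [hι, hc]) (by simp [hι, hc])) a)
    (Q.sc_asc_conv (by simp [hι, hc]) (by simp [hι, hc]) (by simp [hι, hc])
      (by simp [hι, hc]) (by simp [hι, hc]) (by simp [hι, hc]) a)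

theorem sc_δ_element :
    Sc (Q.ascInv (Q.conv (ι 0) (ι 1)) (ι 2) (ι 3) * Q.asc (ι 0) (ι 1) (ι 2))
      (Q.conv (Q.conv (ι 0) (Q.conv (ι 1) (ι 2))) (ι 3))
      (Q.conv (Q.conv (ι 0) (ι 1)) (Q.conv (ι 2) (ι 3))) := fun a =>
  SemiconjBy.mul_left
    (Q.sc_ascInv_conv (by simp [hι, hc]) (by simp [hι, hc]) (by simp [hι, hc])
      (by simp [hι, hc]) (by simp [hι, hc]) (by simp [hι, hc]) a)
    (Q.sc_conv (Q.sc_asc_conv (by simp [hι, hc]) (by simp [hι, hc]) (by simp [hι, hc])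
      (by simp [hι, hc]) (by simp [hι, hc]) (by simp [hι, hc]))
      (Q.asc_sc (by simp [hι, hc]) (by simp [hι, hc]) (by simp [hι, hc])) a)

end FourLegs

theorem isHom_leg₄ (i : Fin 4) : IsHom (leg₄ 𝕜 H i).toLinearMap := isHom_algHom _

theorem γ_eq : Q.γ = Q.γMap
    (Q.ascInv (leg₄ 𝕜 H 0).toLinearMap (leg₄ 𝕜 H 1).toLinearMap (leg₄ 𝕜 H 2).toLinearMap *
      Q.asc (Q.conv (leg₄ 𝕜 H 0).toLinearMap (leg₄ 𝕜 H 1).toLinearMap)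
        (leg₄ 𝕜 H 2).toLinearMap (leg₄ 𝕜 H 3).toLinearMap) := by
  rw [← Q.mulMap₄_γ_element (ι := fun i => (leg₄ 𝕜 H i).toLinearMap) isHom_leg₄ com_leg₄,
    mulMap₄_leg₄]
  rfl

theorem δ_eq : Q.δ = Q.δMap
    (Q.ascInv (Q.conv (leg₄ 𝕜 H 0).toLinearMap (leg₄ 𝕜 H 1).toLinearMap)
        (leg₄ 𝕜 H 2).toLinearMap (leg₄ 𝕜 H 3).toLinearMap *
      Q.asc (leg₄ 𝕜 H 0).toLinearMap (leg₄ 𝕜 H 1).toLinearMap (leg₄ 𝕜 H 2).toLinearMap) := by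
  rw [← Q.mulMap₄_δ_element (ι := fun i => (leg₄ 𝕜 H i).toLinearMap) isHom_leg₄ com_leg₄,
    mulMap₄_leg₄]
  rfl

theorem conv_leg₄ (x y : H ⊗[𝕜] H) : (x ⊗ₜ y : (H ⊗[𝕜] H) ⊗[𝕜] (H ⊗[𝕜] H)) =
    mulMap (leg₄ 𝕜 H 0).toLinearMap (leg₄ 𝕜 H 1).toLinearMap x *
      mulMap (leg₄ 𝕜 H 2).toLinearMap (leg₄ 𝕜 H 3).toLinearMap y := by
  simp [mulMap_leg₄_zero_one, mulMap_leg₄_two_three]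

theorem lEq_γMap_nested : LEq Q.γMap (Q.conv (Q.conv (leg₄ 𝕜 H 0).toLinearMap
    (Q.conv (leg₄ 𝕜 H 1).toLinearMap (leg₄ 𝕜 H 2).toLinearMap)) (leg₄ 𝕜 H 3).toLinearMap)
    Q.triv := by
  have hc := com_leg₄ (𝕜 := 𝕜) (H := H)
  have k : LEq Q.γMap (Q.conv (leg₄ 𝕜 H 0).toLinearMap
      (Q.conv (leg₄ 𝕜 H 1).toLinearMap (leg₄ 𝕜 H 2).toLinearMap)) (leg₄ 𝕜 H 0).toLinearMap := by
    simpa using Q.lEq_conv (LEq.refl (φ := (leg₄ 𝕜 H 0).toLinearMap)) Q.lEq_γMap_inner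
      (by simp [hc]) (by simp [hc])
  exact (Q.lEq_conv k LEq.refl (by simp [hc]) (by simp [hc])).trans Q.lEq_γMap_outer

theorem rEq_δMap_nested : REq Q.δMap (Q.conv (Q.conv (leg₄ 𝕜 H 0).toLinearMap
    (Q.conv (leg₄ 𝕜 H 1).toLinearMap (leg₄ 𝕜 H 2).toLinearMap)) (leg₄ 𝕜 H 3).toLinearMap)
    Q.triv := by
  have hc := com_leg₄ (𝕜 := 𝕜) (H := H)
  have k : REq Q.δMap (Q.conv (leg₄ 𝕜 H 0).toLinearMap
      (Q.conv (leg₄ 𝕜 H 1).toLinearMap (leg₄ 𝕜 H 2).toLinearMap)) (leg₄ 𝕜 H 0).toLinearMap := by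
    simpa using Q.rEq_conv (REq.refl (φ := (leg₄ 𝕜 H 0).toLinearMap)) Q.rEq_δMap_inner
      (by simp [hc]) (by simp [hc])
  exact (Q.rEq_conv k REq.refl (Q.com_conv_left (by simp [hc]) (by simp [hc]))
    (by simp [hc])).trans Q.rEq_δMap_outer

/-- The left side is `γMap` of τ (Δ ⊗ Δ)Δ(a). Moving the co-products to the left of τ nests them as
0(12)3, and both pairs contract. -/
theorem evMap_γ_comul (a : H) : evMap Q.comulS Q.γ Q.Δ (Q.Δ a) = Q.ε a • Q.γ := by
  set τ := Q.ascInv (leg₄ 𝕜 H 0).toLinearMap (leg₄ 𝕜 H 1).toLinearMap (leg₄ 𝕜 H 2).toLinearMap *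
      Q.asc (Q.conv (leg₄ 𝕜 H 0).toLinearMap (leg₄ 𝕜 H 1).toLinearMap)
        (leg₄ 𝕜 H 2).toLinearMap (leg₄ 𝕜 H 3).toLinearMap with hτ
  have e : ∀ t, evMap Q.comulS Q.γ Q.Δ t = Q.γMap (τ * mulMap
      (Q.conv (leg₄ 𝕜 H 0).toLinearMap (leg₄ 𝕜 H 1).toLinearMap)
      (Q.conv (leg₄ 𝕜 H 2).toLinearMap (leg₄ 𝕜 H 3).toLinearMap) t) := LinearMap.congr_fun
    (g := Q.γMap ∘ₗ LinearMap.mulLeft 𝕜 τ ∘ₗ mulMap _ _) (TensorProduct.ext' fun x y => by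
      rw [evMap_tmul, LinearMap.comp_apply, LinearMap.comp_apply, mulMap_tmul, conv_apply,
        conv_apply, ← conv_leg₄, LinearMap.mulLeft_apply, γMap_mul, γ_eq, comulS_apply])
  rw [e, ← conv_apply, (Q.sc_γ_element (ι := fun i => (leg₄ 𝕜 H i).toLinearMap) isHom_leg₄
    com_leg₄ a).eq, Q.lEq_γMap_nested a, triv_apply, ← Algebra.smul_def, map_smul, γ_eq]

theorem coevMap_δ_comul (a : H) : coevMap Q.Δ Q.δ Q.comulS (Q.Δ a) = Q.ε a • Q.δ := by
  set κ := Q.ascInv (Q.conv (leg₄ 𝕜 H 0).toLinearMap (leg₄ 𝕜 H 1).toLinearMap)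
        (leg₄ 𝕜 H 2).toLinearMap (leg₄ 𝕜 H 3).toLinearMap *
      Q.asc (leg₄ 𝕜 H 0).toLinearMap (leg₄ 𝕜 H 1).toLinearMap (leg₄ 𝕜 H 2).toLinearMap with hκ
  have e : ∀ t, coevMap Q.Δ Q.δ Q.comulS t = Q.δMap (mulMap
      (Q.conv (leg₄ 𝕜 H 0).toLinearMap (leg₄ 𝕜 H 1).toLinearMap)
      (Q.conv (leg₄ 𝕜 H 2).toLinearMap (leg₄ 𝕜 H 3).toLinearMap) t * κ) := LinearMap.congr_fun
    (g := Q.δMap ∘ₗ LinearMap.mulRight 𝕜 κ ∘ₗ mulMap _ _) (TensorProduct.ext' fun x y => by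
      rw [coevMap_tmul, LinearMap.comp_apply, LinearMap.comp_apply, mulMap_tmul, conv_apply,
        conv_apply, ← conv_leg₄, LinearMap.mulRight_apply, mul_δMap, δ_eq, comulS_apply])
  rw [e, ← conv_apply, ← (Q.sc_δ_element (ι := fun i => (leg₄ 𝕜 H i).toLinearMap) isHom_leg₄
    com_leg₄ a).eq, Q.rEq_δMap_nested a, triv_apply, ← Algebra.commutes, ← Algebra.smul_def,
    map_smul, δ_eq]

variable (𝕜 H) in
/-- The tensor square of `H ⊗ H ⊗ H`. -/
abbrev Tensor₆ : Type _ := (H ⊗[𝕜] H ⊗[𝕜] H) ⊗[𝕜] (H ⊗[𝕜] H ⊗[𝕜] H)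

/-- A map into a product of five tensors is determined by its values on pure tensors. -/
theorem map_mul_eq_of_tmul {A B : Type*} [Ring A] [Algebra 𝕜 A] [Ring B] [Algebra 𝕜 B]
    {C : B →ₗ[𝕜] A} {l l' : (H ⊗[𝕜] H) ⊗[𝕜] (H ⊗[𝕜] H) →ₗ[𝕜] B} {k k' k'' : H ⊗[𝕜] H →ₗ[𝕜] B}
    {D : (H ⊗[𝕜] H) ⊗[𝕜] (H ⊗[𝕜] H) → H ⊗[𝕜] H → H ⊗[𝕜] H → H ⊗[𝕜] H →
      (H ⊗[𝕜] H) ⊗[𝕜] (H ⊗[𝕜] H) → A}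
    (h₁ : ∀ τ τ' p q r κ, D (τ + τ') p q r κ = D τ p q r κ + D τ' p q r κ)
    (h₂ : ∀ τ p p' q r κ, D τ (p + p') q r κ = D τ p q r κ + D τ p' q r κ)
    (h₃ : ∀ τ p q q' r κ, D τ p (q + q') r κ = D τ p q r κ + D τ p q' r κ)
    (h₄ : ∀ τ p q r r' κ, D τ p q (r + r') κ = D τ p q r κ + D τ p q r' κ)
    (h₅ : ∀ τ p q r κ κ', D τ p q r (κ + κ') = D τ p q r κ + D τ p q r κ')
    (h : ∀ a b c d p₁ p₂ q₁ q₂ r₁ r₂ a' b' c' d',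
      C (l ((a ⊗ₜ b) ⊗ₜ (c ⊗ₜ d)) * (k (p₁ ⊗ₜ p₂) * k' (q₁ ⊗ₜ q₂) * k'' (r₁ ⊗ₜ r₂)) *
        l' ((a' ⊗ₜ b') ⊗ₜ (c' ⊗ₜ d'))) = D ((a ⊗ₜ b) ⊗ₜ (c ⊗ₜ d)) (p₁ ⊗ₜ p₂) (q₁ ⊗ₜ q₂)
          (r₁ ⊗ₜ r₂) ((a' ⊗ₜ b') ⊗ₜ (c' ⊗ₜ d'))) (τ p q r κ) :
    C (l τ * (k p * k' q * k'' r) * l' κ) = D τ p q r κ := by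
  have z₁ : ∀ p q r κ, D 0 p q r κ = 0 := fun p q r κ => by simpa using h₁ 0 0 p q r κ
  have z₂ : ∀ τ q r κ, D τ 0 q r κ = 0 := fun τ q r κ => by simpa using h₂ τ 0 0 q r κ
  have z₃ : ∀ τ p r κ, D τ p 0 r κ = 0 := fun τ p r κ => by simpa using h₃ τ p 0 0 r κ
  have z₄ : ∀ τ p q κ, D τ p q 0 κ = 0 := fun τ p q κ => by simpa using h₄ τ p q 0 0 κ
  have z₅ : ∀ τ p q r, D τ p q r 0 = 0 := fun τ p q r => by simpa using h₅ τ p q r 0 0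
  induction p with
  | zero => simp only [map_zero, zero_mul, mul_zero, z₂]
  | add x y hx hy => simp only [map_add, add_mul, mul_add, hx, hy, h₂]
  | tmul p₁ p₂ =>
  induction q with
  | zero => simp only [map_zero, zero_mul, mul_zero, z₃]
  | add x y hx hy => simp only [map_add, add_mul, mul_add, hx, hy, h₃]
  | tmul q₁ q₂ =>
  induction r with
  | zero => simp only [map_zero, zero_mul, mul_zero, z₄]
  | add x y hx hy => simp only [map_add, add_mul, mul_add, hx, hy, h₄]
  | tmul r₁ r₂ =>
  induction τ using tmul₄_induction with
  | zero => simp only [map_zero, zero_mul, z₁]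
  | add x y hx hy => simp only [map_add, add_mul, hx, hy, h₁]
  | tmul a b c d =>
  induction κ using tmul₄_induction with
  | zero => simp only [map_zero, mul_zero, z₅]
  | add x y hx hy => simp only [map_add, mul_add, hx, hy, h₅]
  | tmul k l m n => exact h ..

/-- The contraction `x ↦ S(x₁) α x₂ β S(x₅) ⊗ S(x₀) α x₃ β S(x₄)` of six legs. -/
noncomputable def evCoevMap₆ :
    Tensor₆ 𝕜 H →ₗ[𝕜] H ⊗[𝕜] H :=
  TensorProduct.map (evCoevMap Q.S.toLinearMap Q.α (AlgHom.id 𝕜 H) Q.β Q.S.toLinearMap)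
    (evCoevMap Q.S.toLinearMap Q.α (AlgHom.id 𝕜 H) Q.β Q.S.toLinearMap)

/-- The contraction `x ↦ x₀ β S(x₃) α x₄ ⊗ x₁ β S(x₂) α x₅` of six legs. -/
noncomputable def coevEvMap₆ :
    Tensor₆ 𝕜 H →ₗ[𝕜] H ⊗[𝕜] H :=
  (flip (𝕜 := 𝕜) (H := H)).toLinearMap ∘ₗ
    TensorProduct.map (coevEvMap (AlgHom.id 𝕜 H) Q.β Q.S.toLinearMap Q.α)
      (coevEvMap (AlgHom.id 𝕜 H) Q.β Q.S.toLinearMap Q.α)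

/-- The six-leg contraction computes products around γ and δ. Legs 01, 23, 45 carry Δ(X), Δ(Y),
Δ(Z); the flip in the outer factors pairs 1, 2, 5 in the first tensor factor and 0, 3, 4 in the
second. -/
theorem evCoevMap₆_apply (τ κ : (H ⊗[𝕜] H) ⊗[𝕜] (H ⊗[𝕜] H)) (p q r : H ⊗[𝕜] H) :
    Q.evCoevMap₆ (mulMap₄ (leg₆ 𝕜 H 0).toLinearMap (leg₆ 𝕜 H 1).toLinearMap
        (leg₆ 𝕜 H 2).toLinearMap (leg₆ 𝕜 H 3).toLinearMap τ *
      (mulMap (leg₆ 𝕜 H 0).toLinearMap (leg₆ 𝕜 H 1).toLinearMap p *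
        mulMap (leg₆ 𝕜 H 2).toLinearMap (leg₆ 𝕜 H 3).toLinearMap q *
        mulMap (leg₆ 𝕜 H 4).toLinearMap (leg₆ 𝕜 H 5).toLinearMap r) *
      mulMap₄ (leg₆ 𝕜 H 2).toLinearMap (leg₆ 𝕜 H 3).toLinearMap
        (leg₆ 𝕜 H 4).toLinearMap (leg₆ 𝕜 H 5).toLinearMap κ) =
      Q.SS (flip p) * Q.γMap τ * q * Q.δMap κ * Q.SS (flip r) := by
  refine map_mul_eq_of_tmul (B := Tensor₆ 𝕜 H) (C := Q.evCoevMap₆)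
    (D := fun τ p q r κ => Q.SS (flip p) * Q.γMap τ * q * Q.δMap κ * Q.SS (flip r))
    (by simp [mul_add, add_mul]) (by simp [mul_add, add_mul]) (by simp [mul_add, add_mul])
    (by simp [mul_add, add_mul]) (by simp [mul_add, add_mul]) ?_ τ p q r κ
  intros
  simp [evCoevMap₆, Q.S_mul, mul_assoc]

theorem coevEvMap₆_apply (τ κ : (H ⊗[𝕜] H) ⊗[𝕜] (H ⊗[𝕜] H)) (p q r : H ⊗[𝕜] H) :
    Q.coevEvMap₆ (mulMap₄ (leg₆ 𝕜 H 2).toLinearMap (leg₆ 𝕜 H 3).toLinearMap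
        (leg₆ 𝕜 H 4).toLinearMap (leg₆ 𝕜 H 5).toLinearMap τ *
      (mulMap (leg₆ 𝕜 H 0).toLinearMap (leg₆ 𝕜 H 1).toLinearMap p *
        mulMap (leg₆ 𝕜 H 2).toLinearMap (leg₆ 𝕜 H 3).toLinearMap q *
        mulMap (leg₆ 𝕜 H 4).toLinearMap (leg₆ 𝕜 H 5).toLinearMap r) *
      mulMap₄ (leg₆ 𝕜 H 0).toLinearMap (leg₆ 𝕜 H 1).toLinearMap
        (leg₆ 𝕜 H 2).toLinearMap (leg₆ 𝕜 H 3).toLinearMap κ) =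
      p * Q.δMap κ * Q.SS (flip q) * Q.γMap τ * r := by
  refine map_mul_eq_of_tmul (B := Tensor₆ 𝕜 H) (C := Q.coevEvMap₆)
    (D := fun τ p q r κ => p * Q.δMap κ * Q.SS (flip q) * Q.γMap τ * r)
    (by simp [mul_add, add_mul]) (by simp [mul_add, add_mul]) (by simp [mul_add, add_mul])
    (by simp [mul_add, add_mul]) (by simp [mul_add, add_mul]) ?_ τ p q r κ
  intros
  simp [coevEvMap₆, Q.S_mul, mul_assoc]

theorem lEq_triv_of_tmul {M A : Type*} [Ring M] [Algebra 𝕜 M] [Ring A] [Algebra 𝕜 A]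
    {C : M ⊗[𝕜] M →ₗ[𝕜] A} {φ : H →ₗ[𝕜] M ⊗[𝕜] M}
    (h : ∀ a x y, C (φ a * (x ⊗ₜ y)) = Q.ε a • C (x ⊗ₜ y)) : LEq C φ Q.triv :=
  IsAntipode.lEq_triv fun a t => by
    induction t with
    | zero => simp only [mul_zero, map_zero, smul_zero]
    | add x y hx hy => simp only [mul_add, map_add, smul_add, hx, hy]
    | tmul x y => exact h a x y

theorem rEq_triv_of_tmul {M A : Type*} [Ring M] [Algebra 𝕜 M] [Ring A] [Algebra 𝕜 A]
    {C : M ⊗[𝕜] M →ₗ[𝕜] A} {φ : H →ₗ[𝕜] M ⊗[𝕜] M}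
    (h : ∀ a x y, C ((x ⊗ₜ y) * φ a) = Q.ε a • C (x ⊗ₜ y)) : REq C φ Q.triv :=
  IsAntipode.rEq_triv fun a t => by
    induction t with
    | zero => simp only [zero_mul, map_zero, smul_zero]
    | add x y hx hy => simp only [add_mul, map_add, smul_add, hx, hy]
    | tmul x y => exact h a x y

theorem lEq_evCoevMap₆ : LEq (B := Tensor₆ 𝕜 H) Q.evCoevMap₆
      (Q.conv (B := Tensor₆ 𝕜 H) (leg₆ 𝕜 H 1).toLinearMap (leg₆ 𝕜 H 2).toLinearMap) Q.triv ∧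
    LEq (B := Tensor₆ 𝕜 H) Q.evCoevMap₆
      (Q.conv (B := Tensor₆ 𝕜 H) (leg₆ 𝕜 H 0).toLinearMap (leg₆ 𝕜 H 3).toLinearMap) Q.triv := by
  constructor
  all_goals
    refine Q.lEq_triv_of_tmul fun a x y => ?_
  · rw [conv_apply, mulMap_leg₆_one_two,
      Algebra.TensorProduct.tmul_mul_tmul, one_mul, evCoevMap₆, TensorProduct.map_tmul,
      Q.isAntipode.evCoevMap_comul_left, TensorProduct.map_tmul,
      TensorProduct.smul_tmul']
  · rw [conv_apply, mulMap_leg₆_zero_three,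
      Algebra.TensorProduct.tmul_mul_tmul, one_mul, evCoevMap₆, TensorProduct.map_tmul,
      Q.isAntipode.evCoevMap_comul_left, TensorProduct.map_tmul,
      TensorProduct.tmul_smul]

theorem rEq_evCoevMap₆ : REq (B := Tensor₆ 𝕜 H) Q.evCoevMap₆
      (Q.conv (B := Tensor₆ 𝕜 H) (leg₆ 𝕜 H 2).toLinearMap (leg₆ 𝕜 H 5).toLinearMap) Q.triv ∧
    REq (B := Tensor₆ 𝕜 H) Q.evCoevMap₆
      (Q.conv (B := Tensor₆ 𝕜 H) (leg₆ 𝕜 H 3).toLinearMap (leg₆ 𝕜 H 4).toLinearMap) Q.triv := by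
  constructor
  all_goals
    refine Q.rEq_triv_of_tmul fun a x y => ?_
  · rw [conv_apply, mulMap_leg₆_two_five,
      Algebra.TensorProduct.tmul_mul_tmul, mul_one, evCoevMap₆, TensorProduct.map_tmul,
      Q.isAntipode.evCoevMap_comul_right, TensorProduct.map_tmul,
      TensorProduct.smul_tmul']
  · rw [conv_apply, mulMap_leg₆_three_four,
      Algebra.TensorProduct.tmul_mul_tmul, mul_one, evCoevMap₆, TensorProduct.map_tmul,
      Q.isAntipode.evCoevMap_comul_right, TensorProduct.map_tmul,
      TensorProduct.tmul_smul]

theorem rEq_coevEvMap₆ : REq (B := Tensor₆ 𝕜 H) Q.coevEvMap₆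
      (Q.conv (B := Tensor₆ 𝕜 H) (leg₆ 𝕜 H 1).toLinearMap (leg₆ 𝕜 H 2).toLinearMap) Q.triv ∧
    REq (B := Tensor₆ 𝕜 H) Q.coevEvMap₆
      (Q.conv (B := Tensor₆ 𝕜 H) (leg₆ 𝕜 H 0).toLinearMap (leg₆ 𝕜 H 3).toLinearMap) Q.triv := by
  constructor
  all_goals
    refine Q.rEq_triv_of_tmul fun a x y => ?_
  · rw [conv_apply, mulMap_leg₆_one_two,
      Algebra.TensorProduct.tmul_mul_tmul, mul_one, coevEvMap₆, LinearMap.comp_apply,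
      TensorProduct.map_tmul, Q.isAntipode.coevEvMap_comul_right, LinearMap.comp_apply,
      TensorProduct.map_tmul, ← TensorProduct.smul_tmul', map_smul]
  · rw [conv_apply, mulMap_leg₆_zero_three,
      Algebra.TensorProduct.tmul_mul_tmul, mul_one, coevEvMap₆, LinearMap.comp_apply,
      TensorProduct.map_tmul, Q.isAntipode.coevEvMap_comul_right, LinearMap.comp_apply,
      TensorProduct.map_tmul, TensorProduct.tmul_smul, map_smul]

theorem lEq_coevEvMap₆ : LEq (B := Tensor₆ 𝕜 H) Q.coevEvMap₆
      (Q.conv (B := Tensor₆ 𝕜 H) (leg₆ 𝕜 H 2).toLinearMap (leg₆ 𝕜 H 5).toLinearMap) Q.triv ∧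
    LEq (B := Tensor₆ 𝕜 H) Q.coevEvMap₆
      (Q.conv (B := Tensor₆ 𝕜 H) (leg₆ 𝕜 H 3).toLinearMap (leg₆ 𝕜 H 4).toLinearMap) Q.triv := by
  constructor
  all_goals
    refine Q.lEq_triv_of_tmul fun a x y => ?_
  · rw [conv_apply, mulMap_leg₆_two_five,
      Algebra.TensorProduct.tmul_mul_tmul, one_mul, coevEvMap₆, LinearMap.comp_apply,
      TensorProduct.map_tmul, Q.isAntipode.coevEvMap_comul_left, LinearMap.comp_apply,
      TensorProduct.map_tmul, ← TensorProduct.smul_tmul', map_smul]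
  · rw [conv_apply, mulMap_leg₆_three_four,
      Algebra.TensorProduct.tmul_mul_tmul, one_mul, coevEvMap₆, LinearMap.comp_apply,
      TensorProduct.map_tmul, Q.isAntipode.coevEvMap_comul_left, LinearMap.comp_apply,
      TensorProduct.map_tmul, TensorProduct.tmul_smul, map_smul]

theorem isHom_leg₆ (i : Fin 6) : IsHom (𝕜 := 𝕜) (H := H)
    (B := Tensor₆ 𝕜 H) (leg₆ 𝕜 H i).toLinearMap :=
  isHom_algHom _

theorem eq_mul_mul_of_tmul₃ {A B : Type*} [Ring A] [Algebra 𝕜 A] [Ring B] [Algebra 𝕜 B]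
    {C : B →ₗ[𝕜] A} {φ : H ⊗[𝕜] H ⊗[𝕜] H →ₗ[𝕜] B} {ψ : H ⊗[𝕜] H ⊗[𝕜] H →ₗ[𝕜] A} {b b' : B}
    (h : ∀ x y z, ψ (x ⊗ₜ y ⊗ₜ z) = C (b * φ (x ⊗ₜ y ⊗ₜ z) * b')) (t) :
    ψ t = C (b * φ t * b') :=
  LinearMap.congr_fun (g := C ∘ₗ LinearMap.mulRight 𝕜 b' ∘ₗ LinearMap.mulLeft 𝕜 b ∘ₗ φ)
    (TensorProduct.ext_threefold h) t

theorem evCoevMap_comul (τ κ : (H ⊗[𝕜] H) ⊗[𝕜] (H ⊗[𝕜] H)) (t : H ⊗[𝕜] H ⊗[𝕜] H) :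
    evCoevMap Q.comulS (Q.γMap τ) Q.Δ (Q.δMap κ) Q.comulS t =
      Q.evCoevMap₆ (mulMap₄ (B := Tensor₆ 𝕜 H) (leg₆ 𝕜 H 0).toLinearMap (leg₆ 𝕜 H 1).toLinearMap
        (leg₆ 𝕜 H 2).toLinearMap (leg₆ 𝕜 H 3).toLinearMap τ *
        mulMap₃ (A := Tensor₆ 𝕜 H)
          (Q.conv (B := Tensor₆ 𝕜 H) (leg₆ 𝕜 H 0).toLinearMap (leg₆ 𝕜 H 1).toLinearMap)
          (Q.conv (B := Tensor₆ 𝕜 H) (leg₆ 𝕜 H 2).toLinearMap (leg₆ 𝕜 H 3).toLinearMap)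
          (Q.conv (B := Tensor₆ 𝕜 H) (leg₆ 𝕜 H 4).toLinearMap (leg₆ 𝕜 H 5).toLinearMap) t *
        mulMap₄ (B := Tensor₆ 𝕜 H) (leg₆ 𝕜 H 2).toLinearMap (leg₆ 𝕜 H 3).toLinearMap
        (leg₆ 𝕜 H 4).toLinearMap (leg₆ 𝕜 H 5).toLinearMap κ) := by
  refine eq_mul_mul_of_tmul₃ (B := Tensor₆ 𝕜 H) (fun x y z => ?_) t
  rw [mulMap₃_tmul, conv_apply, conv_apply, conv_apply, evCoevMap₆_apply, evCoevMap_tmul]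
  rfl

theorem coevEvMap_comul (τ κ : (H ⊗[𝕜] H) ⊗[𝕜] (H ⊗[𝕜] H)) (t : H ⊗[𝕜] H ⊗[𝕜] H) :
    coevEvMap Q.Δ (Q.δMap κ) Q.comulS (Q.γMap τ) t =
      Q.coevEvMap₆ (mulMap₄ (B := Tensor₆ 𝕜 H) (leg₆ 𝕜 H 2).toLinearMap (leg₆ 𝕜 H 3).toLinearMap
        (leg₆ 𝕜 H 4).toLinearMap (leg₆ 𝕜 H 5).toLinearMap τ *
        mulMap₃ (A := Tensor₆ 𝕜 H)
          (Q.conv (B := Tensor₆ 𝕜 H) (leg₆ 𝕜 H 0).toLinearMap (leg₆ 𝕜 H 1).toLinearMap)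
          (Q.conv (B := Tensor₆ 𝕜 H) (leg₆ 𝕜 H 2).toLinearMap (leg₆ 𝕜 H 3).toLinearMap)
          (Q.conv (B := Tensor₆ 𝕜 H) (leg₆ 𝕜 H 4).toLinearMap (leg₆ 𝕜 H 5).toLinearMap) t *
        mulMap₄ (B := Tensor₆ 𝕜 H) (leg₆ 𝕜 H 0).toLinearMap (leg₆ 𝕜 H 1).toLinearMap
        (leg₆ 𝕜 H 2).toLinearMap (leg₆ 𝕜 H 3).toLinearMap κ) := by
  refine eq_mul_mul_of_tmul₃ (B := Tensor₆ 𝕜 H) (fun x y z => ?_) t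
  rw [mulMap₃_tmul, conv_apply, conv_apply, conv_apply, coevEvMap₆_apply, coevEvMap_tmul]
  rfl

attribute [local irreducible] leg₆

theorem mulMap₄_γ_element' {n : ℕ} {B : Type*} [Ring B] [Algebra 𝕜 B]
    {ι : Fin n → H →ₗ[𝕜] B} (hι : ∀ i, IsHom (ι i)) (hc : ∀ i j, i ≠ j → Com (ι i) (ι j))
    (i j k l : Fin n)
    (h : ∀ p q : Fin 4, p ≠ q → (![i, j, k, l] : Fin 4 → Fin n) p ≠ ![i, j, k, l] q) :
    mulMap₄ (ι i) (ι j) (ι k) (ι l) (tensorOne₃ (↑Q.Φ⁻¹ : H ⊗[𝕜] H ⊗[𝕜] H) *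
      comulOneOne Q.Δ (Q.Φ : H ⊗[𝕜] H ⊗[𝕜] H)) =
      Q.ascInv (ι i) (ι j) (ι k) * Q.asc (Q.conv (ι i) (ι j)) (ι k) (ι l) :=
  Q.mulMap₄_γ_element (ι := fun p => ι ((![i, j, k, l] : Fin 4 → Fin n) p))
    (fun _ => hι _) (fun p q hpq => hc _ _ (h p q hpq))

theorem mulMap₄_δ_element' {n : ℕ} {B : Type*} [Ring B] [Algebra 𝕜 B]
    {ι : Fin n → H →ₗ[𝕜] B} (hι : ∀ i, IsHom (ι i)) (hc : ∀ i j, i ≠ j → Com (ι i) (ι j))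
    (i j k l : Fin n)
    (h : ∀ p q : Fin 4, p ≠ q → (![i, j, k, l] : Fin 4 → Fin n) p ≠ ![i, j, k, l] q) :
    mulMap₄ (ι i) (ι j) (ι k) (ι l) (comulOneOne Q.Δ (↑Q.Φ⁻¹ : H ⊗[𝕜] H ⊗[𝕜] H) *
      tensorOne₃ (Q.Φ : H ⊗[𝕜] H ⊗[𝕜] H)) =
      Q.ascInv (Q.conv (ι i) (ι j)) (ι k) (ι l) * Q.asc (ι i) (ι j) (ι k) :=
  Q.mulMap₄_δ_element (ι := fun p => ι ((![i, j, k, l] : Fin 4 → Fin n) p))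
    (fun _ => hι _) (fun p q hpq => hc _ _ (h p q hpq))

theorem evCoevMap₆_tmul (x y : H ⊗[𝕜] H ⊗[𝕜] H) : Q.evCoevMap₆ (x ⊗ₜ y) =
    evCoevMap Q.S.toLinearMap Q.α (AlgHom.id 𝕜 H) Q.β Q.S.toLinearMap x ⊗ₜ
    evCoevMap Q.S.toLinearMap Q.α (AlgHom.id 𝕜 H) Q.β Q.S.toLinearMap y :=
  TensorProduct.map_tmul ..

theorem coevEvMap₆_tmul (x y : H ⊗[𝕜] H ⊗[𝕜] H) : Q.coevEvMap₆ (x ⊗ₜ y) =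
    coevEvMap (AlgHom.id 𝕜 H) Q.β Q.S.toLinearMap Q.α y ⊗ₜ
    coevEvMap (AlgHom.id 𝕜 H) Q.β Q.S.toLinearMap Q.α x := by
  rw [coevEvMap₆, LinearMap.comp_apply, TensorProduct.map_tmul]
  exact flip_tmul ..

theorem one_tmul_mul_tmul_one {A : Type*} [Ring A] [Algebra 𝕜 A] (x y : A) :
    (1 ⊗ₜ[𝕜] x : A ⊗[𝕜] A) * (y ⊗ₜ 1) = y ⊗ₜ x := by simp

theorem tmul_one_mul_one_tmul {A : Type*} [Ring A] [Algebra 𝕜 A] (x y : A) :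
    (y ⊗ₜ[𝕜] 1 : A ⊗[𝕜] A) * (1 ⊗ₜ x) = y ⊗ₜ x := by simp

/-- After `contract_six`, two copies of Φ remain on disjoint triples of legs, each evaluated to 1 by
the antipode axiom of `Q`. -/
theorem evCoevMap_γ_δ :
    evCoevMap Q.comulS Q.γ Q.Δ Q.δ Q.comulS (Q.Φ : H ⊗[𝕜] H ⊗[𝕜] H) = 1 := by
  have e₁ := Q.mulMap₄_γ_element' (B := Tensor₆ 𝕜 H)
    (ι := fun i => (leg₆ 𝕜 H i).toLinearMap) isHom_leg₆ com_leg₆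
    0 1 2 3 (by decide)
  have e₂ := Q.mulMap₄_δ_element' (B := Tensor₆ 𝕜 H)
    (ι := fun i => (leg₆ 𝕜 H i).toLinearMap) isHom_leg₆ com_leg₆
    2 3 4 5 (by decide)
  have e₃ := Q.contract_six (B := Tensor₆ 𝕜 H) (C := Q.evCoevMap₆)
    (ι := fun i => (leg₆ 𝕜 H i).toLinearMap) isHom_leg₆ com_leg₆
    Q.lEq_evCoevMap₆.1 Q.lEq_evCoevMap₆.2 Q.rEq_evCoevMap₆.1 Q.rEq_evCoevMap₆.2
  have e₄ := congrArg₂ (· * ·) (mulMap₃_leg₆_snd (Q.Φ : H ⊗[𝕜] H ⊗[𝕜] H))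
    (mulMap₃_leg₆_fst (Q.Φ : H ⊗[𝕜] H ⊗[𝕜] H))
  rw [γ, δ, evCoevMap_comul, e₁, e₂]
  refine e₃.trans ((congrArg Q.evCoevMap₆ (e₄.trans (one_tmul_mul_tmul_one _ _))).trans ?_)
  rw [evCoevMap₆_tmul, Q.isAntipode.coassociator]
  rfl

theorem coevEvMap_δ_γ :
    coevEvMap Q.Δ Q.δ Q.comulS Q.γ (↑Q.Φ⁻¹ : H ⊗[𝕜] H ⊗[𝕜] H) = 1 := by
  have e₁ := Q.mulMap₄_γ_element' (B := Tensor₆ 𝕜 H)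
    (ι := fun i => (leg₆ 𝕜 H i).toLinearMap) isHom_leg₆ com_leg₆
    2 3 4 5 (by decide)
  have e₂ := Q.mulMap₄_δ_element' (B := Tensor₆ 𝕜 H)
    (ι := fun i => (leg₆ 𝕜 H i).toLinearMap) isHom_leg₆ com_leg₆
    0 1 2 3 (by decide)
  have e₃ := Q.contract_six' (B := Tensor₆ 𝕜 H) (C := Q.coevEvMap₆)
    (ι := fun i => (leg₆ 𝕜 H i).toLinearMap) isHom_leg₆ com_leg₆
    Q.rEq_coevEvMap₆.1 Q.rEq_coevEvMap₆.2 Q.lEq_coevEvMap₆.1 Q.lEq_coevEvMap₆.2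
  have e₄ := congrArg₂ (· * ·) (mulMap₃_leg₆_fst (↑Q.Φ⁻¹ : H ⊗[𝕜] H ⊗[𝕜] H))
    (mulMap₃_leg₆_snd (↑Q.Φ⁻¹ : H ⊗[𝕜] H ⊗[𝕜] H))
  rw [γ, δ, coevEvMap_comul, e₁, e₂]
  refine e₃.trans ((congrArg Q.coevEvMap₆ (e₄.trans (tmul_one_mul_one_tmul _ _))).trans ?_)
  rw [coevEvMap₆_tmul, Q.isAntipode.coassociator_inv]
  rfl

/-- `(S ⊗ S) Δᵀ` with `γ` and `δ` is an antipode along the co-product. -/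
theorem isAntipode_comulS : Q.IsAntipode Q.Δ Q.comulS Q.γ Q.δ where
  map_one := by simp [comulS_apply, Algebra.TensorProduct.one_def, Q.S_one]
  map_mul a b := by
    have : ∀ x y : H ⊗[𝕜] H, flip (x * y) = flip x * flip y :=
      map_mul (Algebra.TensorProduct.comm 𝕜 H H)
    rw [comulS_apply, map_mul, this, SS_mul]
    rfl
  left := Q.evMap_γ_comul
  right := Q.coevMap_δ_comul
  coassociator := Q.evCoevMap_γ_δ
  coassociator_inv := Q.coevEvMap_δ_γ

end QuasiHopfAlgebra

end QHA

namespace QHA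

/-! ### The Drinfeld twists as intertwiners -/

section Flip

variable {𝕜 H : Type*} [Field 𝕜] [Ring H] [Algebra 𝕜 H]

theorem flip_mul (x y : H ⊗[𝕜] H) : flip (x * y) = flip x * flip y :=
  map_mul (Algebra.TensorProduct.comm 𝕜 H H) x y

theorem flip_one : flip (1 : H ⊗[𝕜] H) = 1 := map_one (Algebra.TensorProduct.comm 𝕜 H H)

theorem flip_flip (x : H ⊗[𝕜] H) : flip (flip x) = x :=
  (TensorProduct.comm 𝕜 H H).left_inv x

end Flip

namespace QuasiHopfAlgebra

open QuasiBialgebra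

variable {𝕜 H : Type*} [Field 𝕜] [Ring H] [Algebra 𝕜 H] (Q : QuasiHopfAlgebra 𝕜 H)

theorem S_symm_mul (a b : H) : Q.S.symm (a * b) = Q.S.symm b * Q.S.symm a :=
  Q.S.injective (by simp [Q.S_mul])

theorem S_symm_one : Q.S.symm 1 = 1 := Q.S.injective (by simp [Q.S_one])

theorem SS_symm_mul (x y : H ⊗[𝕜] H) : Q.SS.symm (x * y) = Q.SS.symm y * Q.SS.symm x :=
  Q.SS.injective (by simp [Q.SS_mul])

theorem SS_symm_one : Q.SS.symm 1 = 1 := Q.SS.injective (by simp [Q.SS_one])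

@[simp]
theorem SS_symm_tmul (x y : H) : Q.SS.symm (x ⊗ₜ y) = Q.S.symm x ⊗ₜ Q.S.symm y := by
  simp [SS]

theorem flip_SS (x : H ⊗[𝕜] H) : flip (Q.SS x) = Q.SS (flip x) := by
  induction x with
  | zero => simp
  | add a b ha hb => simp [ha, hb]
  | tmul a b => simp

/-- The co-product of the antipode is an antipode along the co-product. -/
theorem isAntipode_comul : Q.IsAntipode Q.Δ (Q.Δ.toLinearMap ∘ₗ Q.S.toLinearMap) (Q.Δ Q.α)
    (Q.Δ Q.β) := by
  simpa using Q.isAntipode.map Q.Δ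

/-- Because Δ(Y β S(Z)) = Δ(Y) Δ(β) Δ(S(Z)), the defining formula is exactly that of the intertwiner
between the two antipodes along Δ. -/
theorem drinfeldTwist_eq : Q.drinfeldTwist = evCoevMap Q.comulS Q.γ Q.Δ (Q.Δ Q.β)
    (Q.Δ.toLinearMap ∘ₗ Q.S.toLinearMap) (Q.Φ : H ⊗[𝕜] H ⊗[𝕜] H) :=
  LinearMap.congr_fun
    (f := mulMap Q.comulS (LinearMap.mulLeft 𝕜 Q.γ ∘ₗ Q.Δ.toLinearMap ∘ₗ
      mulMap LinearMap.id (LinearMap.mulLeft 𝕜 Q.β ∘ₗ Q.S.toLinearMap)) ∘ₗ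
        (TensorProduct.assoc 𝕜 H H H).toLinearMap)
    (TensorProduct.ext_threefold fun x y z => by simp [mul_assoc]) _

/-- The Drinfeld twist as a unit. -/
noncomputable def drinfeldUnit : (H ⊗[𝕜] H)ˣ := Q.isAntipode_comulS.unit Q.isAntipode_comul

theorem coe_drinfeldUnit : (Q.drinfeldUnit : H ⊗[𝕜] H) = Q.drinfeldTwist :=
  Q.drinfeldTwist_eq.symm

theorem drinfeldUnit_mul_comul_α : ↑Q.drinfeldUnit * Q.Δ Q.α = Q.γ :=
  Q.isAntipode_comulS.evCoevMap_mul Q.isAntipode_comul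

theorem δ_mul_drinfeldUnit : Q.δ * ↑Q.drinfeldUnit = Q.Δ Q.β :=
  Q.isAntipode_comulS.mul_evCoevMap Q.isAntipode_comul

theorem drinfeldUnit_mul_comul_S (a : H) :
    ↑Q.drinfeldUnit * Q.Δ (Q.S a) = Q.SS (flip (Q.Δ a)) * ↑Q.drinfeldUnit :=
  Q.isAntipode_comulS.evCoevMap_intertwines Q.isAntipode_comul a

/-- The Drinfeld twist is characterized by its action on `Δ(α)` and on `Δ(S(a))`. -/
theorem eq_drinfeldUnit {X : H ⊗[𝕜] H} (h₁ : X * Q.Δ Q.α = Q.γ)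
    (h₂ : ∀ a, X * Q.Δ (Q.S a) = Q.SS (flip (Q.Δ a)) * X) : X = Q.drinfeldUnit :=
  Q.isAntipode_comul.eq_evCoevMap h₁ h₂

/-- The second Drinfeld twist as a unit. -/
noncomputable def secondDrinfeldUnit : (H ⊗[𝕜] H)ˣ where
  val := Q.SS.symm (flip (Q.drinfeldUnit : H ⊗[𝕜] H))
  inv := Q.SS.symm (flip (↑Q.drinfeldUnit⁻¹ : H ⊗[𝕜] H))
  val_inv := by rw [← SS_symm_mul, ← flip_mul, Units.inv_mul, flip_one, SS_symm_one]
  inv_val := by rw [← SS_symm_mul, ← flip_mul, Units.mul_inv, flip_one, SS_symm_one]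

theorem coe_secondDrinfeldUnit : (Q.secondDrinfeldUnit : H ⊗[𝕜] H) = Q.secondDrinfeldTwist := by
  rw [secondDrinfeldTwist, ← coe_drinfeldUnit]
  rfl

/-- The intertwining relation at a = S⁻¹(β) reads F_δ Δ(β) = (S ⊗ S)Δᵀ(S⁻¹(β)) F_δ; substitute Δ(β)
= δ F_δ and cancel F_δ on the right. -/
theorem drinfeldUnit_mul_δ : ↑Q.drinfeldUnit * Q.δ = Q.SS (flip (Q.Δ (Q.S.symm Q.β))) := by
  have h := Q.drinfeldUnit_mul_comul_S (Q.S.symm Q.β)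
  rw [LinearEquiv.apply_symm_apply, ← δ_mul_drinfeldUnit, ← mul_assoc] at h
  exact (Units.mul_left_inj _).mp h

/-- This relation and the next, once conjugated, are the two properties characterizing the Drinfeld
twist of the conjugate algebra. -/
theorem SS_symm_δ_mul_secondDrinfeldUnit :
    Q.SS.symm (flip Q.δ) * ↑Q.secondDrinfeldUnit = Q.Δ (Q.S.symm Q.β) := by
  refine (Q.SS_symm_mul _ _).symm.trans ?_
  rw [← flip_mul, drinfeldUnit_mul_δ, flip_SS, flip_flip, LinearEquiv.symm_apply_apply]

theorem secondDrinfeldUnit_mul_comul (a : H) :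
    ↑Q.secondDrinfeldUnit * Q.Δ (Q.S.symm a) =
      Q.SS.symm (flip (Q.Δ a)) * ↑Q.secondDrinfeldUnit := by
  have h := congrArg (fun x => Q.SS.symm (flip x)) (Q.drinfeldUnit_mul_comul_S (Q.S.symm a))
  simp only [LinearEquiv.apply_symm_apply, flip_mul, SS_symm_mul, flip_SS, flip_flip,
    LinearEquiv.symm_apply_apply] at h
  exact h.symm

end QuasiHopfAlgebra

end QHA

/-! ### Twisting quasi-bialgebras and their antipodes -/

namespace QHA

theorem algHom_inv_mul {𝕜 A B : Type*} [Field 𝕜] [Ring A] [Algebra 𝕜 A] [Ring B] [Algebra 𝕜 B]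
    (f : A →ₐ[𝕜] B) (u : Aˣ) : f ↑u⁻¹ * f u = 1 := by
  rw [← map_mul, Units.inv_mul, map_one]

namespace QuasiBialgebra

variable {𝕜 H B : Type*} [Field 𝕜] [Ring H] [Algebra 𝕜 H] [Ring B] [Algebra 𝕜 B]

/-- The quasi-bialgebra `P'` is the twist of `P` by `F`. -/
structure IsTwistBy (P' P : QuasiBialgebra 𝕜 H) (F : (H ⊗[𝕜] H)ˣ) : Prop where
  isTwist : P.IsTwist F
  counit : P'.ε = P.ε
  comul : ∀ a, P'.Δ a = ↑F * P.Δ a * ↑F⁻¹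
  coassociator : (P'.Φ : H ⊗[𝕜] H ⊗[𝕜] H) = P.twistΦ F

variable {P' P : QuasiBialgebra 𝕜 H} {F : (H ⊗[𝕜] H)ˣ}

theorem IsTwist.inv (h : P.IsTwist F) : P.IsTwist F⁻¹ := by
  have h₁ := congrArg (counitOne P.ε) F.mul_inv
  have h₂ := congrArg (oneCounit P.ε) F.mul_inv
  rw [map_mul, h.1, one_mul, map_one] at h₁
  rw [map_mul, h.2, one_mul, map_one] at h₂
  exact ⟨h₁, h₂⟩

namespace IsTwistBy

theorem coassociator_inv (h : IsTwistBy P' P F) : (↑P'.Φ⁻¹ : H ⊗[𝕜] H ⊗[𝕜] H) =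
    oneTensor₂ (F : H ⊗[𝕜] H) * oneComul P.Δ (F : H ⊗[𝕜] H) * ↑P.Φ⁻¹ *
      comulOne P.Δ (↑F⁻¹ : H ⊗[𝕜] H) * tensorOne₂ (↑F⁻¹ : H ⊗[𝕜] H) := by
  have e : P'.Φ = Units.map (tensorOne₂ : H ⊗[𝕜] H →ₐ[𝕜] _) F * Units.map (comulOne P.Δ) F *
      P.Φ * Units.map (oneComul P.Δ) F⁻¹ *
      Units.map (oneTensor₂ : H ⊗[𝕜] H →ₐ[𝕜] _) F⁻¹ := Units.ext h.coassociator
  rw [e]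
  simp [mul_assoc, ← map_inv]

variable {φ ψ χ : H →ₗ[𝕜] B} (h₁ : IsHom φ) (h₂ : IsHom ψ) (h₃ : IsHom χ) (h₁₂ : Com φ ψ)
  (h₁₃ : Com φ χ) (h₂₃ : Com ψ χ)

include h₁ h₂ h₁₂ in
theorem sc_conv (h : IsTwistBy P' P F) : Sc (mulMap φ ψ F) (P.conv φ ψ) (P'.conv φ ψ) :=
  fun a => by
    rw [SemiconjBy, conv_apply, conv_apply, ← mulMap_mul h₁ h₂ h₁₂, ← mulMap_mul h₁ h₂ h₁₂,
      h.comul, Units.inv_mul_cancel_right]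

include h₁ h₂ h₃ h₁₂ h₁₃ h₂₃

theorem asc_eq (h : IsTwistBy P' P F) : P'.asc φ ψ χ =
    mulMap φ ψ F * mulMap (P.conv φ ψ) χ F * P.asc φ ψ χ * mulMap φ (P.conv ψ χ) ↑F⁻¹ *
      mulMap ψ χ ↑F⁻¹ := by
  have l : ∀ x, mulMap₃ φ ψ χ (tensorOne₂ x) = mulMap φ ψ x := fun x => by
    simp [mulMap₃, h₃.map_one]
  have r : ∀ x, mulMap₃ φ ψ χ (oneTensor₂ x) = mulMap ψ χ x := LinearMap.congr_fun
    (f := mulMap₃ φ ψ χ ∘ₗ oneTensor₂.toLinearMap)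
    (TensorProduct.ext' fun x y => by simp [h₁.map_one])
  rw [asc, h.coassociator, twistΦ]
  simp only [mulMap₃_mul h₁ h₂ h₃ h₁₂ h₁₃ h₂₃, l, r, mulMap₃_comulOne, mulMap₃_oneComul]
  rfl

theorem ascInv_eq (h : IsTwistBy P' P F) : P'.ascInv φ ψ χ =
    mulMap ψ χ F * mulMap φ (P.conv ψ χ) F * P.ascInv φ ψ χ * mulMap (P.conv φ ψ) χ ↑F⁻¹ *
      mulMap φ ψ ↑F⁻¹ := by
  have l : ∀ x, mulMap₃ φ ψ χ (tensorOne₂ x) = mulMap φ ψ x := fun x => by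
    simp [mulMap₃, h₃.map_one]
  have r : ∀ x, mulMap₃ φ ψ χ (oneTensor₂ x) = mulMap ψ χ x := LinearMap.congr_fun
    (f := mulMap₃ φ ψ χ ∘ₗ oneTensor₂.toLinearMap)
    (TensorProduct.ext' fun x y => by simp [h₁.map_one])
  rw [ascInv, h.coassociator_inv]
  simp only [mulMap₃_mul h₁ h₂ h₃ h₁₂ h₁₃ h₂₃, l, r, mulMap₃_comulOne, mulMap₃_oneComul]
  rfl

end IsTwistBy

end QuasiBialgebra

section EvCoev

variable {𝕜 H A : Type*} [Field 𝕜] [Ring H] [Algebra 𝕜 H] [Ring A] [Algebra 𝕜 A]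
  {P : QuasiBialgebra 𝕜 H} {f : H →ₐ[𝕜] A} {g : H →ₗ[𝕜] A} {α β : A}

namespace QuasiBialgebra.IsAntipode

/-- Factors on the first two legs modify only α, and factors on the last two only β. Hence the axiom
for the twisted α and β is the contraction of the untwisted map on an enlarged tensor. -/
theorem evCoevMap_mul_mul (h : P.IsAntipode f g α β) (s s' : H ⊗[𝕜] H) (t : H ⊗[𝕜] H ⊗[𝕜] H) :
    evCoevMap g α f β g (tensorOne₂ s * t * oneTensor₂ s') =
      evCoevMap g (evMap g α f s) f (coevMap f β g s') g t := by
  refine LinearMap.congr_fun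
    (f := evCoevMap g α f β g ∘ₗ LinearMap.mulRight 𝕜 _ ∘ₗ LinearMap.mulLeft 𝕜 _)
    (TensorProduct.ext_threefold fun x y z => ?_) t
  simp only [LinearMap.comp_apply, LinearMap.mulRight_apply, LinearMap.mulLeft_apply,
    evCoevMap_tmul]
  induction s with
  | zero => simp
  | add a b ha hb => simp only [map_add, add_mul, mul_add, ha, hb]
  | tmul a b =>
  induction s' with
  | zero => simp
  | add c d hc hd => simp only [map_add, add_mul, mul_add, hc, hd]
  | tmul c d => simp [h.map_mul, mul_assoc]

theorem coevEvMap_mul_mul (h : P.IsAntipode f g α β) (s s' : H ⊗[𝕜] H) (t : H ⊗[𝕜] H ⊗[𝕜] H) :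
    coevEvMap f β g α (oneTensor₂ s * t * tensorOne₂ s') =
      coevEvMap f (coevMap f β g s') g (evMap g α f s) t := by
  refine LinearMap.congr_fun
    (f := coevEvMap f β g α ∘ₗ LinearMap.mulRight 𝕜 _ ∘ₗ LinearMap.mulLeft 𝕜 _)
    (TensorProduct.ext_threefold fun x y z => ?_) t
  simp only [LinearMap.comp_apply, LinearMap.mulRight_apply, LinearMap.mulLeft_apply,
    coevEvMap_tmul]
  induction s with
  | zero => simp
  | add a b ha hb => simp only [map_add, add_mul, mul_add, ha, hb]
  | tmul a b =>
  induction s' with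
  | zero => simp
  | add c d hc hd => simp only [map_add, add_mul, mul_add, hc, hd]
  | tmul c d => simp [h.map_mul, mul_assoc]

theorem evMap_evMap (h : P.IsAntipode f g α β) (s t : H ⊗[𝕜] H) :
    evMap g (evMap g α f s) f t = evMap g α f (s * t) := by
  induction t with
  | zero => simp
  | add a b ha hb => simp [mul_add, ha, hb]
  | tmul a b => rw [h.evMap_mul, evMap_tmul]

theorem coevMap_coevMap (h : P.IsAntipode f g α β) (s t : H ⊗[𝕜] H) :
    coevMap f (coevMap f β g s) g t = coevMap f β g (t * s) := by
  induction t with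
  | zero => simp
  | add a b ha hb => simp [add_mul, ha, hb]
  | tmul a b => rw [h.mul_coevMap, coevMap_tmul]

theorem lEq_evCoevMap (h : P.IsAntipode f g α β) : LEq (evCoevMap g α f β g)
    (P.conv (leg₃ 𝕜 H 0).toLinearMap (leg₃ 𝕜 H 1).toLinearMap) P.triv :=
  lEq_triv fun a y => by
    rw [conv_apply, mulMap_leg₃_zero_one, h.evCoevMap_comul_left]

theorem rEq_evCoevMap (h : P.IsAntipode f g α β) : REq (evCoevMap g α f β g)
    (P.conv (leg₃ 𝕜 H 1).toLinearMap (leg₃ 𝕜 H 2).toLinearMap) P.triv :=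
  rEq_triv fun a y => by
    rw [conv_apply, mulMap_leg₃_one_two, h.evCoevMap_comul_right]

theorem lEq_coevEvMap (h : P.IsAntipode f g α β) : LEq (coevEvMap f β g α)
    (P.conv (leg₃ 𝕜 H 1).toLinearMap (leg₃ 𝕜 H 2).toLinearMap) P.triv :=
  lEq_triv fun a y => by
    rw [conv_apply, mulMap_leg₃_one_two, h.coevEvMap_comul_left]

theorem rEq_coevEvMap (h : P.IsAntipode f g α β) : REq (coevEvMap f β g α)
    (P.conv (leg₃ 𝕜 H 0).toLinearMap (leg₃ 𝕜 H 1).toLinearMap) P.triv :=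
  rEq_triv fun a y => by
    rw [conv_apply, mulMap_leg₃_zero_one, h.coevEvMap_comul_right]

theorem comulOne_eq (x : H ⊗[𝕜] H) : comulOne P.Δ x = mulMap
    (P.conv (leg₃ 𝕜 H 0).toLinearMap (leg₃ 𝕜 H 1).toLinearMap) (leg₃ 𝕜 H 2).toLinearMap x := by
  rw [← mulMap₃_comulOne, mulMap₃_leg₃]

theorem oneComul_eq (x : H ⊗[𝕜] H) : oneComul P.Δ x = mulMap (leg₃ 𝕜 H 0).toLinearMap
    (P.conv (leg₃ 𝕜 H 1).toLinearMap (leg₃ 𝕜 H 2).toLinearMap) x := by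
  rw [← mulMap₃_oneComul, mulMap₃_leg₃]

/-- The antipode of a twisted quasi-bialgebra. -/
theorem twist {P' : QuasiBialgebra 𝕜 H} {F : (H ⊗[𝕜] H)ˣ} (h : P.IsAntipode f g α β)
    (hF : IsTwistBy P' P F) :
    P'.IsAntipode f g (evMap g α f (↑F⁻¹ : H ⊗[𝕜] H)) (coevMap f β g (F : H ⊗[𝕜] H)) where
  map_one := h.map_one
  map_mul := h.map_mul
  left a := by
    rw [h.evMap_evMap, hF.comul, mul_assoc, Units.inv_mul_cancel_left, h.evMap_comul_mul,
      hF.counit]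
  right a := by
    rw [h.coevMap_coevMap, hF.comul, Units.inv_mul_cancel_right, h.coevMap_mul_comul,
      hF.counit]
  coassociator := by
    -- Under the contraction, (Δ ⊗ 1)F on the left becomes (ε ⊗ 1)F = 1, and (1 ⊗ Δ)F⁻¹ on the right
    -- becomes (1 ⊗ ε)F⁻¹ = 1. The outer F ⊗ 1 and 1 ⊗ F⁻¹ cancel against the twists of α and β.
    have e₁ := h.lEq_evCoevMap.mulMap (LEq.refl (φ := (leg₃ 𝕜 H 2).toLinearMap))
      P.com_triv_left P.com_triv_left (F : H ⊗[𝕜] H)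
    have e₂ := (REq.refl (φ := (leg₃ 𝕜 H 0).toLinearMap)).mulMap h.rEq_evCoevMap
      P.com_triv_right P.com_triv_right (↑F⁻¹ : H ⊗[𝕜] H)
    rw [mulMap_triv_left, hF.isTwist.1, (isHom_algHom _).map_one, ← comulOne_eq] at e₁
    rw [mulMap_triv_right, hF.isTwist.inv.2, (isHom_algHom _).map_one, ← oneComul_eq] at e₂
    rw [← h.evCoevMap_mul_mul, hF.coassociator, twistΦ]
    simp only [← mul_assoc, algHom_inv_mul, one_mul]
    rw [mul_assoc _ (oneTensor₂ _), algHom_inv_mul, mul_one, e₂, mul_one, e₁, one_mul,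
      h.coassociator]
  coassociator_inv := by
    have hc := com_leg₃ (𝕜 := 𝕜) (H := H)
    have e₁ := (LEq.refl (φ := (leg₃ 𝕜 H 0).toLinearMap)).mulMap h.lEq_coevEvMap
      (P.com_conv_right (hc _ _ (by decide)) (hc _ _ (by decide))) P.com_triv_right
      (F : H ⊗[𝕜] H)
    have e₂ := h.rEq_coevEvMap.mulMap (REq.refl (φ := (leg₃ 𝕜 H 2).toLinearMap))
      (P.com_conv_left (hc _ _ (by decide)) (hc _ _ (by decide))) P.com_triv_left
      (↑F⁻¹ : H ⊗[𝕜] H)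
    rw [mulMap_triv_right, hF.isTwist.2, (isHom_algHom _).map_one,
      ← oneComul_eq] at e₁
    rw [mulMap_triv_left, hF.isTwist.inv.1, (isHom_algHom _).map_one, ← comulOne_eq] at e₂
    rw [← h.coevEvMap_mul_mul, hF.coassociator_inv]
    simp only [← mul_assoc, algHom_inv_mul, one_mul]
    rw [mul_assoc _ (tensorOne₂ _), algHom_inv_mul, mul_one, e₂, mul_one, e₁, one_mul,
      h.coassociator_inv]

end QuasiBialgebra.IsAntipode

end EvCoev

end QHA

/-! ### The Drinfeld twist of a twisted quasi-Hopf algebra -/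

namespace QHA

theorem mulMap_mul_inv {𝕜 H B : Type*} [Field 𝕜] [Ring H] [Algebra 𝕜 H] [Ring B] [Algebra 𝕜 B]
    {φ ψ : H →ₗ[𝕜] B} (h₁ : IsHom φ) (h₂ : IsHom ψ) (h : Com φ ψ) (F : (H ⊗[𝕜] H)ˣ) :
    mulMap φ ψ (F : H ⊗[𝕜] H) * mulMap φ ψ (↑F⁻¹ : H ⊗[𝕜] H) = 1 := by
  rw [← mulMap_mul h₁ h₂ h, Units.mul_inv, mulMap_one h₁ h₂]

theorem mulMap_inv_mul {𝕜 H B : Type*} [Field 𝕜] [Ring H] [Algebra 𝕜 H] [Ring B] [Algebra 𝕜 B]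
    {φ ψ : H →ₗ[𝕜] B} (h₁ : IsHom φ) (h₂ : IsHom ψ) (h : Com φ ψ) (F : (H ⊗[𝕜] H)ˣ) :
    mulMap φ ψ (↑F⁻¹ : H ⊗[𝕜] H) * mulMap φ ψ (F : H ⊗[𝕜] H) = 1 := by
  rw [← mulMap_mul h₁ h₂ h, Units.inv_mul, mulMap_one h₁ h₂]

namespace QuasiBialgebra

variable {𝕜 H A B : Type*} [Field 𝕜] [Ring H] [Algebra 𝕜 H] [Ring A] [Algebra 𝕜 A]
  [Ring B] [Algebra 𝕜 B]

theorem mul_cancel_aux {M : Type*} [Monoid M] {a' a h b p c' c d' d e e' q f g' g : M}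
    (ha : a' * a = 1) (hah : h * a = a * h) (hd : d' * d = 1) (hc : c' * c = 1) (hg : g' * g = 1)
    (hp : p * e = e' * p) :
    a' * h * (a * b * p * c' * d' * (d * (c * e * q * f * g') * d')) * (d * g) =
      h * (b * (e' * (p * q * f))) := by
  have h₁ : a' * (h * a) = h := by rw [hah, ← mul_assoc, ha, one_mul]
  calc a' * h * (a * b * p * c' * d' * (d * (c * e * q * f * g') * d')) * (d * g) =
        a' * (h * a) * b * p * c' * (d' * d) * (c * e * q * f * g') * (d' * d) * g := by
        simp only [mul_assoc]
    _ = h * b * p * (c' * c) * e * q * f * (g' * g) := by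
        simp only [h₁, hd, mul_one, mul_assoc]
    _ = h * b * (p * e) * q * f := by simp only [hc, hg, mul_one, mul_assoc]
    _ = _ := by simp only [hp, mul_assoc]

/-- The element defining `γ` for a twisted quasi-bialgebra, under a map which contracts the inner
legs. -/
theorem IsTwistBy.contract_γ_element {P' P : QuasiBialgebra 𝕜 H} {F : (H ⊗[𝕜] H)ˣ}
    (h : IsTwistBy P' P F) {C : B →ₗ[𝕜] A} {ι : Fin 4 → H →ₗ[𝕜] B} (hι : ∀ i, IsHom (ι i))
    (hc : ∀ i j, i ≠ j → Com (ι i) (ι j)) (hl : LEq C (P.conv (ι 1) (ι 2)) P.triv) :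
    C (mulMap (ι 1) (ι 2) ↑F⁻¹ * mulMap (ι 0) (ι 3) ↑F⁻¹ *
      (P'.ascInv (ι 0) (ι 1) (ι 2) * P'.asc (P'.conv (ι 0) (ι 1)) (ι 2) (ι 3)) *
        (mulMap (ι 0) (ι 1) F * mulMap (ι 2) (ι 3) F)) =
      C (P.ascInv (ι 0) (ι 1) (ι 2) * P.asc (P.conv (ι 0) (ι 1)) (ι 2) (ι 3) *
        mulMap (P.conv (ι 0) (ι 1)) (P.conv (ι 2) (ι 3)) ↑F⁻¹) := by
  have c₀₁ := hc 0 1 (by decide)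
  have c₀₂ := hc 0 2 (by decide)
  have c₀₃ := hc 0 3 (by decide)
  have c₁₂ := hc 1 2 (by decide)
  have c₁₃ := hc 1 3 (by decide)
  have c₂₃ := hc 2 3 (by decide)
  have h₀₁ := P.isHom_conv (hι 0) (hι 1) c₀₁
  have k : ∀ {φ ψ χ : H →ₗ[𝕜] B}, Com φ χ → Com ψ χ → ∀ x, Sc (mulMap φ ψ x) χ χ :=
    fun h₁ h₂ x a => (sc_mulMap (h₁.symm a) (h₂.symm a) x).symm
  -- The twisted co-product on legs 0, 1 is the original one conjugated by F on these legs. Both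
  -- conjugating factors cancel later in `mul_cancel_aux`.
  have e₁ : P'.asc (P'.conv (ι 0) (ι 1)) (ι 2) (ι 3) = mulMap (ι 0) (ι 1) F *
      P'.asc (P.conv (ι 0) (ι 1)) (ι 2) (ι 3) * mulMap (ι 0) (ι 1) ↑F⁻¹ := by
    rw [(P'.sc_asc (h.sc_conv (hι 0) (hι 1) c₀₁) (k c₀₂ c₁₂ _) (k c₀₃ c₁₃ _)).eq, mul_assoc,
      mulMap_mul_inv (hι 0) (hι 1) c₀₁, mul_one]
  have hp := sc_mulMap (P.sc_ascInv_conv (hι 0) (hι 1) (hι 2) c₀₁ c₀₂ c₁₂)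
    (P.ascInv_sc c₀₃ c₁₃ c₂₃) (F : H ⊗[𝕜] H)
  rw [e₁, h.ascInv_eq (hι 0) (hι 1) (hι 2) c₀₁ c₀₂ c₁₂,
    h.asc_eq h₀₁ (hι 2) (hι 3) (P.com_conv_left c₀₂ c₁₂) (P.com_conv_left c₀₃ c₁₃) c₂₃,
    mul_cancel_aux (mulMap_inv_mul (hι 1) (hι 2) c₁₂ F)
      (sc_mulMap (k c₀₁ c₁₃.symm _) (k c₀₂ c₂₃.symm _) _).eq
      (mulMap_inv_mul (hι 0) (hι 1) c₀₁ F)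
      (mulMap_inv_mul h₀₁ (hι 2) (P.com_conv_left c₀₂ c₁₂) F)
      (mulMap_inv_mul (hι 2) (hι 3) c₂₃ F)
      hp.eq]
  set u := mulMap (ι 0) (ι 3) (↑F⁻¹ : H ⊗[𝕜] H) with hu
  have hl' : LEq (C ∘ₗ LinearMap.mulLeft 𝕜 u) (P.conv (ι 1) (ι 2)) P.triv :=
    hl.comp_mulLeft (P.sc_conv (k c₀₁ c₁₃.symm _) (k c₀₂ c₂₃.symm _)) P.sc_triv
  -- Contracting 12 turns F(0,12) into (1 ⊗ ε)F = 1 and F(0(12),3) into F(0,3), which then cancels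
  -- the F⁻¹ on legs 0, 3.
  have s₁ := (LEq.refl (φ := ι 0)).mulMap hl' (P.com_conv_right c₀₁ c₀₂) P.com_triv_right
    (F : H ⊗[𝕜] H)
  have s₂ := (P.lEq_conv (LEq.refl (φ := ι 0)) hl' (P.com_conv_right c₀₁ c₀₂)
    P.com_triv_right).mulMap (LEq.refl (φ := ι 3)) (by simpa using c₀₃) (by simpa using c₀₃)
    (F : H ⊗[𝕜] H)
  rw [mulMap_triv_right, h.isTwist.2, (hι 0).map_one] at s₁
  rw [conv_triv_right] at s₂
  refine (s₁ _).trans ?_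
  rw [one_mul]
  refine (s₂ _).trans ?_
  rw [LinearMap.comp_apply, LinearMap.mulLeft_apply, ← mul_assoc, hu,
    mulMap_inv_mul (hι 0) (hι 3) c₀₃, one_mul]

end QuasiBialgebra

namespace QuasiHopfAlgebra

open QuasiBialgebra

variable {𝕜 H : Type*} [Field 𝕜] [Ring H] [Algebra 𝕜 H] (Q : QuasiHopfAlgebra 𝕜 H)

theorem twistα_eq (F : (H ⊗[𝕜] H)ˣ) : Q.twistα F =
    evMap Q.S.toLinearMap Q.α (AlgHom.id 𝕜 H) (↑F⁻¹ : H ⊗[𝕜] H) := rfl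

theorem γMap_mul_left (s s' : H ⊗[𝕜] H) (x y z u : H) :
    Q.γMap (mulMap (leg₄ 𝕜 H 1).toLinearMap (leg₄ 𝕜 H 2).toLinearMap s *
      mulMap (leg₄ 𝕜 H 0).toLinearMap (leg₄ 𝕜 H 3).toLinearMap s' * ((x ⊗ₜ y) ⊗ₜ (z ⊗ₜ u))) =
      (Q.S y * evMap Q.S.toLinearMap Q.α (AlgHom.id 𝕜 H) s * z) ⊗ₜ
        (Q.S x * evMap Q.S.toLinearMap Q.α (AlgHom.id 𝕜 H) s' * u) := by
  induction s with
  | zero => simp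
  | add a b ha hb =>
    simp only [map_add, add_mul, mul_add, TensorProduct.add_tmul] at ha hb ⊢
    rw [ha, hb]
  | tmul a b =>
  induction s' with
  | zero => simp
  | add c d hc hd =>
    simp only [map_add, add_mul, mul_add, TensorProduct.tmul_add] at hc hd ⊢
    rw [hc, hd]
  | tmul c d => simp [Q.S_mul, mul_assoc]

variable {Q} {Q' : QuasiHopfAlgebra 𝕜 H} {F : (H ⊗[𝕜] H)ˣ} {w : H}

/-- The element `w` passes through S' and turns it into S until it meets α', where w α' = α_F. So
passing to the new antipode amounts to inserting F⁻¹ on the two contracted pairs. -/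
theorem tmul_mul_γMap (hα : w * Q'.α = Q.twistα F) (hS : ∀ a, Q.S a * w = w * Q'.S a)
    (t : (H ⊗[𝕜] H) ⊗[𝕜] (H ⊗[𝕜] H)) : (w ⊗ₜ[𝕜] w) * Q'.γMap t =
      Q.γMap (mulMap (leg₄ 𝕜 H 1).toLinearMap (leg₄ 𝕜 H 2).toLinearMap ↑F⁻¹ *
        mulMap (leg₄ 𝕜 H 0).toLinearMap (leg₄ 𝕜 H 3).toLinearMap ↑F⁻¹ * t) := by
  refine linearMap_eq_of_tmul₄ (C := LinearMap.mulLeft 𝕜 _ ∘ₗ Q'.γMap)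
    (C' := Q.γMap ∘ₗ LinearMap.mulLeft 𝕜 _) (fun x y z u => ?_) t
  simp only [LinearMap.comp_apply, LinearMap.mulLeft_apply, γMap_mul_left, γMap_tmul,
    Algebra.TensorProduct.tmul_mul_tmul, ← twistα_eq, ← hα, ← mul_assoc, hS]

theorem drinfeldUnit_mul_comul (a b : H) : ↑Q.drinfeldUnit * Q.Δ (Q.S a * Q.α * b) =
    Q.SS (flip (Q.Δ a)) * Q.γ * Q.Δ b := by
  rw [map_mul, map_mul, ← mul_assoc, ← mul_assoc, drinfeldUnit_mul_comul_S,
    mul_assoc _ _ (Q.Δ Q.α), drinfeldUnit_mul_comul_α]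

/-- The transformation of `γ` under a twist. -/
theorem tmul_mul_γ (hF : Q'.IsTwistBy Q.toQuasiBialgebra F) (hα : w * Q'.α = Q.twistα F)
    (hS : ∀ a, Q.S a * w = w * Q'.S a) :
    Q.SS (flip (F : H ⊗[𝕜] H)) * ((w ⊗ₜ[𝕜] w) * Q'.γ) * F =
      Q.drinfeldUnit * Q.Δ (Q.twistα F) := by
  -- F_δ Δ(S(x) α y) = (S ⊗ S)Δᵀ(x) γ Δ(y), which is linear in x ⊗ y and hence may be evaluated at
  -- F⁻¹, giving α_F.
  have e : ∀ t, ↑Q.drinfeldUnit * Q.Δ (evMap Q.S.toLinearMap Q.α (AlgHom.id 𝕜 H) t) =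
      Q.γMap (Q.ascInv (leg₄ 𝕜 H 0).toLinearMap (leg₄ 𝕜 H 1).toLinearMap
        (leg₄ 𝕜 H 2).toLinearMap * Q.asc (Q.conv (leg₄ 𝕜 H 0).toLinearMap
        (leg₄ 𝕜 H 1).toLinearMap) (leg₄ 𝕜 H 2).toLinearMap (leg₄ 𝕜 H 3).toLinearMap *
        mulMap (Q.conv (leg₄ 𝕜 H 0).toLinearMap (leg₄ 𝕜 H 1).toLinearMap)
          (Q.conv (leg₄ 𝕜 H 2).toLinearMap (leg₄ 𝕜 H 3).toLinearMap) t) := fun t => by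
    induction t with
    | zero => simp
    | add x y hx hy => simp only [map_add, mul_add, hx, hy]
    | tmul x y =>
      rw [mulMap_tmul, conv_apply, conv_apply, ← conv_leg₄, γMap_mul, ← γ_eq, evMap_tmul]
      exact drinfeldUnit_mul_comul x y
  rw [twistα_eq, e, ← hF.contract_γ_element (ι := fun i => (leg₄ 𝕜 H i).toLinearMap) isHom_leg₄
    com_leg₄ Q.lEq_γMap_inner, ← conv_leg₄, γMap_mul, ← tmul_mul_γMap hα hS, ← γ_eq]

/-- The transformation of the Drinfeld twist under a twist. -/
theorem drinfeldUnit_twist (hF : Q'.IsTwistBy Q.toQuasiBialgebra F) {w : Hˣ}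
    (hα : w * Q'.α = Q.twistα F) (hS : ∀ a, Q.S a * w = w * Q'.S a) :
    Q.SS (flip (F : H ⊗[𝕜] H)) * ((w : H) ⊗ₜ[𝕜] (w : H)) * Q'.drinfeldUnit * F =
      Q.drinfeldUnit * Q.Δ w := by
  have hu : ((↑w⁻¹ : H) ⊗ₜ[𝕜] (↑w⁻¹ : H)) * ((w : H) ⊗ₜ[𝕜] (w : H)) = 1 := by
    simp [Algebra.TensorProduct.one_def]
  have hu' : ((w : H) ⊗ₜ[𝕜] (w : H)) * ((↑w⁻¹ : H) ⊗ₜ[𝕜] (↑w⁻¹ : H)) = 1 := by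
    simp [Algebra.TensorProduct.one_def]
  have hf : Q.SS (flip (↑F⁻¹ : H ⊗[𝕜] H)) * Q.SS (flip (F : H ⊗[𝕜] H)) = 1 := by
    rw [← SS_mul, ← flip_mul, Units.mul_inv, flip_one, SS_one]
  have hf' : Q.SS (flip (F : H ⊗[𝕜] H)) * Q.SS (flip (↑F⁻¹ : H ⊗[𝕜] H)) = 1 := by
    rw [← SS_mul, ← flip_mul, Units.inv_mul, flip_one, SS_one]
  have hg : ∀ t : H ⊗[𝕜] H, Q.SS t * ((w : H) ⊗ₜ[𝕜] (w : H)) =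
      ((w : H) ⊗ₜ[𝕜] (w : H)) * Q'.SS t := fun t => by
    induction t with
    | zero => simp
    | add x y hx hy => simp only [map_add, mul_add, add_mul, hx, hy]
    | tmul x y => simp [hS]
  -- Solving the claimed identity for F_δ' gives a candidate; it is checked against the two
  -- properties that characterize the Drinfeld twist of `Q'`.
  have key : ((↑w⁻¹ : H) ⊗ₜ[𝕜] (↑w⁻¹ : H)) * Q.SS (flip (↑F⁻¹ : H ⊗[𝕜] H)) * Q.drinfeldUnit *
      Q.Δ w * ↑F⁻¹ = Q'.drinfeldUnit := by
    refine Q'.eq_drinfeldUnit ?_ fun a => ?_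
    · have e := tmul_mul_γ hF hα hS
      rw [← hα, map_mul] at e
      calc _ = ((↑w⁻¹ : H) ⊗ₜ[𝕜] (↑w⁻¹ : H)) * (Q.SS (flip (↑F⁻¹ : H ⊗[𝕜] H)) *
            (Q.drinfeldUnit * (Q.Δ w * Q.Δ Q'.α))) * ↑F⁻¹ := by
            rw [hF.comul]
            simp only [mul_assoc, Units.inv_mul_cancel_left]
        _ = _ := by
            rw [← e]
            simp only [mul_assoc, Units.mul_inv, mul_one]
            rw [← mul_assoc (Q.SS _), hf, one_mul, ← mul_assoc, hu, one_mul]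
    · have hg' : ∀ t : H ⊗[𝕜] H, Q'.SS t = ((↑w⁻¹ : H) ⊗ₜ[𝕜] (↑w⁻¹ : H)) *
          (Q.SS t * ((w : H) ⊗ₜ[𝕜] (w : H))) := fun t => by
        rw [hg, ← mul_assoc, hu, one_mul]
      calc _ = ((↑w⁻¹ : H) ⊗ₜ[𝕜] (↑w⁻¹ : H)) * Q.SS (flip (↑F⁻¹ : H ⊗[𝕜] H)) *
            (Q.drinfeldUnit * Q.Δ (w * Q'.S a)) * ↑F⁻¹ := by
            rw [hF.comul, map_mul]
            simp only [mul_assoc, Units.inv_mul_cancel_left]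
        _ = _ := by
            rw [← hS, map_mul, ← mul_assoc (Q.drinfeldUnit : H ⊗[𝕜] H), drinfeldUnit_mul_comul_S,
              hg', hF.comul, flip_mul, flip_mul, SS_mul, SS_mul]
            simp only [mul_assoc]
            rw [← mul_assoc (_ ⊗ₜ _) (_ ⊗ₜ _), hu', one_mul, ← mul_assoc (Q.SS (flip ↑F)), hf',
              one_mul]
  rw [← key]
  simp only [mul_assoc, Units.inv_mul, mul_one]
  rw [← mul_assoc (_ ⊗ₜ _) (_ ⊗ₜ _), hu', one_mul, ← mul_assoc, hf', one_mul]

end QuasiHopfAlgebra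

end QHA

/-! ### Conjugate structures -/

namespace QHA

section Star

variable {H A B : Type*} [Ring H] [Algebra ℂ H] [StarRing H] [StarModule ℂ H]
  [Ring A] [Algebra ℂ A] [StarRing A] [StarModule ℂ A]
  [Ring B] [Algebra ℂ B] [StarRing B] [StarModule ℂ B]

/-- The conjugate `a ↦ f(a†)†` of an algebra homomorphism. -/
noncomputable def conjHom (f : A →ₐ[ℂ] B) : A →ₐ[ℂ] B where
  toFun a := star (f (star a))
  map_one' := by simp
  map_mul' := by simp
  map_zero' := by simp
  map_add' := by simp
  commutes' r := by simp [Algebra.algebraMap_eq_smul_one]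

@[simp]
theorem conjHom_apply (f : A →ₐ[ℂ] B) (a : A) : conjHom f a = star (f (star a)) := rfl

theorem star_flip (x : H ⊗[ℂ] H) : star (flip x) = flip (star x) := by
  induction x with
  | zero => simp
  | add a b ha hb => simp [ha, hb]
  | tmul a b => simp

theorem star_counitOne (ε : H →ₐ[ℂ] ℂ) (x : H ⊗[ℂ] H) :
    counitOne (conjHom ε) (star x) = star (counitOne ε x) := by
  induction x with
  | zero => simp
  | add a b ha hb => simp [ha, hb]
  | tmul a b => simp

theorem star_oneCounit (ε : H →ₐ[ℂ] ℂ) (x : H ⊗[ℂ] H) :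
    oneCounit (conjHom ε) (star x) = star (oneCounit ε x) := by
  induction x with
  | zero => simp
  | add a b ha hb => simp [ha, hb]
  | tmul a b => simp

theorem star_oneCounitOne (ε : H →ₐ[ℂ] ℂ) (x : H ⊗[ℂ] H ⊗[ℂ] H) :
    oneCounitOne (conjHom ε) (star x) = star (oneCounitOne ε x) := by
  induction x with
  | zero => simp
  | add a b ha hb => simp [ha, hb]
  | tmul a b => simp [oneCounitOne, star_oneCounit]

theorem star_tensorOne₃ (x : H ⊗[ℂ] H ⊗[ℂ] H) : tensorOne₃ (star x) = star (tensorOne₃ x) := by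
  induction x with
  | zero => simp
  | add a b ha hb => simp [ha, hb]
  | tmul a b => simp

theorem star_oneTensor₃ (x : H ⊗[ℂ] H ⊗[ℂ] H) : oneTensor₃ (star x) = star (oneTensor₃ x) := by
  induction x with
  | zero => simp
  | add a b ha hb => simp [ha, hb]
  | tmul a b =>
    induction a with
    | zero => simp
    | add x y hx hy =>
      rw [TensorProduct.add_tmul, star_add, map_add, hx, hy, map_add, star_add]
    | tmul x y => simp

variable (Δ : H →ₐ[ℂ] H ⊗[ℂ] H)

theorem star_comulOne (x : H ⊗[ℂ] H) :
    comulOne (conjHom Δ) (star x) = star (comulOne Δ x) := by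
  induction x with
  | zero => simp
  | add a b ha hb => simp [ha, hb]
  | tmul a b => simp

theorem star_assoc_symm_tmul (a : H) (t : H ⊗[ℂ] H) :
    star ((TensorProduct.assoc ℂ H H H).symm (a ⊗ₜ t)) =
      (TensorProduct.assoc ℂ H H H).symm (star a ⊗ₜ star t) := by
  induction t with
  | zero => simp
  | add a b ha hb => simp [TensorProduct.tmul_add, ha, hb]
  | tmul a b => simp

theorem star_assoc_tmul (t : H ⊗[ℂ] H ⊗[ℂ] H) (a : H) :
    star (TensorProduct.assoc ℂ (H ⊗[ℂ] H) H H (t ⊗ₜ a)) =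
      TensorProduct.assoc ℂ (H ⊗[ℂ] H) H H (star t ⊗ₜ star a) := by
  induction t with
  | zero => simp
  | add a b ha hb => simp [TensorProduct.add_tmul, ha, hb]
  | tmul a b => simp

theorem star_oneComul (x : H ⊗[ℂ] H) :
    oneComul (conjHom Δ) (star x) = star (oneComul Δ x) := by
  induction x with
  | zero => simp
  | add a b ha hb => simp [ha, hb]
  | tmul a b => simp [oneComul_tmul, star_assoc_symm_tmul]

theorem star_comulOneOne (x : H ⊗[ℂ] H ⊗[ℂ] H) :
    comulOneOne (conjHom Δ) (star x) = star (comulOneOne Δ x) := by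
  induction x with
  | zero => simp
  | add a b ha hb => simp [ha, hb]
  | tmul a b =>
    induction a with
    | zero => simp
    | add x y hx hy =>
      rw [TensorProduct.add_tmul, star_add, map_add, hx, hy, map_add, star_add]
    | tmul x y => simp

theorem star_oneComulOne (x : H ⊗[ℂ] H ⊗[ℂ] H) :
    oneComulOne (conjHom Δ) (star x) = star (oneComulOne Δ x) := by
  induction x with
  | zero => simp
  | add a b ha hb => simp [ha, hb]
  | tmul a b => simp [oneComulOne_tmul, star_oneComul, star_assoc_tmul]

theorem star_oneOneComul (x : H ⊗[ℂ] H ⊗[ℂ] H) :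
    oneOneComul (conjHom Δ) (star x) = star (oneOneComul Δ x) := by
  induction x with
  | zero => simp
  | add a b ha hb => simp [ha, hb]
  | tmul a b => simp

/-- The homomorphism of groups of units induced by an algebra homomorphism. -/
def unitsMap {A B : Type*} [Ring A] [Algebra ℂ A] [Ring B] [Algebra ℂ B] (f : A →ₐ[ℂ] B) :
    Aˣ →* Bˣ := Units.map (f : A →* B)

/-- The conjugate quasi-bialgebra, with co-product `a ↦ Δ(a†)†` and co-associator `(Φ†)⁻¹`. -/
noncomputable def QuasiBialgebra.conj (P : QuasiBialgebra ℂ H) : QuasiBialgebra ℂ H where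
  ε := conjHom P.ε
  Δ := conjHom P.Δ
  Φ := (star P.Φ)⁻¹
  counit_comul a := by
    rw [conjHom_apply, star_counitOne, P.counit_comul, star_star]
  comul_counit a := by
    rw [conjHom_apply, star_oneCounit, P.comul_counit, star_star]
  quasi_coassoc a := by
    rw [conjHom_apply, star_oneComul, star_comulOne, P.quasi_coassoc, inv_inv]
    simp [mul_assoc, Units.coe_star_inv]
  pentagon := by
    -- The inverse of the pentagon has its factors reversed, and the conjugation in the next line
    -- reverses them back. This is why (Φ†)⁻¹, rather than Φ†, is the conjugate co-associator.
    have e : unitsMap (oneOneComul P.Δ) P.Φ⁻¹ * unitsMap (comulOneOne P.Δ) P.Φ⁻¹ =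
        unitsMap oneTensor₃ P.Φ⁻¹ * unitsMap (oneComulOne P.Δ) P.Φ⁻¹ *
          unitsMap tensorOne₃ P.Φ⁻¹ := by
      rw [map_inv, map_inv, ← mul_inv_rev, map_inv, map_inv, map_inv, ← mul_inv_rev,
        ← mul_inv_rev, ← mul_assoc]
      exact congrArg _ (Units.ext P.pentagon)
    have e := congrArg star (congrArg Units.val e)
    rw [← star_inv, Units.coe_star, star_comulOneOne, star_oneOneComul, star_oneComulOne,
      star_oneTensor₃, star_tensorOne₃]
    simpa [unitsMap, mul_assoc] using e
  counit_coassociator := by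
    have e := congrArg (oneCounitOne P.ε) P.Φ.inv_mul
    rw [map_mul, P.counit_coassociator, mul_one, map_one] at e
    rw [← star_inv, Units.coe_star, star_oneCounitOne, e, star_one]

end Star

end QHA

namespace QHA

namespace QuasiHopfAlgebra

open QuasiBialgebra

variable {H : Type*} [Ring H] [Algebra ℂ H] [StarRing H] [StarModule ℂ H]
  (Q : QuasiHopfAlgebra ℂ H)

/-- The conjugate antipode `a ↦ S⁻¹(a†)†`. -/
noncomputable def conjAntipode : H ≃ₗ[ℂ] H where
  toFun a := star (Q.S.symm (star a))
  invFun a := star (Q.S (star a))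
  map_add' := by simp
  map_smul' := by simp
  left_inv a := by simp
  right_inv a := by simp

@[simp]
theorem conjAntipode_apply (a : H) : Q.conjAntipode a = star (Q.S.symm (star a)) := rfl

/-- S⁻¹ and † both reverse products, so x β S(y) becomes S̃(x†) S⁻¹(β)† y†: a β-contraction turns
into an α-contraction. Conjugation therefore exchanges the roles of α and β, and of Φ and Φ⁻¹. -/
theorem evMap_conjAntipode (t : H ⊗[ℂ] H) :
    evMap Q.conjAntipode.toLinearMap (star (Q.S.symm Q.β)) (AlgHom.id ℂ H) (star t) =
      star (Q.S.symm (coevMap (AlgHom.id ℂ H) Q.β Q.S.toLinearMap t)) := by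
  induction t with
  | zero => simp
  | add a b ha hb => simp [ha, hb]
  | tmul a b => simp [S_symm_mul, mul_assoc]

theorem coevMap_conjAntipode (t : H ⊗[ℂ] H) :
    coevMap (AlgHom.id ℂ H) (star (Q.S.symm Q.α)) Q.conjAntipode.toLinearMap (star t) =
      star (Q.S.symm (evMap Q.S.toLinearMap Q.α (AlgHom.id ℂ H) t)) := by
  induction t with
  | zero => simp
  | add a b ha hb => simp [ha, hb]
  | tmul a b => simp [S_symm_mul, mul_assoc]

theorem evCoevMap_conjAntipode (t : H ⊗[ℂ] H ⊗[ℂ] H) :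
    evCoevMap Q.conjAntipode.toLinearMap (star (Q.S.symm Q.β)) (AlgHom.id ℂ H)
      (star (Q.S.symm Q.α)) Q.conjAntipode.toLinearMap (star t) =
      star (Q.S.symm (coevEvMap (AlgHom.id ℂ H) Q.β Q.S.toLinearMap Q.α t)) := by
  induction t with
  | zero => simp
  | add a b ha hb => simp [ha, hb]
  | tmul a b =>
    rw [TensorProduct.star_tmul, evCoevMap_tmul', evMap_conjAntipode, coevEvMap_tmul']
    simp [S_symm_mul, mul_assoc]

theorem coevEvMap_conjAntipode (t : H ⊗[ℂ] H ⊗[ℂ] H) :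
    coevEvMap (AlgHom.id ℂ H) (star (Q.S.symm Q.α)) Q.conjAntipode.toLinearMap
      (star (Q.S.symm Q.β)) (star t) =
      star (Q.S.symm (evCoevMap Q.S.toLinearMap Q.α (AlgHom.id ℂ H) Q.β Q.S.toLinearMap t)) := by
  induction t with
  | zero => simp
  | add a b ha hb => simp [ha, hb]
  | tmul a b =>
    rw [TensorProduct.star_tmul, evCoevMap_tmul', coevEvMap_tmul', coevMap_conjAntipode]
    simp [S_symm_mul, mul_assoc]

/-- The conjugate quasi-Hopf algebra, with antipode `a ↦ S⁻¹(a†)†` and canonical elements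
`S⁻¹(β)†` and `S⁻¹(α)†`. -/
noncomputable def conj : QuasiHopfAlgebra ℂ H where
  toQuasiBialgebra := Q.toQuasiBialgebra.conj
  S := Q.conjAntipode
  S_one := by simp [S_symm_one]
  S_mul := by simp [S_symm_mul]
  α := star (Q.S.symm Q.β)
  β := star (Q.S.symm Q.α)
  antipode_coassociator := by
    have e := Q.evCoevMap_conjAntipode (↑Q.Φ⁻¹ : H ⊗[ℂ] H ⊗[ℂ] H)
    rw [Q.isAntipode.coassociator_inv, S_symm_one, star_one] at e
    exact e
  antipode_coassociator_inv := by
    have e := Q.coevEvMap_conjAntipode (Q.Φ : H ⊗[ℂ] H ⊗[ℂ] H)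
    rw [Q.isAntipode.coassociator, S_symm_one, star_one] at e
    rw [QuasiBialgebra.conj, inv_inv]
    exact e
  antipode_left a := by
    have e := Q.evMap_conjAntipode (Q.Δ (star a))
    rw [Q.isAntipode.right, map_smul, star_smul] at e
    exact e
  antipode_right a := by
    have e := Q.coevMap_conjAntipode (Q.Δ (star a))
    rw [Q.isAntipode.left, map_smul, star_smul] at e
    exact e

theorem conj_S : Q.conj.S = Q.conjAntipode := rfl
theorem conj_α : Q.conj.α = star (Q.S.symm Q.β) := rfl
theorem conj_Δ_apply (a : H) : Q.conj.Δ a = star (Q.Δ (star a)) := rfl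

theorem conj_SS (x : H ⊗[ℂ] H) : Q.conj.SS (star x) = star (Q.SS.symm x) := by
  induction x with
  | zero => simp
  | add a b ha hb => simp [ha, hb]
  | tmul a b => simp [conj_S]

theorem conj_γMap (t : (H ⊗[ℂ] H) ⊗[ℂ] (H ⊗[ℂ] H)) :
    Q.conj.γMap (star t) = star (Q.SS.symm (flip (Q.δMap t))) := by
  induction t using tmul₄_induction with
  | zero => simp
  | add a b ha hb => simp only [map_add, star_add, ha, hb]
  | tmul a b c d => simp [conj_S, conj_α, S_symm_mul, mul_assoc]

/-- The tensors defining γ and δ are exchanged by conjugation, because the conjugate co-associator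
is inverted and † reverses products. -/
theorem conj_γ : Q.conj.γ = star (Q.SS.symm (flip Q.δ)) := by
  rw [δ, ← conj_γMap, star_mul, ← star_tensorOne₃, ← star_comulOneOne, γ]
  have e : Q.conj.Φ⁻¹ = star Q.Φ := inv_inv _
  rw [e]
  rfl

/-- The Drinfeld twist of the conjugate quasi-Hopf algebra is the inverse of the conjugate of the
second Drinfeld twist. -/
theorem star_secondDrinfeldUnit_mul_drinfeldUnit_conj :
    star (Q.secondDrinfeldUnit : H ⊗[ℂ] H) * Q.conj.drinfeldUnit = 1 := by
  have e : (↑(star Q.secondDrinfeldUnit)⁻¹ : H ⊗[ℂ] H) = Q.conj.drinfeldUnit := by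
    -- Conjugates of δ₀ F₀ = Δ(S⁻¹(β)), where δ₀ = (S⁻¹ ⊗ S⁻¹)δᵀ, and of F₀ Δ(S⁻¹(a)) = (S⁻¹ ⊗
    -- S⁻¹)Δᵀ(a) F₀.
    refine Q.conj.eq_drinfeldUnit ?_ fun a => ?_
    · rw [Units.inv_mul_eq_iff_eq_mul, conj_γ, conj_Δ_apply, conj_α, star_star, Units.coe_star,
        ← star_mul, SS_symm_δ_mul_secondDrinfeldUnit]
    · rw [Units.inv_mul_eq_iff_eq_mul, ← mul_assoc, Units.eq_mul_inv_iff_mul_eq, conj_Δ_apply,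
        conj_Δ_apply, conj_S, conjAntipode_apply, star_star, ← star_flip, conj_SS,
        Units.coe_star, ← star_mul, ← star_mul, secondDrinfeldUnit_mul_comul]
  rw [← e, ← Units.coe_star, Units.mul_inv]

end QuasiHopfAlgebra

end QHA

/-! ### The element w and the conjugates of the Drinfeld twists -/

namespace QHA

namespace StarQuasiHopfAlgebra

open QuasiBialgebra QuasiHopfAlgebra

variable {H : Type*} [Ring H] [Algebra ℂ H] [StarRing H] [StarModule ℂ H]
  (Q : StarQuasiHopfAlgebra H)

/-- The conjugate quasi-bialgebra is the twist by the `*`-canonical element. -/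
theorem isTwistBy_conj : Q.toQuasiBialgebra.conj.IsTwistBy Q.toQuasiBialgebra Q.Ω where
  isTwist := Q.isTwist_Ω
  counit := AlgHom.ext fun a => by
    rw [← star_star (Q.ε a), ← Q.counit_star]
    rfl
  comul a := by
    rw [← star_star a, ← Q.comul_star, star_star]
    exact conjHom_apply Q.Δ a
  coassociator := Q.coassociator_star

theorem isAntipode_twist : Q.toQuasiBialgebra.conj.IsAntipode (AlgHom.id ℂ H) Q.S.toLinearMap
    (Q.twistα Q.Ω) (Q.twistβ Q.Ω) :=
  Q.isAntipode.twist Q.isTwistBy_conj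

theorem isAntipode_conj : Q.toQuasiBialgebra.conj.IsAntipode (AlgHom.id ℂ H)
    Q.conjAntipode.toLinearMap (star (Q.S.symm Q.β)) (star (Q.S.symm Q.α)) :=
  Q.conj.isAntipode

/-- The invertible element relating the conjugate and the twisted antipode structures. -/
noncomputable def intertwiner : Hˣ := Q.isAntipode_twist.unit Q.isAntipode_conj

theorem S_mul_intertwiner (a : H) : Q.S a * Q.intertwiner = Q.intertwiner * Q.conj.S a :=
  (Q.isAntipode_twist.evCoevMap_intertwines Q.isAntipode_conj a).symm

theorem intertwiner_mul_α : ↑Q.intertwiner * Q.conj.α = Q.twistα Q.Ω :=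
  Q.isAntipode_twist.evCoevMap_mul Q.isAntipode_conj

theorem isIntertwiner_intertwiner : Q.IsIntertwiner Q.intertwiner :=
  ⟨Q.intertwiner_mul_α, Q.isAntipode_twist.mul_evCoevMap Q.isAntipode_conj,
    fun a => (Units.eq_mul_inv_iff_mul_eq _).mpr (Q.S_mul_intertwiner a)⟩

theorem IsIntertwiner.eq_intertwiner {w : Hˣ} (h : Q.IsIntertwiner w) : w = Q.intertwiner :=
  Units.ext (Q.isAntipode_conj.eq_evCoevMap h.1
    fun a => ((Units.eq_mul_inv_iff_mul_eq _).mp (h.2.2 a)).symm)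

/-- The twisting formula for the Drinfeld twist F̃ of the conjugate algebra reads (S ⊗ S)Ωᵀ (w ⊗ w)
F̃ Ω = F_δ Δ(w), and F̃ is the inverse of F₀†. -/
theorem star_secondDrinfeldUnit : star (Q.secondDrinfeldUnit : H ⊗[ℂ] H) =
    ↑Q.Ω * Q.Δ ↑Q.intertwiner⁻¹ * ↑Q.drinfeldUnit⁻¹ * Q.SS (flip (Q.Ω : H ⊗[ℂ] H)) *
      ((Q.intertwiner : H) ⊗ₜ[ℂ] (Q.intertwiner : H)) := by
  have e := drinfeldUnit_twist (Q' := Q.conj) Q.isTwistBy_conj Q.intertwiner_mul_α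
    Q.S_mul_intertwiner
  refine (Units.mul_left_inj Q.conj.drinfeldUnit).mp ((Units.mul_left_inj Q.Ω).mp ?_)
  rw [star_secondDrinfeldUnit_mul_drinfeldUnit_conj, one_mul]
  simp only [mul_assoc] at e ⊢
  rw [e, Units.inv_mul_cancel_left, ← map_mul, Units.inv_mul, map_one, mul_one]

theorem conj_SS_eq (t : H ⊗[ℂ] H) :
    Q.SS t * ((Q.intertwiner : H) ⊗ₜ[ℂ] (Q.intertwiner : H)) =
      ((Q.intertwiner : H) ⊗ₜ[ℂ] (Q.intertwiner : H)) * Q.conj.SS t := by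
  induction t with
  | zero => simp
  | add x y hx hy => simp only [map_add, mul_add, add_mul, hx, hy]
  | tmul x y => simp [S_mul_intertwiner]

theorem star_drinfeldUnit : star (Q.drinfeldUnit : H ⊗[ℂ] H) =
    ↑Q.Ω * Q.Δ (Q.S.symm ↑Q.intertwiner⁻¹) * ↑Q.secondDrinfeldUnit⁻¹ *
      Q.SS.symm (flip (Q.Ω : H ⊗[ℂ] H)) *
        (Q.S.symm ↑Q.intertwiner ⊗ₜ[ℂ] Q.S.symm ↑Q.intertwiner) := by
  set w := Q.intertwiner with hw
  have hu : ((w : H) ⊗ₜ[ℂ] (w : H)) * ((↑w⁻¹ : H) ⊗ₜ[ℂ] (↑w⁻¹ : H)) = 1 := by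
    simp [Algebra.TensorProduct.one_def]
  -- F₀ = (S⁻¹ ⊗ S⁻¹)F_δᵀ, and conjugation turns S⁻¹ into S̃. Then `w` replaces S̃ by S, which (S⁻¹
  -- ⊗ S⁻¹)T undoes.
  have e₁ : star (Q.secondDrinfeldUnit : H ⊗[ℂ] H) =
      Q.conj.SS (flip (star (Q.drinfeldUnit : H ⊗[ℂ] H))) := by
    rw [← star_flip, conj_SS]
    rfl
  have e₂ : Q.SS (flip (star (Q.drinfeldUnit : H ⊗[ℂ] H))) =
      ((w : H) ⊗ₜ[ℂ] (w : H)) * (↑Q.Ω * Q.Δ ↑w⁻¹ * ↑Q.drinfeldUnit⁻¹ *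
        Q.SS (flip (Q.Ω : H ⊗[ℂ] H))) := by
    have e := Q.conj_SS_eq (flip (star (Q.drinfeldUnit : H ⊗[ℂ] H)))
    rw [← e₁, star_secondDrinfeldUnit, ← mul_assoc] at e
    have e' := congrArg (· * ((↑w⁻¹ : H) ⊗ₜ[ℂ] (↑w⁻¹ : H))) e
    simpa only [mul_assoc, ← hw, hu, mul_one] using e'
  -- After reversal by (S⁻¹ ⊗ S⁻¹)T, the co-product of `w⁻¹` stands to the right of F₀⁻¹; the
  -- intertwining property of F₀ moves it to the left.
  have e₃ : ↑Q.secondDrinfeldUnit⁻¹ * Q.SS.symm (flip (Q.Δ ↑w⁻¹)) =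
      Q.Δ (Q.S.symm ↑w⁻¹) * ↑Q.secondDrinfeldUnit⁻¹ := by
    rw [Units.inv_mul_eq_iff_eq_mul, ← mul_assoc, Units.eq_mul_inv_iff_mul_eq,
      secondDrinfeldUnit_mul_comul]
  have e₄ := congrArg (fun x => Q.SS.symm (flip x)) e₂
  simp only [flip_SS, flip_flip, LinearEquiv.symm_apply_apply, flip_mul, SS_symm_mul, flip_tmul,
    SS_symm_tmul] at e₄
  rw [e₄, mul_assoc _ (Q.Δ _), ← e₃]
  simp only [mul_assoc]
  rfl

theorem inv_Ω_mul_star_drinfeldUnit :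
    ↑Q.Ω⁻¹ * star (Q.drinfeldUnit : H ⊗[ℂ] H) *
      (Q.S.symm ↑Q.intertwiner⁻¹ ⊗ₜ[ℂ] Q.S.symm ↑Q.intertwiner⁻¹) *
        Q.SS.symm (flip (↑Q.Ω⁻¹ : H ⊗[ℂ] H)) * ↑Q.secondDrinfeldUnit *
          Q.Δ (Q.S.symm ↑Q.intertwiner) = 1 := by
  have h₁ : ((Q.S.symm ↑Q.intertwiner) ⊗ₜ[ℂ] (Q.S.symm ↑Q.intertwiner)) *
      ((Q.S.symm ↑Q.intertwiner⁻¹) ⊗ₜ[ℂ] (Q.S.symm ↑Q.intertwiner⁻¹)) = (1 : H ⊗[ℂ] H) := by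
    rw [Algebra.TensorProduct.tmul_mul_tmul, ← S_symm_mul, Units.inv_mul, S_symm_one,
      Algebra.TensorProduct.one_def]
  have h₂ : Q.SS.symm (flip (Q.Ω : H ⊗[ℂ] H)) * Q.SS.symm (flip (↑Q.Ω⁻¹ : H ⊗[ℂ] H)) = 1 := by
    rw [← SS_symm_mul, ← flip_mul, Units.inv_mul, flip_one, SS_symm_one]
  have h₃ : Q.Δ (Q.S.symm ↑Q.intertwiner⁻¹) * Q.Δ (Q.S.symm ↑Q.intertwiner) = 1 := by
    rw [← map_mul, ← S_symm_mul, Units.mul_inv, S_symm_one, map_one]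
  rw [star_drinfeldUnit]
  simp only [mul_assoc, Units.inv_mul_cancel_left]
  rw [← mul_assoc (_ ⊗ₜ _) (_ ⊗ₜ _), h₁, one_mul, ← mul_assoc (Q.SS.symm _) (Q.SS.symm _), h₂,
    one_mul, Units.inv_mul_cancel_left, h₃]

end StarQuasiHopfAlgebra

end QHA

theorem mainTheorem1 {H : Type*} [Ring H] [Algebra ℂ H] [StarRing H] [StarModule ℂ H]
    (Q : QHA.StarQuasiHopfAlgebra H) :
    ∃ (w : Hˣ) (Fδ F₀ : (H ⊗[ℂ] H)ˣ),
      (Q.IsIntertwiner w ∧ ∀ w' : Hˣ, Q.IsIntertwiner w' → w' = w) ∧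
      (Fδ : H ⊗[ℂ] H) = Q.drinfeldTwist ∧
      (F₀ : H ⊗[ℂ] H) = Q.secondDrinfeldTwist ∧
      -- the conjugate of the Drinfeld twist
      star (Fδ : H ⊗[ℂ] H) =
        ↑Q.Ω * Q.Δ (Q.S.symm ↑w⁻¹) * ↑F₀⁻¹ * Q.SS.symm (QHA.flip (Q.Ω : H ⊗[ℂ] H)) *
          (Q.S.symm ↑w ⊗ₜ[ℂ] Q.S.symm ↑w) ∧
      -- the conjugate of the second Drinfeld twist
      star (F₀ : H ⊗[ℂ] H) =
        ↑Q.Ω * Q.Δ ↑w⁻¹ * ↑Fδ⁻¹ * Q.SS (QHA.flip (Q.Ω : H ⊗[ℂ] H)) *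
          ((w : H) ⊗ₜ[ℂ] (w : H)) ∧
      -- the operator commuting with the co-product is trivial
      ↑Q.Ω⁻¹ * star (Fδ : H ⊗[ℂ] H) * (Q.S.symm ↑w⁻¹ ⊗ₜ[ℂ] Q.S.symm ↑w⁻¹) *
        Q.SS.symm (QHA.flip (↑Q.Ω⁻¹ : H ⊗[ℂ] H)) * ↑F₀ * Q.Δ (Q.S.symm ↑w) = 1 := by
  refine ⟨Q.intertwiner, Q.drinfeldUnit, Q.secondDrinfeldUnit,
    ⟨Q.isIntertwiner_intertwiner, fun w' hw' => hw'.eq_intertwiner⟩, Q.coe_drinfeldUnit,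
    Q.coe_secondDrinfeldUnit, Q.star_drinfeldUnit, Q.star_secondDrinfeldUnit,
    Q.inv_Ω_mul_star_drinfeldUnit⟩
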